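/- Fix an integer $N\ge 3$. For $1<s<2$ and $1\le p<\infty$ let $B(s,p)$ be the space of all (a.e. equivalence classes of) real functions $u\in W^{1,p}(\mathbb{R}^N)$ with finite norm $$\|u\|_{s,p}=\|u\|_{L^p}+\|Du\|_{L^p}+\left(\int_{\mathbb{R}^N}\int_{\mathbb{R}^N}\frac{|Du(x)-Du(y)|^p}{|x-y|^{N+(s-1)p}}\,dx\,dy\right)^{1/p},$$ where $Du$ is the weak gradient, and let $\mathcal{D}'(\mathbb{R}^N)$ be the space of distributions with its usual topology. Then $C_c^2(\mathbb{R}^N)\subset B(2-\tfrac2N,N)$, and there is exactly one continuous map $\mathscr{H}:B(2-\tfrac2N,N)\to\mathcal{D}'(\mathbb{R}^N)$ such that $$\langle\mathscr{H}(u),\varphi\rangle=\int_{\mathbb{R}^N}\det(D^2u)\,\varphi\,dx\qquad\text{for all }u\in C_c^2(\mathbb{R}^N),\ \varphi\in C_c^\infty(\mathbb{R}^N).$$ Moreover, there is a constant $C$ depending only on $N$ such that for all $u_1,u_2\in B(2-\tfrac2N,N)$ and all $\varphi\in C_c^\infty(\mathbb{R}^N)$ $$|\langle\mathscr{H}(u_1)-\mathscr{H}(u_2),\varphi\rangle|\le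 C\,\|u_1-u_2\|_{2-\frac2N,N}\left(\|u_1\|_{2-\frac2N,N}^{N-1}+\|u_2\|_{2-\frac2N,N}^{N-1}\right)\|D^2\varphi\|_{L^\infty(\mathbb{R}^N)}.$$ Each $\mathscr{H}(u)$ is of order at most two, that is, it extends to a continuous linear functional on $C_c^2(\mathbb{R}^N)$, and with these extensions the estimate holds, with the same $C$, for all $\varphi\in C_c^2(\mathbb{R}^N)$. -/

import Mathlib

open MeasureTheory TopologicalSpace
open scoped ENNReal NNReal Distributions

noncomputable section

namespace HessianDet

/-- Euclidean space `ℝ^N`. -/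
abbrev E (N : ℕ) : Type := EuclideanSpace ℝ (Fin N)

/-- `G` is the weak (distributional) gradient of `u` on `ℝ^N`:
`∫ u ∂ᵢφ = - ∫ Gᵢ φ` for all `φ ∈ C_c^∞(ℝ^N)` and all `i`. It is only used for `u`, `G` in `L^p`. -/
def HasWeakGradient {N : ℕ} (u : E N → ℝ) (G : E N → E N) : Prop :=
  ∀ (φ : 𝓓((⊤ : Opens (E N)), ℝ)) (i : Fin N),
    ∫ x, u x * fderiv ℝ φ x (EuclideanSpace.single i 1) = -∫ x, G x i * φ x

/-- The Gagliardo (Slobodeckij) seminorm of order `σ` and exponent `p` of a vector field: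
`(∫∫ |G(x) - G(y)|^p / |x - y|^(N + σ p) dx dy)^(1/p)`, with values in `[0, ∞]`. -/
def gagliardo {N : ℕ} (σ : ℝ) (p : ℝ≥0) (G : E N → E N) : ℝ≥0∞ :=
  (∫⁻ z : E N × E N,
    ‖G z.1 - G z.2‖ₑ ^ (p : ℝ) / ‖z.1 - z.2‖ₑ ^ ((N : ℝ) + σ * (p : ℝ))) ^ (1 / (p : ℝ))

instance instFactOneLeCoe {p : ℝ≥0} [h : Fact (1 ≤ p)] : Fact (1 ≤ (p : ℝ≥0∞)) :=
  ⟨by exact_mod_cast h.out⟩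

instance instFactOneLeNatCast {N : ℕ} [h : Fact (3 ≤ N)] : Fact (1 ≤ (N : ℝ≥0)) :=
  ⟨by exact_mod_cast le_trans (by norm_num) h.out⟩

section Aux

variable {N : ℕ} {σ : ℝ} {p : ℝ≥0}

theorem gagliardo_congr {G G' : E N → E N} (h : G =ᵐ[volume] G') :
    gagliardo σ p G = gagliardo σ p G' := by
  unfold gagliardo
  congr 1
  have h1 : ∀ᵐ z : E N × E N, G z.1 = G' z.1 :=
    Measure.quasiMeasurePreserving_fst.ae h
  have h2 : ∀ᵐ z : E N × E N, G z.2 = G' z.2 :=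
    Measure.quasiMeasurePreserving_snd.ae h
  apply lintegral_congr_ae
  filter_upwards [h1, h2] with z hz1 hz2
  rw [hz1, hz2]

theorem gagliardo_zero [h : Fact (1 ≤ p)] : gagliardo σ p (0 : E N → E N) = 0 := by
  have hp : (0 : ℝ) < p := lt_of_lt_of_le one_pos (by exact_mod_cast h.out)
  simp [gagliardo, hp]

theorem gagliardo_smul [h : Fact (1 ≤ p)] (c : ℝ) (G : E N → E N) :
    gagliardo σ p (c • G) = ‖c‖ₑ * gagliardo σ p G := by
  have hp : (0 : ℝ) < p := lt_of_lt_of_le one_pos (by exact_mod_cast h.out)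
  have key : ∀ z : E N × E N,
      ‖(c • G) z.1 - (c • G) z.2‖ₑ ^ (p : ℝ) / ‖z.1 - z.2‖ₑ ^ ((N : ℝ) + σ * (p : ℝ)) =
      ‖c‖ₑ ^ (p : ℝ) *
        (‖G z.1 - G z.2‖ₑ ^ (p : ℝ) / ‖z.1 - z.2‖ₑ ^ ((N : ℝ) + σ * (p : ℝ))) := by
    intro z
    rw [Pi.smul_apply, Pi.smul_apply, ← smul_sub, enorm_smul,
      ENNReal.mul_rpow_of_nonneg _ _ hp.le, mul_div_assoc]
  unfold gagliardo
  simp_rw [key]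
  rw [lintegral_const_mul' _ _ (ENNReal.rpow_ne_top_of_nonneg hp.le enorm_ne_top),
    ENNReal.mul_rpow_of_nonneg _ _ (by positivity), ← ENNReal.rpow_mul,
    mul_one_div_cancel hp.ne', ENNReal.rpow_one]

theorem gagliardo_add_le [h : Fact (1 ≤ p)] {G G' : E N → E N}
    (hG : AEStronglyMeasurable G volume) (hG' : AEStronglyMeasurable G' volume) :
    gagliardo σ p (G + G') ≤ gagliardo σ p G + gagliardo σ p G' := by
  have hp1 : (1 : ℝ) ≤ p := by exact_mod_cast h.out
  have hp : (0 : ℝ) < p := lt_of_lt_of_le one_pos hp1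
  set w : E N × E N → ℝ≥0∞ := fun z =>
    ((‖z.1 - z.2‖ₑ ^ ((N : ℝ) + σ * (p : ℝ)))⁻¹) ^ (1 / (p : ℝ)) with hw
  have hwm : Measurable w := by
    have : Measurable fun z : E N × E N => ‖z.1 - z.2‖ₑ :=
      (measurable_fst.sub measurable_snd).enorm
    exact ((this.pow_const _).inv).pow_const _
  have key : ∀ (a : ℝ≥0∞) (z : E N × E N),
      a ^ (p : ℝ) / ‖z.1 - z.2‖ₑ ^ ((N : ℝ) + σ * (p : ℝ)) = (a * w z) ^ (p : ℝ) := by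
    intro a z
    rw [ENNReal.mul_rpow_of_nonneg _ _ hp.le, hw, ← ENNReal.rpow_mul,
      one_div_mul_cancel hp.ne', ENNReal.rpow_one, div_eq_mul_inv]
  have hm : ∀ {F : E N → E N}, AEStronglyMeasurable F volume →
      AEMeasurable (fun z : E N × E N => ‖F z.1 - F z.2‖ₑ * w z) volume := by
    intro F hF
    have h1 : AEStronglyMeasurable (fun z : E N × E N => F z.1) volume :=
      hF.comp_quasiMeasurePreserving Measure.quasiMeasurePreserving_fst
    have h2 : AEStronglyMeasurable (fun z : E N × E N => F z.2) volume :=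
      hF.comp_quasiMeasurePreserving Measure.quasiMeasurePreserving_snd
    exact (h1.sub h2).enorm.mul hwm.aemeasurable
  unfold gagliardo
  simp_rw [key]
  refine le_trans ?_ (ENNReal.lintegral_Lp_add_le (hm hG) (hm hG') hp1)
  gcongr with z
  simp only [Pi.add_apply]
  rw [← add_mul]
  gcongr
  calc ‖G z.1 + G' z.1 - (G z.2 + G' z.2)‖ₑ = ‖(G z.1 - G z.2) + (G' z.1 - G' z.2)‖ₑ := by
        congr 1; abel
    _ ≤ _ := enorm_add_le _ _

theorem integrable_mul_of_Lp [h : Fact (1 ≤ p)] {f : E N → ℝ} (hf : MemLp f p volume)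
    {g : E N → ℝ} (hg : Continuous g) (hc : HasCompactSupport g) :
    Integrable (fun x => f x * g x) volume :=
  ((hf.locallyIntegrable (by exact_mod_cast h.out)).integrable_smul_right_of_hasCompactSupport
    hg hc)

theorem integrable_coord_mul_of_Lp [Fact (1 ≤ p)] {G : E N → E N} (hG : MemLp G p volume)
    (φ : 𝓓((⊤ : Opens (E N)), ℝ)) (i : Fin N) :
    Integrable (fun x => G x i * φ x) volume :=
  integrable_mul_of_Lp (hG.continuousLinearMap_comp (EuclideanSpace.proj (𝕜 := ℝ) i))
    φ.continuous φ.hasCompactSupport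

theorem integrable_mul_fderiv_of_Lp [Fact (1 ≤ p)] {u : E N → ℝ} (hu : MemLp u p volume)
    (φ : 𝓓((⊤ : Opens (E N)), ℝ)) (v : E N) :
    Integrable (fun x => u x * fderiv ℝ φ x v) volume :=
  integrable_mul_of_Lp hu
    ((φ.contDiff.continuous_fderiv (by simp)).clm_apply continuous_const)
    (φ.hasCompactSupport.fderiv_apply (𝕜 := ℝ) v)

theorem HasWeakGradient.congr {u u' : E N → ℝ} {G G' : E N → E N} (h : HasWeakGradient u G)
    (hu : u =ᵐ[volume] u') (hG : G =ᵐ[volume] G') : HasWeakGradient u' G' := by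
  intro φ i
  have h1 : ∫ x, u' x * fderiv ℝ φ x (EuclideanSpace.single i 1) =
      ∫ x, u x * fderiv ℝ φ x (EuclideanSpace.single i 1) :=
    integral_congr_ae (by filter_upwards [hu] with x hx; rw [hx])
  have h2 : ∫ x, G' x i * φ x = ∫ x, G x i * φ x :=
    integral_congr_ae (by filter_upwards [hG] with x hx; rw [hx])
  rw [h1, h2, h φ i]

theorem HasWeakGradient.add [Fact (1 ≤ p)] {u u' : E N → ℝ} {G G' : E N → E N}
    (h : HasWeakGradient u G) (h' : HasWeakGradient u' G')
    (hu : MemLp u p volume) (hu' : MemLp u' p volume)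
    (hG : MemLp G p volume) (hG' : MemLp G' p volume) : HasWeakGradient (u + u') (G + G') := by
  intro φ i
  simp only [Pi.add_apply, PiLp.add_apply, add_mul]
  rw [integral_add (integrable_mul_fderiv_of_Lp hu φ _) (integrable_mul_fderiv_of_Lp hu' φ _),
    integral_add (integrable_coord_mul_of_Lp hG φ i) (integrable_coord_mul_of_Lp hG' φ i),
    h φ i, h' φ i, neg_add]

theorem HasWeakGradient.smul {u : E N → ℝ} {G : E N → E N}
    (h : HasWeakGradient u G) (c : ℝ) : HasWeakGradient (c • u) (c • G) := by
  intro φ i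
  simp only [Pi.smul_apply, PiLp.smul_apply, smul_eq_mul, mul_assoc]
  rw [integral_const_mul, integral_const_mul, h φ i, mul_neg]

theorem HasWeakGradient.zero : HasWeakGradient (0 : E N → ℝ) (0 : E N → E N) := by
  intro φ i
  simp

/-- The weak gradient is unique almost everywhere. -/
theorem HasWeakGradient.unique [h1 : Fact (1 ≤ p)] {u : E N → ℝ} {G G' : E N → E N}
    (h : HasWeakGradient u G) (h' : HasWeakGradient u G')
    (hG : MemLp G p volume) (hG' : MemLp G' p volume) : G =ᵐ[volume] G' := by
  have hp : (1 : ℝ≥0∞) ≤ p := by exact_mod_cast h1.out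
  have key : ∀ i : Fin N, ∀ᵐ x, G x i = G' x i := by
    intro i
    have e : ∀ {F : E N → E N}, MemLp F p volume →
        LocallyIntegrable (fun x => F x i) volume := fun hF =>
      (hF.continuousLinearMap_comp (EuclideanSpace.proj (𝕜 := ℝ) i)).locallyIntegrable hp
    refine ae_eq_of_integral_contDiff_smul_eq (e hG) (e hG') ?_
    intro g hg hgc
    have a := h ⟨g, hg, hgc, by simp⟩ i
    have b := h' ⟨g, hg, hgc, by simp⟩ i
    have c := neg_injective (a.symm.trans b)
    simpa [mul_comm] using c
  filter_upwards [ae_all_iff.2 key] with x hx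
  ext i
  exact hx i

end Aux

/-- The functions `u ∈ W^{1,p}(ℝ^N)` (that is, `u ∈ L^p` with a weak gradient in `L^p`) whose
gradient has finite Gagliardo seminorm of order `s - 1`. As a set and vector space this is
`B(s, p)`, for `1 < s < 2` and `1 ≤ p < ∞`. -/
def besovSubmodule (N : ℕ) (s : ℝ) (p : ℝ≥0) [Fact (1 ≤ p)] :
    Submodule ℝ (Lp ℝ p (volume : Measure (E N))) where
  carrier := {u | ∃ G : Lp (E N) p (volume : Measure (E N)),
    HasWeakGradient u G ∧ gagliardo (s - 1) p G < ∞}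
  zero_mem' := ⟨0, HasWeakGradient.zero.congr (Lp.coeFn_zero _ _ _).symm
      (Lp.coeFn_zero _ _ _).symm, by
    rw [gagliardo_congr (Lp.coeFn_zero _ _ _), gagliardo_zero]; exact ENNReal.zero_lt_top⟩
  add_mem' := by
    rintro u v ⟨G, hG, hG'⟩ ⟨K, hK, hK'⟩
    refine ⟨G + K, (hG.add hK (Lp.memLp u) (Lp.memLp v) (Lp.memLp G) (Lp.memLp K)).congr
      (Lp.coeFn_add u v).symm (Lp.coeFn_add G K).symm, ?_⟩
    rw [gagliardo_congr (Lp.coeFn_add G K)]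
    exact (gagliardo_add_le (Lp.aestronglyMeasurable G) (Lp.aestronglyMeasurable K)).trans_lt
      (ENNReal.add_lt_top.2 ⟨hG', hK'⟩)
  smul_mem' := by
    rintro c u ⟨G, hG, hG'⟩
    refine ⟨c • G, (hG.smul c).congr (Lp.coeFn_smul c u).symm (Lp.coeFn_smul c G).symm, ?_⟩
    rw [gagliardo_congr (Lp.coeFn_smul c G), gagliardo_smul]
    exact ENNReal.mul_lt_top enorm_lt_top hG'

/-- The Besov space `B(s, p)` on `ℝ^N`. It is a type of its own so that it does not inherit the
norm of `L^p`; its norm is defined below. -/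
def Besov (N : ℕ) (s : ℝ) (p : ℝ≥0) [Fact (1 ≤ p)] : Type :=
  ↥(besovSubmodule N s p)

namespace Besov

variable {N : ℕ} {s : ℝ} {p : ℝ≥0} [Fact (1 ≤ p)]

instance : AddCommGroup (Besov N s p) :=
  inferInstanceAs (AddCommGroup ↥(besovSubmodule N s p))

instance : Module ℝ (Besov N s p) :=
  inferInstanceAs (Module ℝ ↥(besovSubmodule N s p))

/-- The inclusion `B(s, p) ⊆ L^p`. -/
def toLp : Besov N s p →ₗ[ℝ] Lp ℝ p (volume : Measure (E N)) :=
  (besovSubmodule N s p).subtype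

theorem toLp_injective : Function.Injective (toLp : Besov N s p → _) :=
  Subtype.val_injective

/-- The weak gradient `Du ∈ L^p` of `u ∈ B(s, p)`. -/
def grad (u : Besov N s p) : Lp (E N) p (volume : Measure (E N)) :=
  u.2.choose

theorem hasWeakGradient_grad (u : Besov N s p) : HasWeakGradient (toLp u) (grad u) :=
  u.2.choose_spec.1

theorem gagliardo_grad_lt_top (u : Besov N s p) : gagliardo (s - 1) p (grad u) < ∞ :=
  u.2.choose_spec.2

theorem grad_eq_of_hasWeakGradient (u : Besov N s p) (G : Lp (E N) p (volume : Measure (E N)))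
    (h : HasWeakGradient (toLp u) G) : grad u = G :=
  Lp.ext ((hasWeakGradient_grad u).unique h (Lp.memLp _) (Lp.memLp _))

theorem grad_add (u v : Besov N s p) : grad (u + v) = grad u + grad v := by
  apply grad_eq_of_hasWeakGradient
  rw [map_add]
  exact ((hasWeakGradient_grad u).add (hasWeakGradient_grad v) (Lp.memLp _) (Lp.memLp _)
    (Lp.memLp _) (Lp.memLp _)).congr (Lp.coeFn_add _ _).symm (Lp.coeFn_add _ _).symm

theorem grad_smul (c : ℝ) (u : Besov N s p) : grad (c • u) = c • grad u := by
  apply grad_eq_of_hasWeakGradient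
  rw [map_smul]
  exact ((hasWeakGradient_grad u).smul c).congr (Lp.coeFn_smul _ _).symm
    (Lp.coeFn_smul _ _).symm

/-- The norm of `B(s, p)`: `‖u‖_{s,p} = ‖u‖_{W^{1,p}} + [Du]_{s-1,p}`,
where `‖u‖_{W^{1,p}} = ‖u‖_{L^p} + ‖Du‖_{L^p}`. -/
def besovNorm (u : Besov N s p) : ℝ :=
  (‖toLp u‖ + ‖grad u‖) + (gagliardo (s - 1) p (grad u)).toReal

theorem besovNorm_smul (c : ℝ) (u : Besov N s p) : besovNorm (c • u) = |c| * besovNorm u := by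
  unfold besovNorm
  rw [map_smul, grad_smul, norm_smul, norm_smul, gagliardo_congr (Lp.coeFn_smul c (grad u)),
    gagliardo_smul, ENNReal.toReal_mul, toReal_enorm, Real.norm_eq_abs]
  ring

theorem besovNorm_add_le (u v : Besov N s p) :
    besovNorm (u + v) ≤ besovNorm u + besovNorm v := by
  have h1 := norm_add_le (toLp u) (toLp v)
  have h2 := norm_add_le (grad u) (grad v)
  have h3 : (gagliardo (s - 1) p (grad (u + v))).toReal ≤
      (gagliardo (s - 1) p (grad u)).toReal + (gagliardo (s - 1) p (grad v)).toReal := by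
    rw [grad_add, gagliardo_congr (Lp.coeFn_add (grad u) (grad v)),
      ← ENNReal.toReal_add (gagliardo_grad_lt_top u).ne (gagliardo_grad_lt_top v).ne]
    exact ENNReal.toReal_mono
      (ENNReal.add_lt_top.2 ⟨gagliardo_grad_lt_top u, gagliardo_grad_lt_top v⟩).ne
      (gagliardo_add_le (Lp.aestronglyMeasurable _) (Lp.aestronglyMeasurable _))
  rw [← map_add] at h1
  rw [← grad_add] at h2
  unfold besovNorm
  linarith

theorem besovNorm_zero : besovNorm (0 : Besov N s p) = 0 := by
  have := besovNorm_smul 0 (0 : Besov N s p)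
  simpa using this

theorem eq_zero_of_besovNorm_eq_zero (u : Besov N s p) (h : besovNorm u = 0) : u = 0 := by
  have h1 := norm_nonneg (toLp u)
  have h2 := norm_nonneg (grad u)
  have h3 : 0 ≤ (gagliardo (s - 1) p (grad u)).toReal := ENNReal.toReal_nonneg
  unfold besovNorm at h
  have h4 : ‖toLp u‖ = 0 := by linarith
  exact toLp_injective ((norm_eq_zero.1 h4).trans (map_zero toLp).symm)

instance : NormedAddCommGroup (Besov N s p) :=
  AddGroupNorm.toNormedAddCommGroup
    { toFun := besovNorm
      map_zero' := besovNorm_zero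
      add_le' := besovNorm_add_le
      neg' := fun u => by
        have := besovNorm_smul (-1) u
        simpa using this
      eq_zero_of_map_eq_zero' := eq_zero_of_besovNorm_eq_zero }

theorem norm_def (u : Besov N s p) :
    ‖u‖ = (‖toLp u‖ + ‖grad u‖) + (gagliardo (s - 1) p (grad u)).toReal := rfl

instance : NormedSpace ℝ (Besov N s p) where
  norm_smul_le c u := (besovNorm_smul c u).le

end Besov

/-- The Hessian matrix `D²u(x) = (∂ᵢ∂ⱼu(x))` of a function `u : ℝ^N → ℝ`. -/
def hessian {N : ℕ} (u : E N → ℝ) (x : E N) : Matrix (Fin N) (Fin N) ℝ :=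
  Matrix.of fun i j =>
    iteratedFDeriv ℝ 2 u x ![EuclideanSpace.single i 1, EuclideanSpace.single j 1]

/-- `‖D²φ‖_{L^∞(ℝ^N)}`, with the operator norm of the bilinear form `D²φ(x)`. -/
def supNormD2 {N : ℕ} (φ : E N → ℝ) : ℝ :=
  (eLpNorm (iteratedFDeriv ℝ 2 φ) ∞ (volume : Measure (E N))).toReal

/-- The space `B(2 - 2/N, N)` on `ℝ^N`, `N ≥ 3`. -/
abbrev CriticalBesov (N : ℕ) [Fact (3 ≤ N)] : Type :=
  Besov N (2 - 2 / (N : ℝ)) (N : ℝ≥0)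

/-- `H` extends the operator `u ↦ det(D²u)` from `C_c^2(ℝ^N)` to distributions: every
`u ∈ C_c^2(ℝ^N)` is (represents) an element `w` of `B(2 - 2/N, N)`, necessarily unique, and
`⟨H(w), φ⟩ = ∫ det(D²u) φ` for all test functions `φ`. -/
def ExtendsHessianDet {N : ℕ} [Fact (3 ≤ N)]
    (H : CriticalBesov N → 𝓓'((⊤ : Opens (E N)), ℝ)) : Prop :=
  ∀ u : 𝓓^{2}((⊤ : Opens (E N)), ℝ), ∃ w : CriticalBesov N,
    (Besov.toLp w : E N → ℝ) =ᵐ[volume] u ∧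
    ∀ φ : 𝓓((⊤ : Opens (E N)), ℝ), H w φ = ∫ x, (hessian u x).det * φ x

end HessianDet

end

open MeasureTheory TopologicalSpace
open scoped ENNReal NNReal Distributions

noncomputable section

/-! Everything rests on one estimate for smooth compactly supported `u`: the integral of `det(D²u)
φ` is at most a constant times `sup |D²φ|` times the double integral of `|Du(x) - Du(y)|^N / |x -
y|^(2N-2)`. The exponent is the one in the norm, since `2N - 2 = N + (1 - 2/N) N`.

To prove it, put `U(t,x) = ∫ ρ(z) u(x - t z) dz` with an even smooth probability density `ρ` on the
unit ball, and `g(t) = ∫ det(D²U(t,·)) φ`. Then `g(0)` is the quantity wanted, and `g(t) → 0` as `t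
→ ∞` because `D²U = O(1/t)`, so `|g(0)| ≤ ∫ |g'|`. The derivative `g'` contains the linearized
determinant applied to `D²(∂_t U)`. Cofactors of a Hessian are divergence free and symmetric, so two
integrations by parts move both derivatives from `∂_t U` to `φ` (`integral_linearized_hessian_det`).
Both `t D²U` and `∂_t U` are controlled by the oscillation of `Du` at scale `t`: the first by moving
a derivative to `ρ`, the second by evenness of `ρ`. Hence `|g'(t)|` is at most a constant times
`t^(1-N) ∫ osc^N dx`. Jensen's inequality and integration over all `t ≥ |x - y|` give the double
integral (`lintegral_scales_le`).

The bound for differences follows from the bound for single functions, without multilinear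
estimates: `θ ↦ ∫ det(D²(u₂ + θh)) φ` is a polynomial of degree at most `N`, hence determined by its
values at `0, …, N`. With `h` the difference `u₁ - u₂` rescaled to norm `‖u₂‖ + ‖u₁ - u₂‖`, the
original difference is an increment of this polynomial over a small parameter
(`exists_abs_integral_det_hessian_sub_le`).

Smooth compactly supported functions are dense in the Besov space, by mollification and cutoff
(`Besov.exists_smooth_close`). The difference bound therefore extends the pairing by Cauchy
sequences to the whole space, for test functions that are only `C^2`. Continuity into distributions,
the order and uniqueness all come from that bound and density; agreement on `C_c^2` comes from
mollifying `u`. -/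

namespace HessianDet

/-! ### Determinants: derivative, linearization, bounds, interpolation -/

section Determinant

/-- The directional derivative `∂_v f`. -/
def dirDeriv {V : Type*} [NormedAddCommGroup V] [NormedSpace ℝ V] (v : V) (f : V → ℝ) : V → ℝ :=
  fun x => fderiv ℝ f x v

variable {V : Type*} [NormedAddCommGroup V] [NormedSpace ℝ V]
variable {n : Type*} [Fintype n] [DecidableEq n]

/-- The determinant as a continuous multilinear map of the rows. -/
def detCMM (n : Type*) [Fintype n] [DecidableEq n] :
    ContinuousMultilinearMap ℝ (fun _ : n => n → ℝ) ℝ where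
  toMultilinearMap := (Matrix.detRowAlternating : (n → ℝ) [⋀^n]→ₗ[ℝ] ℝ).toMultilinearMap
  cont := Continuous.matrix_det (A := fun B : Matrix n n ℝ => B) continuous_id

theorem hasFDerivAt_det {A : V → Matrix n n ℝ} {x : V}
    (hA : ∀ i j, DifferentiableAt ℝ (fun y => A y i j) x) :
    HasFDerivAt (fun y => (A y).det) (∑ i, ((detCMM n).toContinuousLinearMap (A x) i) ∘L
      (ContinuousLinearMap.pi fun j => fderiv ℝ (fun y => A y i j) x)) x :=
  HasFDerivAt.multilinear_comp (f := detCMM n) (g := fun i y => A y i) fun i =>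
    hasFDerivAt_pi.2 fun j => (hA i j).hasFDerivAt

/-- The derivative of a determinant, differentiating one row at a time. -/
theorem dirDeriv_det {A : V → Matrix n n ℝ} {x : V}
    (hA : ∀ i j, DifferentiableAt ℝ (fun y => A y i j) x) (v : V) :
    dirDeriv v (fun y => (A y).det) x =
      ∑ i, ((A x).updateRow i fun j => dirDeriv v (fun y => A y i j) x).det := by
  rw [dirDeriv, (hasFDerivAt_det hA).fderiv]
  simp only [_root_.sum_apply, ContinuousLinearMap.comp_apply]
  rfl

theorem contDiff_det {A : V → Matrix n n ℝ} {k : WithTop ℕ∞}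
    (hA : ∀ i j, ContDiff ℝ k (fun y => A y i j)) : ContDiff ℝ k fun y => (A y).det := by
  simp only [Matrix.det_apply]
  refine ContDiff.sum fun σ _ => ContDiff.const_smul _ ?_
  exact contDiff_prod fun i _ => hA _ _

/-- Linearity in row `i`, with the adjugate entries as coefficients. This exhibits the linearized
Hessian determinant as a second-order operator with cofactor coefficients. -/
theorem det_updateRow_eq_sum (A : Matrix n n ℝ) (i : n) (b : n → ℝ) :
    (A.updateRow i b).det = ∑ j, A.adjugate j i * b j := by
  have hb : b = ∑ j, b j • (Pi.single j 1 : n → ℝ) := by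
    ext k; simp [Finset.sum_apply, Pi.single_apply]
  conv_lhs => rw [hb]
  have : ∀ s : Finset n, (A.updateRow i (∑ j ∈ s, b j • (Pi.single j 1 : n → ℝ))).det =
      ∑ j ∈ s, A.adjugate j i * b j := by
    intro s
    induction s using Finset.induction_on with
    | empty =>
      simpa using Matrix.det_eq_zero_of_row_eq_zero (A := A.updateRow i 0) i (by simp)
    | insert j s hj ih =>
      rw [Finset.sum_insert hj, Finset.sum_insert hj, Matrix.det_updateRow_add, ih,
        Matrix.det_updateRow_smul, Matrix.adjugate_apply, mul_comm]
  exact this _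

theorem abs_det_le {A : Matrix n n ℝ} {r : ℝ} (h : ∀ i j, |A i j| ≤ r) :
    |A.det| ≤ (Fintype.card n).factorial * r ^ Fintype.card n := by
  simpa using Matrix.det_le (abv := AbsoluteValue.abs) h

/-- An adjugate entry is a determinant with one row replaced by a unit vector, whose entry `1` may
exceed `r`. Scaling that row by `r` makes `abs_det_le` applicable; one factor `r` is then divided
out. -/
theorem abs_adjugate_le (hn : 2 ≤ Fintype.card n) {A : Matrix n n ℝ} {r : ℝ}
    (h : ∀ i j, |A i j| ≤ r) (i j : n) :
    |A.adjugate i j| ≤ (Fintype.card n).factorial * r ^ (Fintype.card n - 1) := by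
  have hr : 0 ≤ r := (abs_nonneg _).trans (h i j)
  rcases hr.eq_or_lt with rfl | hr
  · have : A = 0 := by ext a b; exact abs_nonpos_iff.1 (h a b)
    have : Nontrivial n := Fintype.one_lt_card_iff_nontrivial.1 (by omega)
    subst A
    simp [Matrix.adjugate_zero, zero_pow (show Fintype.card n - 1 ≠ 0 by omega)]
  · have h1 : |(A.updateRow j (r • Pi.single i 1)).det| ≤
        (Fintype.card n).factorial * r ^ Fintype.card n := by
      apply abs_det_le
      intro a b
      rcases eq_or_ne a j with rfl | ha
      · rw [Matrix.updateRow_self]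
        rcases eq_or_ne b i with rfl | hb
        · simp [abs_of_pos hr]
        · simp [hb, hr.le]
      · rw [Matrix.updateRow_ne ha]; exact h a b
    rw [Matrix.det_updateRow_smul, ← Matrix.adjugate_apply, abs_mul, abs_of_pos hr] at h1
    have h2 : r ^ Fintype.card n = r * r ^ (Fintype.card n - 1) := by
      rw [← pow_succ']; congr 1; omega
    rw [h2] at h1
    refine le_of_mul_le_mul_left ?_ hr
    linarith

/-- The linearization `∑ᵢ det(A with row i replaced by that of B)` of the determinant. -/
theorem abs_sum_det_updateRow_le (hn : 2 ≤ Fintype.card n) {A B : Matrix n n ℝ} {r M : ℝ}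
    (hA : ∀ i j, |A i j| ≤ r) (hB : ∀ i j, |B i j| ≤ M) :
    |∑ i, (A.updateRow i (B i)).det| ≤
      (Fintype.card n ^ 2 * (Fintype.card n).factorial) * r ^ (Fintype.card n - 1) * M := by
  have key : ∀ i j, |A.adjugate j i * B i j| ≤
      (Fintype.card n).factorial * r ^ (Fintype.card n - 1) * M := by
    intro i j
    rw [abs_mul]
    have := abs_adjugate_le hn hA j i
    exact mul_le_mul this (hB i j) (abs_nonneg _) ((abs_nonneg _).trans this)
  simp only [det_updateRow_eq_sum]
  calc |∑ i, ∑ j, A.adjugate j i * B i j|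
      ≤ ∑ _i : n, ∑ _j : n, (Fintype.card n).factorial * r ^ (Fintype.card n - 1) * M := by
        refine (Finset.abs_sum_le_sum_abs _ _).trans (Finset.sum_le_sum fun i _ => ?_)
        exact (Finset.abs_sum_le_sum_abs _ _).trans (Finset.sum_le_sum fun j _ => key i j)
    _ = _ := by simp; ring

/-- `θ ↦ det(A + θ B)` is recovered from its values at `0, …, n` by Lagrange interpolation. -/
theorem det_add_smul_eq_sum (A B : Matrix n n ℝ) (θ : ℝ) :
    (A + θ • B).det = ∑ k ∈ Finset.range (Fintype.card n + 1), (A + (k : ℝ) • B).det *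
      (Lagrange.basis (Finset.range (Fintype.card n + 1)) (fun k : ℕ => (k : ℝ)) k).eval θ := by
  set P : Polynomial ℝ := ((Polynomial.X : Polynomial ℝ) • B.map Polynomial.C +
    A.map Polynomial.C).det with hP
  have hev : ∀ s : ℝ, P.eval s = (A + s • B).det := by
    intro s
    rw [hP, ← Polynomial.coe_evalRingHom, RingHom.map_det]
    congr 1
    ext i j
    simp [add_comm, mul_comm s]
  have hdeg : P.degree < (Finset.range (Fintype.card n + 1)).card := by
    rw [Finset.card_range]
    refine (Polynomial.degree_le_natDegree).trans_lt ?_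
    exact_mod_cast Nat.lt_succ_of_le (Polynomial.natDegree_det_X_add_C_le B A)
  have h := congrArg (Polynomial.eval θ) (Lagrange.eq_interpolate (v := fun k : ℕ => (k : ℝ))
    (Nat.cast_injective.injOn) hdeg)
  rw [hev, Lagrange.interpolate_apply, Polynomial.eval_finsetSum] at h
  rw [h]
  refine Finset.sum_congr rfl fun k _ => ?_
  rw [Polynomial.eval_mul, Polynomial.eval_C, hev]

end Determinant

/-! ### Directional derivatives and the Piola identity -/

section Piola

variable {V : Type*} [NormedAddCommGroup V] [NormedSpace ℝ V]

theorem contDiff_dirDeriv {f : V → ℝ} {k m : WithTop ℕ∞} (hf : ContDiff ℝ k f) (hmk : m + 1 ≤ k)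
    (v : V) : ContDiff ℝ m (dirDeriv v f) :=
  (hf.fderiv_right hmk).clm_apply contDiff_const

theorem dirDeriv_dirDeriv {f : V → ℝ} (hf : ContDiff ℝ 2 f) (v w x : V) :
    dirDeriv v (dirDeriv w f) x = fderiv ℝ (fderiv ℝ f) x v w := by
  have hd : DifferentiableAt ℝ (fderiv ℝ f) x :=
    (hf.fderiv_right (m := 1) (by norm_num)).differentiable (by norm_num) x
  change fderiv ℝ (fun y => fderiv ℝ f y w) x v = _
  rw [fderiv_clm_apply hd (differentiableAt_const w)]
  simp

theorem dirDeriv_comm {f : V → ℝ} (hf : ContDiff ℝ 2 f) (v w : V) :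
    dirDeriv v (dirDeriv w f) = dirDeriv w (dirDeriv v f) := by
  ext x
  rw [dirDeriv_dirDeriv hf, dirDeriv_dirDeriv hf]
  exact (hf.contDiffAt.isSymmSndFDerivAt (by simp)) v w

theorem dirDeriv_mul {f g : V → ℝ} {x : V} (hf : DifferentiableAt ℝ f x)
    (hg : DifferentiableAt ℝ g x) (v : V) :
    dirDeriv v (fun y => f y * g y) x = dirDeriv v f x * g x + f x * dirDeriv v g x := by
  simp only [dirDeriv]
  rw [fderiv_fun_mul hf hg]
  simp
  ring

theorem _root_.HasCompactSupport.dirDeriv {f : V → ℝ} (hf : HasCompactSupport f) (v : V) :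
    HasCompactSupport (dirDeriv v f) :=
  hf.fderiv_apply (𝕜 := ℝ) v

variable {n : Type*} [Fintype n]

/-- Sum of a symmetric against an antisymmetric array. -/
theorem sum_symm_mul_antisymm {s d : n → n → ℝ} (hs : ∀ i j, s i j = s j i)
    (hd : ∀ i j, d i j = -d j i) : ∑ i, ∑ j, s i j * d i j = 0 := by
  have h : ∑ i, ∑ j, s i j * d i j = -∑ i, ∑ j, s i j * d i j := by
    conv_lhs => rw [Finset.sum_comm]
    rw [← Finset.sum_neg_distrib]
    refine Finset.sum_congr rfl fun i _ => ?_
    rw [← Finset.sum_neg_distrib]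
    refine Finset.sum_congr rfl fun j _ => ?_
    rw [hs j i, hd j i]; ring
  linarith

variable [DecidableEq n]

/-- **Piola identity**: if the rows of `A` are gradients, its cofactor matrix is divergence free. -/
theorem sum_dirDeriv_adjugate {e : n → V} {A : V → Matrix n n ℝ}
    (hA : ∀ i j, Differentiable ℝ (fun y => A y i j))
    (hsymm : ∀ k i l, dirDeriv (e i) (fun y => A y k l) = dirDeriv (e l) (fun y => A y k i))
    (j : n) (x : V) :
    ∑ i, dirDeriv (e i) (fun y => (A y).adjugate i j) x = 0 := by
  have h1 : ∀ i, dirDeriv (e i) (fun y => (A y).adjugate i j) x =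
      ∑ k ∈ Finset.univ.erase j, ∑ l, dirDeriv (e i) (fun y => A y k l) x *
        (((A x).updateRow j (Pi.single i 1)).updateRow k (Pi.single l 1)).det := by
    intro i
    simp only [Matrix.adjugate_apply]
    rw [dirDeriv_det]
    · rw [← Finset.add_sum_erase _ _ (Finset.mem_univ j)]
      -- Row `j` is the constant unit vector, so differentiating it contributes nothing.
      have h0 : ((((A x).updateRow j (Pi.single i 1)).updateRow j fun l =>
          dirDeriv (e i) (fun y => (A y).updateRow j (Pi.single i 1) j l) x)).det = 0 := by
        apply Matrix.det_eq_zero_of_row_eq_zero j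
        intro l
        rw [Matrix.updateRow_self]
        simp [Matrix.updateRow_self, dirDeriv]
      rw [h0, zero_add]
      refine Finset.sum_congr rfl fun k hk => ?_
      have hk' : k ≠ j := (Finset.mem_erase.1 hk).1
      simp only [Matrix.updateRow_ne hk']
      rw [det_updateRow_eq_sum]
      refine Finset.sum_congr rfl fun l _ => ?_
      rw [Matrix.adjugate_apply, mul_comm]
    · intro a b
      rcases eq_or_ne a j with rfl | ha
      · simp [Matrix.updateRow_self]
      · simp only [Matrix.updateRow_ne ha]
        exact hA a b x
  simp only [h1]
  rw [Finset.sum_comm]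
  refine Finset.sum_eq_zero fun k hk => ?_
  have hk' : k ≠ j := (Finset.mem_erase.1 hk).1
  -- For fixed `k`, the derivative of the entry is symmetric in `i, l` because row `k` is a
  -- gradient. The determinant is antisymmetric: exchanging `i` and `l` swaps rows `j` and `k`.
  refine sum_symm_mul_antisymm (fun i l => by rw [hsymm]) fun i l => ?_
  have : ((A x).updateRow j (Pi.single l 1)).updateRow k (Pi.single i 1) =
      (((A x).updateRow j (Pi.single i 1)).updateRow k (Pi.single l 1)).submatrix
        (Equiv.swap j k) id := by
    ext a b
    rcases eq_or_ne a j with rfl | haj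
    · simp [Matrix.updateRow_apply, hk'.symm]
    · rcases eq_or_ne a k with rfl | hak
      · simp [Matrix.updateRow_apply, hk'.symm]
      · simp [Matrix.updateRow_apply, haj, hak, Equiv.swap_apply_of_ne_of_ne haj hak]
  rw [this, Matrix.det_permute, Equiv.Perm.sign_swap hk'.symm]
  simp

end Piola

/-! ### Integration by parts for the linearized Hessian determinant -/

section IntegrationByParts

variable {N : ℕ}

/-- The standard basis vectors of `ℝ^N`. -/
abbrev stdVec (i : Fin N) : E N := EuclideanSpace.single i 1

theorem hessian_apply {u : E N → ℝ} (hu : ContDiff ℝ 2 u) (x : E N) (i j : Fin N) :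
    hessian u x i j = dirDeriv (stdVec i) (dirDeriv (stdVec j) u) x := by
  rw [dirDeriv_dirDeriv hu, hessian, Matrix.of_apply, iteratedFDeriv_two_apply]
  simp

theorem hessian_symm {u : E N → ℝ} (hu : ContDiff ℝ 2 u) (x : E N) :
    (hessian u x).transpose = hessian u x := by
  ext i j
  rw [Matrix.transpose_apply, hessian_apply hu, hessian_apply hu, dirDeriv_comm hu]

theorem integral_mul_dirDeriv {f g : E N → ℝ} (hf : ContDiff ℝ 1 f) (hg : ContDiff ℝ 1 g)
    (hfc : HasCompactSupport f) (v : E N) :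
    ∫ x, f x * dirDeriv v g x = -∫ x, dirDeriv v f x * g x := by
  have hf' : Continuous (dirDeriv v f) :=
    (contDiff_dirDeriv hf (m := 0) (by norm_num) v).continuous
  have hg' : Continuous (dirDeriv v g) :=
    (contDiff_dirDeriv hg (m := 0) (by norm_num) v).continuous
  refine integral_mul_fderiv_eq_neg_fderiv_mul_of_integrable ?_ ?_ ?_ ?_ ?_
  · exact (hf'.mul hg.continuous).integrable_of_hasCompactSupport ((hfc.dirDeriv v).mul_right)
  · exact (hf.continuous.mul hg').integrable_of_hasCompactSupport hfc.mul_right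
  · exact (hf.continuous.mul hg.continuous).integrable_of_hasCompactSupport hfc.mul_right
  · exact fun x _ => hf.differentiable (by norm_num) x
  · exact fun x _ => hg.differentiable (by norm_num) x

/-- Two integrations by parts against a coefficient matrix with divergence-free rows and
columns. -/
theorem integral_sum_mul_dirDeriv_dirDeriv {c : Fin N → Fin N → E N → ℝ} {w φ : E N → ℝ}
    (hc : ∀ i j, ContDiff ℝ 1 (c i j))
    (hcol : ∀ j x, ∑ i, dirDeriv (stdVec i) (c i j) x = 0)
    (hrow : ∀ i x, ∑ j, dirDeriv (stdVec j) (c i j) x = 0)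
    (hw : ContDiff ℝ 2 w) (hφ : ContDiff ℝ 2 φ) (hφc : HasCompactSupport φ) :
    ∫ x, (∑ i, ∑ j, c i j x * dirDeriv (stdVec i) (dirDeriv (stdVec j) w) x) * φ x =
      ∫ x, (∑ i, ∑ j, c i j x * dirDeriv (stdVec j) (dirDeriv (stdVec i) φ) x) * w x := by
  have one_two : (1 : WithTop ℕ∞) ≤ 2 := by norm_num
  have hw1 : ContDiff ℝ 1 w := hw.of_le one_two
  have hφ1 : ContDiff ℝ 1 φ := hφ.of_le one_two
  have hdw : ∀ j, ContDiff ℝ 1 (dirDeriv (stdVec j) w) :=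
    fun j => contDiff_dirDeriv hw (by norm_num) _
  have hdφ : ∀ j, ContDiff ℝ 1 (dirDeriv (stdVec j) φ) :=
    fun j => contDiff_dirDeriv hφ (by norm_num) _
  have hddw : ∀ i j, Continuous (dirDeriv (stdVec i) (dirDeriv (stdVec j) w)) :=
    fun i j => (contDiff_dirDeriv (hdw j) (m := 0) (by norm_num) _).continuous
  have hddφ : ∀ i j, Continuous (dirDeriv (stdVec i) (dirDeriv (stdVec j) φ)) :=
    fun i j => (contDiff_dirDeriv (hdφ j) (m := 0) (by norm_num) _).continuous
  have hcφc : ∀ i j, HasCompactSupport (fun x => c i j x * φ x) := fun i j => hφc.mul_left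
  have hcdφc : ∀ i j, HasCompactSupport (fun x => c i j x * dirDeriv (stdVec i) φ x) :=
    fun i j => (hφc.dirDeriv _).mul_left
  have hcφ : ∀ i j, ContDiff ℝ 1 (fun x => c i j x * φ x) := fun i j => (hc i j).mul hφ1
  have hcdφ : ∀ i j, ContDiff ℝ 1 (fun x => c i j x * dirDeriv (stdVec i) φ x) :=
    fun i j => (hc i j).mul (hdφ i)
  have cdd : ∀ {f : E N → ℝ} (_ : ContDiff ℝ 1 f) (v : E N), Continuous (dirDeriv v f) :=
    fun hf v => (contDiff_dirDeriv hf (m := 0) (by norm_num) v).continuous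
  have int1 : ∀ i j, Integrable fun x =>
      (c i j x * φ x) * dirDeriv (stdVec i) (dirDeriv (stdVec j) w) x := fun i j =>
    ((hcφ i j).continuous.mul (hddw i j)).integrable_of_hasCompactSupport (hcφc i j).mul_right
  have int2 : ∀ i j, Integrable fun x =>
      (c i j x * dirDeriv (stdVec i) φ x) * dirDeriv (stdVec j) w x := fun i j =>
    ((hcdφ i j).continuous.mul (hdw j).continuous).integrable_of_hasCompactSupport
      (hcdφc i j).mul_right
  have int3 : ∀ i j, Integrable fun x =>
      (c i j x * dirDeriv (stdVec j) (dirDeriv (stdVec i) φ) x) * w x := fun i j =>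
    (((hc i j).continuous.mul (hddφ j i)).mul hw.continuous).integrable_of_hasCompactSupport
      (((hφc.dirDeriv _).dirDeriv _).mul_left.mul_right)
  have int4 : ∀ i j, Integrable fun x =>
      dirDeriv (stdVec i) (fun y => c i j y * φ y) x * dirDeriv (stdVec j) w x := fun i j =>
    ((cdd (hcφ i j) _).mul (hdw j).continuous).integrable_of_hasCompactSupport
      ((hcφc i j).dirDeriv _).mul_right
  have int5 : ∀ i j, Integrable fun x =>
      dirDeriv (stdVec j) (fun y => c i j y * dirDeriv (stdVec i) φ y) x * w x := fun i j =>
    ((cdd (hcdφ i j) _).mul hw.continuous).integrable_of_hasCompactSupport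
      ((hcdφc i j).dirDeriv _).mul_right
  -- The derivative falling on the coefficients is summed over `i` and vanishes by `hcol`; only the
  -- term with `∂ᵢφ` survives.
  have first : ∀ j, ∫ x, (∑ i, (c i j x * φ x) * dirDeriv (stdVec i) (dirDeriv (stdVec j) w) x) =
      -∫ x, ∑ i, (c i j x * dirDeriv (stdVec i) φ x) * dirDeriv (stdVec j) w x := by
    intro j
    rw [integral_finsetSum _ fun i _ => int1 i j,
      Finset.sum_congr rfl fun i _ => integral_mul_dirDeriv (hcφ i j) (hdw j) (hcφc i j) _,
      Finset.sum_neg_distrib, ← integral_finsetSum _ fun i _ => int4 i j]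
    congr 1
    refine integral_congr_ae (Filter.Eventually.of_forall fun x => ?_)
    simp only
    rw [Finset.sum_congr rfl fun i _ => by
      rw [dirDeriv_mul ((hc i j).differentiable (by norm_num) x)
        (hφ1.differentiable (by norm_num) x), add_mul]]
    rw [Finset.sum_add_distrib, ← Finset.sum_mul, ← Finset.sum_mul, hcol j x]
    ring
  have second : ∀ i, ∫ x, (∑ j, (c i j x * dirDeriv (stdVec i) φ x) * dirDeriv (stdVec j) w x) =
      -∫ x, ∑ j, (c i j x * dirDeriv (stdVec j) (dirDeriv (stdVec i) φ) x) * w x := by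
    intro i
    rw [integral_finsetSum _ fun j _ => int2 i j,
      Finset.sum_congr rfl fun j _ => integral_mul_dirDeriv (hcdφ i j) hw1 (hcdφc i j) _,
      Finset.sum_neg_distrib, ← integral_finsetSum _ fun j _ => int5 i j]
    congr 1
    refine integral_congr_ae (Filter.Eventually.of_forall fun x => ?_)
    simp only
    rw [Finset.sum_congr rfl fun j _ => by
      rw [dirDeriv_mul ((hc i j).differentiable (by norm_num) x)
        ((hdφ i).differentiable (by norm_num) x), add_mul]]
    rw [Finset.sum_add_distrib, ← Finset.sum_mul, ← Finset.sum_mul, hrow i x]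
    ring
  calc ∫ x, (∑ i, ∑ j, c i j x * dirDeriv (stdVec i) (dirDeriv (stdVec j) w) x) * φ x
      = ∫ x, ∑ j, ∑ i, (c i j x * φ x) * dirDeriv (stdVec i) (dirDeriv (stdVec j) w) x := by
        refine integral_congr_ae (Filter.Eventually.of_forall fun x => ?_)
        simp only
        rw [Finset.sum_comm, Finset.sum_mul]
        refine Finset.sum_congr rfl fun j _ => ?_
        rw [Finset.sum_mul]
        exact Finset.sum_congr rfl fun i _ => by ring
    _ = -∫ x, ∑ j, ∑ i, (c i j x * dirDeriv (stdVec i) φ x) * dirDeriv (stdVec j) w x := by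
        rw [integral_finsetSum _ fun j _ => integrable_finsetSum _ fun i _ => int1 i j,
          integral_finsetSum _ fun j _ => integrable_finsetSum _ fun i _ => int2 i j,
          Finset.sum_congr rfl fun j _ => first j, Finset.sum_neg_distrib]
    _ = -∫ x, ∑ i, ∑ j, (c i j x * dirDeriv (stdVec i) φ x) * dirDeriv (stdVec j) w x := by
        congr 2; ext x; exact Finset.sum_comm
    _ = ∫ x, ∑ i, ∑ j, (c i j x * dirDeriv (stdVec j) (dirDeriv (stdVec i) φ) x) * w x := by
        rw [integral_finsetSum _ fun i _ => integrable_finsetSum _ fun j _ => int2 i j,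
          integral_finsetSum _ fun i _ => integrable_finsetSum _ fun j _ => int3 i j,
          Finset.sum_congr rfl fun i _ => second i, Finset.sum_neg_distrib, neg_neg]
    _ = _ := by
        refine integral_congr_ae (Filter.Eventually.of_forall fun x => ?_)
        simp only
        rw [Finset.sum_mul]
        refine Finset.sum_congr rfl fun j _ => ?_
        rw [Finset.sum_mul]

/-- The linearized Hessian determinant is formally self-adjoint. -/
theorem integral_linearized_hessian_det {v w φ : E N → ℝ} (hv : ContDiff ℝ 3 v)
    (hw : ContDiff ℝ 2 w) (hφ : ContDiff ℝ 2 φ) (hφc : HasCompactSupport φ) :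
    ∫ x, (∑ i, ((hessian v x).updateRow i (hessian w x i)).det) * φ x =
      ∫ x, (∑ i, ((hessian v x).updateRow i (hessian φ x i)).det) * w x := by
  have hv2 : ContDiff ℝ 2 v := hv.of_le (by norm_num)
  have hent : ∀ i j, ContDiff ℝ 1 (fun y => hessian v y i j) := by
    intro i j
    simp only [hessian_apply hv2]
    exact contDiff_dirDeriv (contDiff_dirDeriv hv (m := 2) (by norm_num) _) (by norm_num) _
  have hadj : ∀ i j, ContDiff ℝ 1 (fun y => (hessian v y).adjugate j i) := by
    intro i j
    simp only [Matrix.adjugate_apply]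
    apply contDiff_det
    intro a b
    rcases eq_or_ne a i with rfl | ha
    · simp only [Matrix.updateRow_self]; exact contDiff_const
    · simp only [Matrix.updateRow_ne ha]; exact hent a b
  -- Symmetry of the Hessian makes the adjugate symmetric, so the Piola identity covers rows as well
  -- as columns.
  have hsym : ∀ x i j, (hessian v x).adjugate i j = (hessian v x).adjugate j i := by
    intro x i j
    conv_rhs => rw [← hessian_symm hv2, ← Matrix.adjugate_transpose, Matrix.transpose_apply]
  have piola : ∀ j x, ∑ i, dirDeriv (stdVec i) (fun y => (hessian v y).adjugate i j) x = 0 := by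
    intro j x
    refine sum_dirDeriv_adjugate (fun i j => (hent i j).differentiable (by norm_num)) ?_ j x
    intro k i l
    simp only [hessian_apply hv2]
    rw [dirDeriv_comm hv2 (stdVec k) (stdVec l), dirDeriv_comm hv2 (stdVec k) (stdVec i)]
    exact dirDeriv_comm (contDiff_dirDeriv hv (by norm_num) _) _ _
  have key := integral_sum_mul_dirDeriv_dirDeriv
    (c := fun i j x => (hessian v x).adjugate j i) hadj
    (fun j x => by simp only [fun x i => hsym x j i]; exact piola j x)
    (fun i x => piola i x) hw hφ hφc
  simp only [det_updateRow_eq_sum, hessian_apply hw, hessian_apply hφ]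
  rw [key]
  simp only [dirDeriv_comm hφ]

end IntegrationByParts

/-! ### Integrals depending on a parameter -/

section ParametricIntegral

variable {N : ℕ} {P : Type*} [NormedAddCommGroup P] [NormedSpace ℝ P]

/-- The integral over a compact set of a jointly `C^k` function is `C^k` in the parameter. -/
theorem contDiff_integral_of_compact {Φ : P × E N → ℝ} {K : Set (E N)} (hK : IsCompact K)
    (hzero : ∀ p z, z ∉ K → Φ (p, z) = 0) {k : ℕ∞} (hΦ : ContDiff ℝ k Φ) :
    ContDiff ℝ k fun p => ∫ z, Φ (p, z) := by
  -- The integral is the convolution of the constant `1` with the reflected slice `y ↦ Φ (p, -y)`,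
  -- evaluated at `0`.
  have h := contDiffOn_convolution_right_with_param_comp (𝕜 := ℝ) (μ := (volume : Measure (E N)))
    (n := k) (ContinuousLinearMap.lsmul ℝ ℝ) (s := (Set.univ : Set P)) (v := fun _ => (0 : E N))
    contDiffOn_const (f := fun _ => (1 : ℝ)) (g := fun p y => Φ (p, -y)) (k := -K)
    isOpen_univ hK.neg (fun p x _ hx => hzero p (-x) (by simpa using hx))
    (locallyIntegrable_const _) (by
      rw [Set.univ_prod_univ, contDiffOn_univ]
      exact hΦ.comp (contDiff_fst.prodMk contDiff_snd.neg))
  rw [contDiffOn_univ] at h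
  simpa [convolution] using h

/-- Differentiation under the integral sign. -/
theorem dirDeriv_integral_of_compact {Φ : P × E N → ℝ} {K : Set (E N)} (hK : IsCompact K)
    (hzero : ∀ p z, z ∉ K → Φ (p, z) = 0) (hΦ : ContDiff ℝ 1 Φ) (v p : P) :
    dirDeriv v (fun p => ∫ z, Φ (p, z)) p = ∫ z, dirDeriv (v, 0) Φ (p, z) := by
  have hline : ∀ (s : ℝ) (z : E N), HasDerivAt (fun s : ℝ => Φ (p + s • v, z))
      (dirDeriv (v, 0) Φ (p + s • v, z)) s := by
    intro s z
    have h1 : HasDerivAt (fun s : ℝ => ((p + s • v, z) : P × E N)) (v, 0) s := by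
      refine HasDerivAt.prodMk ?_ (hasDerivAt_const _ _)
      simpa using ((hasDerivAt_id s).smul_const v).const_add p
    exact ((hΦ.differentiable (by norm_num) _).hasFDerivAt).comp_hasDerivAt s h1
  have hcont : Continuous (dirDeriv ((v, 0) : P × E N) Φ) :=
    (contDiff_dirDeriv hΦ (m := 0) (by norm_num) _).continuous
  have hz' : ∀ (s : ℝ) (z : E N), z ∉ K → dirDeriv (v, 0) Φ (p + s • v, z) = 0 := by
    intro s z hz
    have h0 : (fun s : ℝ => Φ (p + s • v, z)) = fun _ => 0 := by ext s; exact hzero _ _ hz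
    have := hline s z
    rw [h0] at this
    exact this.unique (hasDerivAt_const _ _)
  obtain ⟨C, hC⟩ := ((isCompact_Icc (a := (-1 : ℝ)) (b := 1)).prod hK).exists_bound_of_continuousOn
    (f := fun q : ℝ × E N => dirDeriv (v, 0) Φ (p + q.1 • v, q.2)) (by
      refine (hcont.comp ?_).continuousOn
      fun_prop)
  have hslice : ∀ q : P, Continuous fun z => Φ (q, z) := fun q =>
    hΦ.continuous.comp (by fun_prop)
  have hcs : ∀ q : P, HasCompactSupport fun z => Φ (q, z) := fun q =>
    HasCompactSupport.intro hK fun z hz => hzero q z hz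
  have key := (hasDerivAt_integral_of_dominated_loc_of_deriv_le (μ := (volume : Measure (E N)))
    (F := fun (s : ℝ) z => Φ (p + s • v, z)) (x₀ := (0 : ℝ)) (s := Set.Icc (-1) 1)
    (F' := fun s z => dirDeriv (v, 0) Φ (p + s • v, z)) (bound := K.indicator fun _ => C)
    (Icc_mem_nhds (by norm_num) (by norm_num))
    (Filter.Eventually.of_forall fun s => (hslice _).aestronglyMeasurable)
    ((hslice _).integrable_of_hasCompactSupport (hcs _))
    (hcont.comp (by fun_prop)).aestronglyMeasurable
    (Filter.Eventually.of_forall fun z s hs => by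
      by_cases hz : z ∈ K
      · simpa [hz] using hC (s, z) ⟨hs, hz⟩
      · simp [hz, hz' s z hz])
    ((integrable_indicator_iff hK.measurableSet).2
      (integrableOn_const hK.measure_lt_top.ne))
    (Filter.Eventually.of_forall fun z s _ => hline s z)).2
  -- Differentiability is already known, so the directional derivative can be read off along the
  -- line `s ↦ p + s • v`.
  have hd := (contDiff_integral_of_compact hK hzero (k := 1) (by exact_mod_cast hΦ)).differentiable
    (by norm_num) p
  have h1 : HasDerivAt (fun s : ℝ => p + s • v) v 0 := by
    simpa using ((hasDerivAt_id (0 : ℝ)).smul_const v).const_add p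
  have h2 : HasFDerivAt (fun p => ∫ z, Φ (p, z)) (fderiv ℝ (fun p => ∫ z, Φ (p, z)) p)
      (p + (0 : ℝ) • v) := by
    simpa using hd.hasFDerivAt
  have h3 : HasDerivAt (fun s : ℝ => ∫ z, Φ (p + s • v, z))
      (fderiv ℝ (fun p => ∫ z, Φ (p, z)) p v) 0 :=
    HasFDerivAt.comp_hasDerivAt (l := fun p => ∫ z, Φ (p, z)) (0 : ℝ) h2 h1
  simpa [dirDeriv] using h3.unique key

end ParametricIntegral

/-! ### Averages at scale `t` -/

section ScaleAvg

variable {N : ℕ}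

/-- The average `∫ ψ(z) F(x - t z) dz` as a function of `(t, x)`. -/
def scaleAvg (ψ F : E N → ℝ) (p : ℝ × E N) : ℝ := ∫ z, ψ z * F (p.2 - p.1 • z)

variable {ψ F : E N → ℝ} {k : ℕ∞}

theorem contDiff_scaleAvg_integrand (hψ : ContDiff ℝ k ψ) (hF : ContDiff ℝ k F) :
    ContDiff ℝ k fun q : (ℝ × E N) × E N => ψ q.2 * F (q.1.2 - q.1.1 • q.2) := by
  refine (hψ.comp contDiff_snd).mul (hF.comp ?_)
  exact (contDiff_snd.comp contDiff_fst).sub ((contDiff_fst.comp contDiff_fst).smul contDiff_snd)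

theorem scaleAvg_integrand_zero (p : ℝ × E N) (z : E N) (hz : z ∉ tsupport ψ) :
    ψ z * F (p.2 - p.1 • z) = 0 := by
  rw [image_eq_zero_of_notMem_tsupport hz, zero_mul]

theorem contDiff_scaleAvg (hψ : ContDiff ℝ k ψ) (hψc : HasCompactSupport ψ)
    (hF : ContDiff ℝ k F) : ContDiff ℝ k (scaleAvg ψ F) :=
  contDiff_integral_of_compact
    (Φ := fun q : (ℝ × E N) × E N => ψ q.2 * F (q.1.2 - q.1.1 • q.2)) hψc
    scaleAvg_integrand_zero (contDiff_scaleAvg_integrand hψ hF)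

theorem dirDeriv_scaleAvg (hψ : ContDiff ℝ 1 ψ) (hψc : HasCompactSupport ψ)
    (hF : ContDiff ℝ 1 F) (τ t : ℝ) (v x : E N) :
    dirDeriv (τ, v) (scaleAvg ψ F) (t, x) =
      ∫ z, ψ z * fderiv ℝ F (x - t • z) (v - τ • z) := by
  have h := dirDeriv_integral_of_compact
    (Φ := fun q : (ℝ × E N) × E N => ψ q.2 * F (q.1.2 - q.1.1 • q.2)) hψc
    scaleAvg_integrand_zero (contDiff_scaleAvg_integrand (k := 1) hψ hF) (τ, v) (t, x)
  refine h.trans (integral_congr_ae (Filter.Eventually.of_forall fun z => ?_))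
  have hd : HasFDerivAt (fun q : (ℝ × E N) × E N => F (q.1.2 - q.1.1 • q.2))
      ((fderiv ℝ F (x - t • z)).comp
        (((ContinuousLinearMap.snd ℝ ℝ (E N)).comp (ContinuousLinearMap.fst ℝ (ℝ × E N) (E N))) -
          (t • (ContinuousLinearMap.snd ℝ (ℝ × E N) (E N)) +
          ((ContinuousLinearMap.fst ℝ ℝ (E N)).comp
            (ContinuousLinearMap.fst ℝ (ℝ × E N) (E N))).smulRight z))) ((t, x), z) := by
    refine HasFDerivAt.comp (((t, x), z) : (ℝ × E N) × E N)
      (g := F) (f := fun q : (ℝ × E N) × E N => q.1.2 - q.1.1 • q.2)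
      (hF.differentiable (by norm_num) _).hasFDerivAt ?_
    refine HasFDerivAt.sub (hasFDerivAt_snd.comp _ hasFDerivAt_fst) ?_
    exact HasFDerivAt.fun_smul (c := fun q : (ℝ × E N) × E N => q.1.1)
      (f := fun q : (ℝ × E N) × E N => q.2)
      (HasFDerivAt.comp (((t, x), z) : (ℝ × E N) × E N) hasFDerivAt_fst hasFDerivAt_fst)
      hasFDerivAt_snd
  have hψd : HasFDerivAt (fun q : (ℝ × E N) × E N => ψ q.2)
      ((fderiv ℝ ψ z).comp (ContinuousLinearMap.snd ℝ (ℝ × E N) (E N))) ((t, x), z) :=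
    HasFDerivAt.comp (((t, x), z) : (ℝ × E N) × E N) (g := ψ)
      (hψ.differentiable (by norm_num) _).hasFDerivAt hasFDerivAt_snd
  simp only [dirDeriv]
  rw [(hψd.fun_mul hd).fderiv]
  simp

theorem dirDeriv_scaleAvg_space (hψ : ContDiff ℝ 1 ψ) (hψc : HasCompactSupport ψ)
    (hF : ContDiff ℝ 1 F) (v : E N) :
    dirDeriv ((0 : ℝ), v) (scaleAvg ψ F) = scaleAvg ψ (dirDeriv v F) := by
  ext ⟨t, x⟩
  rw [dirDeriv_scaleAvg hψ hψc hF]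
  simp [scaleAvg, dirDeriv]

/-- Moving a derivative onto the kernel. -/
theorem mul_scaleAvg_dirDeriv (hψ : ContDiff ℝ 1 ψ) (hψc : HasCompactSupport ψ)
    (hF : ContDiff ℝ 1 F) (v : E N) (t : ℝ) (x : E N) :
    t * scaleAvg ψ (dirDeriv v F) (t, x) =
      ∫ z, dirDeriv v ψ z * (F (x - t • z) - F x) := by
  -- Subtracting the constant `F x` leaves the derivative in `z` unchanged and produces a difference
  -- on the right, hence an oscillation.
  have hh : ContDiff ℝ 1 fun z => F (x - t • z) - F x :=
    (hF.comp (contDiff_const.sub (contDiff_id.const_smul t))).sub contDiff_const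
  have h := integral_mul_dirDeriv hψ hh hψc v
  have hd : ∀ z, dirDeriv v (fun z => F (x - t • z) - F x) z = -(t * dirDeriv v F (x - t • z)) := by
    intro z
    have h1 : HasFDerivAt (fun z : E N => x - t • z) (-(t • ContinuousLinearMap.id ℝ (E N))) z := by
      simpa using ((hasFDerivAt_id z).const_smul t).const_sub x
    have h2 : HasFDerivAt (fun z : E N => F (x - t • z))
        ((fderiv ℝ F (x - t • z)).comp (-(t • ContinuousLinearMap.id ℝ (E N)))) z :=
      HasFDerivAt.comp z (g := F) (hF.differentiable (by norm_num) _).hasFDerivAt h1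
    rw [dirDeriv, (h2.sub_const (F x)).fderiv]
    simp [dirDeriv]
  simp only [hd] at h
  rw [← neg_inj, ← h, scaleAvg, ← integral_const_mul, ← integral_neg]
  refine integral_congr_ae (Filter.Eventually.of_forall fun z => ?_)
  simp only
  ring

end ScaleAvg

/-! ### Jensen's inequality -/

section Jensen

/-- Jensen's inequality for the power `p ≥ 1` and a measure of arbitrary total mass. -/
theorem lintegral_rpow_le {α : Type*} [MeasurableSpace α] (ν : Measure α) {p : ℝ} (hp : 1 ≤ p)
    {f : α → ℝ≥0∞} (hf : AEMeasurable f ν) :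
    (∫⁻ a, f a ∂ν) ^ p ≤ ν Set.univ ^ (p - 1) * ∫⁻ a, f a ^ p ∂ν := by
  have hp0 : 0 < p := by linarith
  have h := eLpNorm'_le_eLpNorm'_mul_rpow_measure_univ (μ := ν) (f := f) one_pos hp
    hf.aestronglyMeasurable
  simp only [eLpNorm', enorm_eq_self, ENNReal.rpow_one, div_one] at h
  calc (∫⁻ a, f a ∂ν) ^ p
      ≤ ((∫⁻ a, f a ^ p ∂ν) ^ (1 / p) * ν Set.univ ^ (1 - 1 / p)) ^ p := by gcongr
    _ = _ := by
      rw [ENNReal.mul_rpow_of_nonneg _ _ hp0.le, ← ENNReal.rpow_mul, ← ENNReal.rpow_mul,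
        one_div_mul_cancel hp0.ne', ENNReal.rpow_one, mul_comm]
      congr 2
      field_simp

end Jensen

/-! ### From oscillations at all scales to the Gagliardo integral -/

section Scaling

variable {N : ℕ}

theorem lintegral_comp_smul {t : ℝ} (ht : 0 < t) (h : E N → ℝ≥0∞) :
    ∫⁻ z, h (t • z) = ENNReal.ofReal ((t ^ N)⁻¹) * ∫⁻ y, h y := by
  have he : MeasurableEmbedding fun z : E N => t • z :=
    (Homeomorph.smulOfNeZero t ht.ne').measurableEmbedding
  rw [← he.lintegral_map, Measure.map_addHaar_smul _ ht.ne', lintegral_smul_measure]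
  simp [abs_of_pos ht]

/-- Substitute `y = x - t z`. The condition `‖z‖ ≤ 1` becomes `‖x - y‖ ≤ t` and is written as an
indicator in `t`, ready for integration over `t` with `x, y` fixed. -/
theorem lintegral_closedBall_comp {t : ℝ} (ht : 0 < t) (x : E N) (h : E N → ℝ≥0∞) :
    ∫⁻ z in Metric.closedBall 0 1, h (x - t • z) =
      ENNReal.ofReal ((t ^ N)⁻¹) * ∫⁻ y, (Set.Ici ‖x - y‖).indicator (fun _ => h y) t := by
  rw [← lintegral_sub_left_eq_self
      (fun y => (Set.Ici ‖x - y‖).indicator (fun _ => h y) t) x, ← lintegral_comp_smul ht,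
    ← lintegral_indicator Metric.isClosed_closedBall.measurableSet]
  refine lintegral_congr fun z => ?_
  classical
  simp only [Set.indicator_apply, Metric.mem_closedBall, dist_zero_right, Set.mem_Ici,
    sub_sub_cancel, norm_smul, Real.norm_eq_abs, abs_of_pos ht]
  have : ‖z‖ ≤ 1 ↔ t * ‖z‖ ≤ t := by
    constructor
    · intro hz; nlinarith
    · intro hz; exact le_of_mul_le_mul_left (by linarith) ht
  simp only [this]

/-- The integral equals `r^(a+1) / (-a-1)` for `r > 0`, and `a ≤ -2` makes the denominator at least
`1`. For `r = 0` the right side is infinite. -/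
theorem lintegral_rpow_Ici_le {a r : ℝ} (ha : a ≤ -2) (hr : 0 ≤ r) :
    ∫⁻ t in Set.Ioi 0, (Set.Ici r).indicator (fun t => ENNReal.ofReal (t ^ a)) t ≤
      (ENNReal.ofReal r ^ (-a - 1))⁻¹ := by
  rcases hr.eq_or_lt with rfl | hr
  · rw [ENNReal.ofReal_zero, ENNReal.zero_rpow_of_pos (by linarith)]
    simp
  · have h1 : ∫⁻ t in Set.Ioi 0, (Set.Ici r).indicator (fun t => ENNReal.ofReal (t ^ a)) t ≤
        ∫⁻ t in Set.Ici r, ENNReal.ofReal (t ^ a) := by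
      rw [← lintegral_indicator measurableSet_Ici]
      exact setLIntegral_le_lintegral _ _
    refine h1.trans ?_
    rw [setLIntegral_congr (Ioi_ae_eq_Ici (a := r)).symm,
      ← ofReal_integral_eq_lintegral_ofReal (integrableOn_Ioi_rpow_of_lt (by linarith) hr)
        ((ae_restrict_iff' measurableSet_Ioi).2 (Filter.Eventually.of_forall fun t ht =>
          Real.rpow_nonneg (hr.le.trans (le_of_lt ht)) _)),
      integral_Ioi_rpow_of_lt (by linarith) hr,
      ENNReal.ofReal_rpow_of_pos hr, ← ENNReal.ofReal_inv_of_pos (Real.rpow_pos_of_pos hr _),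
      ← Real.rpow_neg hr.le]
    apply ENNReal.ofReal_le_ofReal
    have h2 : 0 < r ^ (a + 1) := Real.rpow_pos_of_pos hr _
    rw [show -(-a - 1) = a + 1 by ring, neg_div, ← div_neg]
    exact div_le_self h2.le (by linarith)

/-- Integrating the oscillation at all scales `t` gives the Gagliardo double integral. -/
theorem lintegral_scales_le (hN : 2 ≤ N) {f : E N × E N → ℝ≥0∞} (hf : Measurable f) :
    ∫⁻ t in Set.Ioi (0 : ℝ), ENNReal.ofReal (t ^ (1 - N : ℝ)) *
        ∫⁻ x, ∫⁻ z in Metric.closedBall 0 1, f (x, x - t • z) ≤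
      ∫⁻ z : E N × E N, f z / ‖z.1 - z.2‖ₑ ^ (2 * N - 2 : ℝ) := by
  have hN' : (2 : ℝ) ≤ N := by exact_mod_cast hN
  have h1 : ∀ t ∈ Set.Ioi (0 : ℝ), ENNReal.ofReal (t ^ (1 - N : ℝ)) *
      ∫⁻ x, ∫⁻ z in Metric.closedBall 0 1, f (x, x - t • z) =
      ∫⁻ z : E N × E N, f z * (Set.Ici ‖z.1 - z.2‖).indicator
        (fun t => ENNReal.ofReal (t ^ (1 - 2 * N : ℝ))) t := by
    intro t ht
    have ht' : 0 < t := ht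
    have hm : Measurable fun z : E N × E N => f z * (Set.Ici ‖z.1 - z.2‖).indicator
        (fun t => ENNReal.ofReal (t ^ (1 - 2 * N : ℝ))) t := by
      refine hf.mul ?_
      have : (fun z : E N × E N => (Set.Ici ‖z.1 - z.2‖).indicator
          (fun t => ENNReal.ofReal (t ^ (1 - 2 * N : ℝ))) t) =
          Set.indicator {z : E N × E N | ‖z.1 - z.2‖ ≤ t}
            (fun _ => ENNReal.ofReal (t ^ (1 - 2 * N : ℝ))) := by
        ext z; simp [Set.indicator_apply]
      rw [this]
      exact measurable_const.indicator
        (measurableSet_le (measurable_fst.sub measurable_snd).norm measurable_const)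
    rw [Measure.volume_eq_prod, lintegral_prod _ hm.aemeasurable,
      ← lintegral_const_mul' _ _ ENNReal.ofReal_ne_top]
    refine lintegral_congr fun x => ?_
    rw [lintegral_closedBall_comp ht' x (fun y => f (x, y)), ← mul_assoc,
      ← ENNReal.ofReal_mul (Real.rpow_nonneg ht'.le _),
      ← lintegral_const_mul' _ _ ENNReal.ofReal_ne_top]
    refine lintegral_congr fun y => ?_
    -- The weight `t^(1-N)` is multiplied by the Jacobian `t^(-N)`; integrating `t^(1-2N)` over `t ≥
    -- |x - y|` then leaves the power `2 - 2N`.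
    have hp : t ^ (1 - N : ℝ) * (t ^ N)⁻¹ = t ^ (1 - 2 * N : ℝ) := by
      rw [← Real.rpow_natCast, ← Real.rpow_neg ht'.le, ← Real.rpow_add ht']
      congr 1; ring
    rw [hp]
    by_cases hy : t ∈ Set.Ici ‖x - y‖
    · simp only [Set.indicator_of_mem hy]; rw [mul_comm]
    · simp only [Set.indicator_of_notMem hy, mul_zero]
  rw [setLIntegral_congr_fun measurableSet_Ioi h1, lintegral_lintegral_swap]
  · refine lintegral_mono fun z => ?_
    have hm : Measurable fun t : ℝ => (Set.Ici ‖z.1 - z.2‖).indicator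
        (fun t => ENNReal.ofReal (t ^ (1 - 2 * N : ℝ))) t :=
      Measurable.indicator (by fun_prop) measurableSet_Ici
    rw [lintegral_const_mul _ hm, div_eq_mul_inv]
    gcongr
    refine (lintegral_rpow_Ici_le (by linarith) (norm_nonneg _)).trans (le_of_eq ?_)
    rw [ofReal_norm]
    congr 2
    ring
  · refine Measurable.aemeasurable ?_
    refine (hf.comp measurable_snd).mul ?_
    have : (fun q : ℝ × (E N × E N) => (Set.Ici ‖q.2.1 - q.2.2‖).indicator
          (fun t => ENNReal.ofReal (t ^ (1 - 2 * N : ℝ))) q.1) =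
          Set.indicator {q : ℝ × (E N × E N) | ‖q.2.1 - q.2.2‖ ≤ q.1}
            (fun q => ENNReal.ofReal (q.1 ^ (1 - 2 * N : ℝ))) := by
        ext z; simp [Set.indicator_apply]
    rw [this]
    refine Measurable.indicator (by fun_prop) ?_
    exact measurableSet_le (by fun_prop) (by fun_prop)

end Scaling

/-! ### The kernel and oscillation bounds -/

section Kernel

variable {N : ℕ}

/-- A bump function supported in the closed unit ball. -/
def unitBump (N : ℕ) : ContDiffBump (0 : E N) := ⟨1 / 2, 1, by norm_num, by norm_num⟩

/-- A smooth even probability density supported in the closed unit ball. -/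
def kernel (N : ℕ) : E N → ℝ := (unitBump N).normed volume

theorem contDiff_kernel {k : ℕ∞} : ContDiff ℝ k (kernel N) := (unitBump N).contDiff_normed

theorem hasCompactSupport_kernel : HasCompactSupport (kernel N) :=
  (unitBump N).hasCompactSupport_normed

theorem kernel_neg (z : E N) : kernel N (-z) = kernel N z := (unitBump N).normed_neg z

theorem integral_kernel : ∫ z, kernel N z = 1 := (unitBump N).integral_normed

theorem tsupport_kernel : tsupport (kernel N) = Metric.closedBall 0 1 :=
  (unitBump N).tsupport_normed_eq

theorem exists_kernel_bound (N : ℕ) : ∃ K : ℝ, 0 ≤ K ∧ (∀ z, |kernel N z| ≤ K) ∧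
    ∀ i z, |dirDeriv (stdVec i) (kernel N) z| ≤ K := by
  obtain ⟨K₀, hK₀⟩ := (contDiff_kernel (N := N) (k := 0)).continuous.bounded_above_of_compact_support
    hasCompactSupport_kernel
  have h : ∀ i : Fin N, ∃ C, ∀ z, ‖dirDeriv (stdVec i) (kernel N) z‖ ≤ C := fun i =>
    (contDiff_dirDeriv (contDiff_kernel (k := 1)) (m := 0) (by simp)
      _).continuous.bounded_above_of_compact_support (hasCompactSupport_kernel.dirDeriv _)
  choose K₁ hK₁ using h
  have hnn : ∀ i, 0 ≤ K₁ i := fun i => (norm_nonneg _).trans (hK₁ i 0)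
  have h0 : 0 ≤ K₀ := (norm_nonneg _).trans (hK₀ 0)
  have hs : 0 ≤ ∑ i, K₁ i := Finset.sum_nonneg fun i _ => hnn i
  refine ⟨K₀ + ∑ i, K₁ i, by positivity, fun z => (hK₀ z).trans (by linarith), fun i z => ?_⟩
  have := Finset.single_le_sum (f := K₁) (fun i _ => hnn i) (Finset.mem_univ i)
  exact (hK₁ i z).trans (by linarith)

theorem scaleAvg_kernel_zero (F : E N → ℝ) (x : E N) : scaleAvg (kernel N) F (0, x) = F x := by
  simp [scaleAvg, integral_mul_const, integral_kernel]

/-- The mean oscillation of `Du` at scale `t` around `x`. -/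
def osc (u : E N → ℝ) (t : ℝ) (x : E N) : ℝ≥0∞ :=
  ∫⁻ z in Metric.closedBall (0 : E N) 1, ‖fderiv ℝ u x - fderiv ℝ u (x - t • z)‖ₑ

theorem enorm_integral_mul_le_osc {u k q : E N → ℝ} {K t : ℝ} {x : E N} (hk : ∀ z, |k z| ≤ K)
    (hk0 : ∀ z, z ∉ Metric.closedBall (0 : E N) 1 → k z = 0)
    (hq : ∀ z ∈ Metric.closedBall (0 : E N) 1,
      ‖q z‖ₑ ≤ ‖fderiv ℝ u x - fderiv ℝ u (x - t • z)‖ₑ) :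
    ‖∫ z, k z * q z‖ₑ ≤ ENNReal.ofReal K * osc u t x := by
  refine (enorm_integral_le_lintegral_enorm _).trans ?_
  rw [osc, ← lintegral_const_mul' _ _ ENNReal.ofReal_ne_top,
    ← lintegral_indicator Metric.isClosed_closedBall.measurableSet]
  refine lintegral_mono fun z => ?_
  by_cases hz : z ∈ Metric.closedBall (0 : E N) 1
  · simp only [Set.indicator_of_mem hz]
    rw [enorm_mul]
    gcongr
    · rw [Real.enorm_eq_ofReal_abs]; exact ENNReal.ofReal_le_ofReal (hk z)
    · exact hq z hz
  · simp [Set.indicator_of_notMem hz, hk0 z hz]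

theorem norm_stdVec (i : Fin N) : ‖(stdVec i : E N)‖ = 1 := by simp [stdVec]

variable {u : E N → ℝ}

/-- The time derivative is `-∫ ρ(z) Du(x - t z) z dz`. Since `ρ` is even, `∫ ρ(z) Du(x) z dz = 0`
may be added, so only the oscillation of `Du` enters, not its size. -/
theorem enorm_dirDeriv_time_le (hu : ContDiff ℝ 1 u) {K : ℝ} (hK : ∀ z, |kernel N z| ≤ K) (t : ℝ)
    (x : E N) :
    ‖dirDeriv ((1 : ℝ), (0 : E N)) (scaleAvg (kernel N) u) (t, x)‖ₑ ≤
      ENNReal.ofReal K * osc u t x := by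
  have hcd : Continuous (fderiv ℝ u) := hu.continuous_fderiv (by norm_num)
  have hkc : Continuous (kernel N) := (contDiff_kernel (k := 0)).continuous
  rw [dirDeriv_scaleAvg (contDiff_kernel (k := 1)) hasCompactSupport_kernel hu]
  have hodd : ∫ z, kernel N z * fderiv ℝ u x z = 0 := by
    have h := integral_neg_eq_self (fun z => kernel N z * fderiv ℝ u x z) volume
    simp only [kernel_neg, map_neg, mul_neg, integral_neg] at h
    linarith
  have heq : ∫ z, kernel N z * fderiv ℝ u (x - t • z) (0 - (1 : ℝ) • z) =
      ∫ z, kernel N z * (fderiv ℝ u x z - fderiv ℝ u (x - t • z) z) := by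
    simp only [mul_sub]
    rw [integral_sub, hodd, zero_sub, ← integral_neg]
    · simp
    · exact (hkc.mul (fderiv ℝ u x).continuous).integrable_of_hasCompactSupport
        hasCompactSupport_kernel.mul_right
    · refine (hkc.mul ?_).integrable_of_hasCompactSupport hasCompactSupport_kernel.mul_right
      exact (hcd.comp (by fun_prop)).clm_apply continuous_id
  rw [heq]
  refine enorm_integral_mul_le_osc hK
    (fun z hz => image_eq_zero_of_notMem_tsupport (by rwa [tsupport_kernel])) fun z hz => ?_
  rw [← _root_.sub_apply, enorm_le_iff_norm_le]
  refine (ContinuousLinearMap.le_opNorm _ _).trans (mul_le_of_le_one_right (norm_nonneg _) ?_)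
  simpa using hz

/-- Of the two derivatives one is moved to the kernel, at the cost of a factor `1/t`; the other
stays on `u` and appears as a difference of `Du`. -/
theorem enorm_mul_scaleAvg_hessian_le (hu : ContDiff ℝ 2 u) {K : ℝ}
    (hK : ∀ i z, |dirDeriv (stdVec i) (kernel N) z| ≤ K) (t : ℝ) (x : E N) (i j : Fin N) :
    ‖t * scaleAvg (kernel N) (dirDeriv (stdVec i) (dirDeriv (stdVec j) u)) (t, x)‖ₑ ≤
      ENNReal.ofReal K * osc u t x := by
  rw [mul_scaleAvg_dirDeriv (contDiff_kernel (k := 1)) hasCompactSupport_kernel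
    (contDiff_dirDeriv hu (by norm_num) _)]
  refine enorm_integral_mul_le_osc (hK i) (fun z hz => ?_) fun z _ => ?_
  · refine image_eq_zero_of_notMem_tsupport fun h => hz ?_
    rw [← tsupport_kernel]
    exact tsupport_fderiv_apply_subset ℝ (stdVec i) h
  · rw [dirDeriv, dirDeriv, ← _root_.sub_apply, enorm_le_iff_norm_le, norm_sub_rev]
    refine (ContinuousLinearMap.le_opNorm _ _).trans ?_
    rw [norm_stdVec, mul_one]

end Kernel

/-! ### Evolution of the Hessian determinant in the scale -/

section Evolution

variable {N : ℕ}

theorem dirDeriv_slice {F : ℝ × E N → ℝ} (hF : Differentiable ℝ F) (t : ℝ) (v x : E N) :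
    dirDeriv v (fun y => F (t, y)) x = dirDeriv ((0 : ℝ), v) F (t, x) := by
  have h1 : HasFDerivAt (fun y : E N => (t, y)) (ContinuousLinearMap.inr ℝ ℝ (E N)) x :=
    hasFDerivAt_prodMk_right t x
  have h2 : HasFDerivAt (fun y : E N => F (t, y))
      ((fderiv ℝ F (t, x)).comp (ContinuousLinearMap.inr ℝ ℝ (E N))) x :=
    HasFDerivAt.comp x (g := F) (hF _).hasFDerivAt h1
  rw [dirDeriv, h2.fderiv]
  simp [dirDeriv]

open scoped ContDiff

variable {U : ℝ × E N → ℝ}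

theorem hessian_slice (hU : ContDiff ℝ ∞ U) (t : ℝ) (x : E N) (i j : Fin N) :
    hessian (fun y => U (t, y)) x i j =
      dirDeriv ((0 : ℝ), stdVec i) (dirDeriv ((0 : ℝ), stdVec j) U) (t, x) := by
  have hs : ContDiff ℝ ∞ fun y => U (t, y) := hU.comp (contDiff_prodMk_right t)
  have hd : ∀ w, ContDiff ℝ ∞ (dirDeriv w U) := fun w => contDiff_dirDeriv hU (by simp) w
  rw [hessian_apply (hs.of_le (WithTop.coe_le_coe.2 (le_top : (2 : ℕ∞) ≤ ⊤)))]
  have h1 : dirDeriv (stdVec j) (fun y => U (t, y)) =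
      fun y => dirDeriv ((0 : ℝ), stdVec j) U (t, y) := by
    ext y; exact dirDeriv_slice (hU.differentiable (by simp)) t _ y
  rw [h1]
  exact dirDeriv_slice ((hd _).differentiable (by simp)) t _ x

/-- Evolution of `∫ det(D²U(t, ·)) φ`: all derivatives can be put on `φ`. -/
theorem integral_det_hessian_slice (hU : ContDiff ℝ ∞ U) {φ : E N → ℝ} (hφ : ContDiff ℝ 2 φ)
    (hφc : HasCompactSupport φ) :
    ContDiff ℝ 1 (fun t => ∫ x, (hessian (fun y => U (t, y)) x).det * φ x) ∧
    ∀ t, deriv (fun t => ∫ x, (hessian (fun y => U (t, y)) x).det * φ x) t =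
      ∫ x, (∑ i, ((hessian (fun y => U (t, y)) x).updateRow i (hessian φ x i)).det) *
        dirDeriv ((1 : ℝ), (0 : E N)) U (t, x) := by
  set A : ℝ × E N → Matrix (Fin N) (Fin N) ℝ := fun p => Matrix.of fun i j =>
    dirDeriv ((0 : ℝ), stdVec i) (dirDeriv ((0 : ℝ), stdVec j) U) p with hA
  have hd : ∀ {f : ℝ × E N → ℝ} (w), ContDiff ℝ ∞ f → ContDiff ℝ ∞ (dirDeriv w f) :=
    fun w hf => contDiff_dirDeriv hf (by simp) w
  have hAs : ∀ t x, hessian (fun y => U (t, y)) x = A (t, x) := by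
    intro t x; ext i j; rw [hessian_slice hU]; rfl
  have hAe : ∀ i j, ContDiff ℝ ∞ fun p => A p i j := fun i j => hd _ (hd _ hU)
  have hdet : ContDiff ℝ ∞ fun p => (A p).det := contDiff_det hAe
  have hΦ : ContDiff ℝ 1 fun q : ℝ × E N => (A q).det * φ q.2 :=
    (hdet.of_le (by simp)).mul ((hφ.of_le (by norm_num)).comp contDiff_snd)
  have hz : ∀ (t : ℝ) (x : E N), x ∉ tsupport φ → (A (t, x)).det * φ x = 0 := by
    intro t x hx
    rw [image_eq_zero_of_notMem_tsupport hx, mul_zero]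
  simp only [hAs]
  refine ⟨contDiff_integral_of_compact (Φ := fun q : ℝ × E N => (A q).det * φ q.2) hφc hz
    (k := 1) hΦ, fun t => ?_⟩
  have h := dirDeriv_integral_of_compact (Φ := fun q : ℝ × E N => (A q).det * φ q.2) hφc hz hΦ
    (1 : ℝ) t
  rw [dirDeriv, fderiv_apply_one_eq_deriv] at h
  refine h.trans ?_
  have hw : ContDiff ℝ ∞ (dirDeriv ((1 : ℝ), (0 : E N)) U) := hd _ hU
  have hws : ∀ x i j, hessian (fun y => dirDeriv ((1 : ℝ), (0 : E N)) U (t, y)) x i j =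
      dirDeriv ((1 : ℝ), (0 : E N)) (fun p => A p i j) (t, x) := by
    intro x i j
    have h2 : ∀ {f : ℝ × E N → ℝ}, ContDiff ℝ ∞ f → ContDiff ℝ 2 f := fun hf =>
      hf.of_le (WithTop.coe_le_coe.2 (le_top : (2 : ℕ∞) ≤ ⊤))
    -- The scale derivative commutes with both space derivatives, so the derivative of the matrix
    -- `A` in `t` is the Hessian of `∂_t U`.
    rw [hessian_slice hw, dirDeriv_comm (h2 hU), dirDeriv_comm (h2 (hd _ hU))]
    rfl
  have hIBP := integral_linearized_hessian_det (v := fun y => U (t, y))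
    (w := fun y => dirDeriv ((1 : ℝ), (0 : E N)) U (t, y)) (φ := φ)
    ((hU.comp (contDiff_prodMk_right t)).of_le (WithTop.coe_le_coe.2 (le_top : (3 : ℕ∞) ≤ ⊤)))
    ((hw.comp (contDiff_prodMk_right t)).of_le (WithTop.coe_le_coe.2 (le_top : (2 : ℕ∞) ≤ ⊤))) hφ hφc
  simp only [hAs] at hIBP
  rw [← hIBP]
  refine integral_congr_ae (Filter.Eventually.of_forall fun x => ?_)
  simp only
  have hφd : HasFDerivAt (fun q : ℝ × E N => φ q.2)
      ((fderiv ℝ φ x).comp (ContinuousLinearMap.snd ℝ ℝ (E N))) (t, x) :=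
    HasFDerivAt.comp ((t, x) : ℝ × E N) (g := φ)
      (hφ.differentiable (by norm_num) _).hasFDerivAt hasFDerivAt_snd
  rw [dirDeriv_mul (hdet.differentiable (by simp) _) hφd.differentiableAt,
    dirDeriv_det (fun i j => (hAe i j).differentiable (by simp) _)]
  have h0 : dirDeriv ((1 : ℝ), (0 : E N)) (fun q : ℝ × E N => φ q.2) (t, x) = 0 := by
    rw [dirDeriv, hφd.fderiv]; simp
  rw [h0, mul_zero, add_zero]
  congr 1
  refine Finset.sum_congr rfl fun i _ => ?_
  congr 2
  ext j
  exact (hws x i j).symm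

end Evolution

/-! ### The estimate for a single smooth function -/

section Diagonal

open scoped ContDiff
open Filter Topology

variable {N : ℕ} {u φ : E N → ℝ}

/-- The bound is uniform in `t` and `x`; it gives both finiteness of the oscillation and the decay
of `D²U` at large scales. -/
theorem osc_ne_top {L : ℝ} (hL : ∀ x, ‖fderiv ℝ u x‖ ≤ L) (t : ℝ) (x : E N) :
    osc u t x ≤ ENNReal.ofReal (2 * L) * volume (Metric.closedBall (0 : E N) 1) := by
  rw [osc, ← setLIntegral_const]
  refine lintegral_mono fun z => ?_
  rw [← ofReal_norm]
  refine ENNReal.ofReal_le_ofReal ((norm_sub_le _ _).trans ?_)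
  linarith [hL x, hL (x - t • z)]

theorem enorm_sub_zero_le_lintegral_deriv {g : ℝ → ℝ} (hg : ContDiff ℝ 1 g) {b : ℝ} (hb : 0 ≤ b) :
    ‖g b - g 0‖ₑ ≤ ∫⁻ t in Set.Ioi (0 : ℝ), ‖deriv g t‖ₑ := by
  have hc : Continuous (deriv g) := hg.continuous_deriv le_rfl
  have h := intervalIntegral.integral_eq_sub_of_hasDerivAt (a := 0) (b := b) (f := g)
    (f' := deriv g) (fun t _ => (hg.differentiable (by norm_num) t).hasDerivAt)
    (hc.intervalIntegrable _ _)
  rw [← h, intervalIntegral.integral_of_le hb]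
  exact (enorm_integral_le_lintegral_enorm _).trans
    (lintegral_mono_set Set.Ioc_subset_Ioi_self)

theorem rpow_osc_le (hN : 1 ≤ N) (hu : ContDiff ℝ 1 u) (t : ℝ) (x : E N) :
    osc u t x ^ (N : ℝ) ≤ volume (Metric.closedBall (0 : E N) 1) ^ ((N : ℝ) - 1) *
      ∫⁻ z in Metric.closedBall (0 : E N) 1,
        ‖fderiv ℝ u x - fderiv ℝ u (x - t • z)‖ₑ ^ (N : ℝ) := by
  have hcd : Continuous (fderiv ℝ u) := hu.continuous_fderiv (by norm_num)
  have hm : Continuous fun z : E N => fderiv ℝ u x - fderiv ℝ u (x - t • z) :=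
    continuous_const.sub (hcd.comp (by fun_prop))
  have h := lintegral_rpow_le (volume.restrict (Metric.closedBall (0 : E N) 1))
    (p := N) (by exact_mod_cast hN) (f := fun z => ‖fderiv ℝ u x - fderiv ℝ u (x - t • z)‖ₑ)
    hm.enorm.measurable.aemeasurable
  simpa [osc] using h

/-- For `t > 0` the integrand of the evolution equation is controlled by the oscillation. -/
theorem enorm_evolution_integrand_le (hN : 2 ≤ N) (hu : ContDiff ℝ ∞ u)
    (huc : HasCompactSupport u) {K : ℝ} (hK0 : 0 ≤ K) (hK : ∀ z, |kernel N z| ≤ K)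
    (hK' : ∀ i z, |dirDeriv (stdVec i) (kernel N) z| ≤ K) {M : ℝ} {x : E N}
    (hM : ∀ i j, |hessian φ x i j| ≤ M) {t : ℝ} (ht : 0 < t) :
    ‖(∑ i, ((hessian (fun y => scaleAvg (kernel N) u (t, y)) x).updateRow i
        (hessian φ x i)).det) *
      dirDeriv ((1 : ℝ), (0 : E N)) (scaleAvg (kernel N) u) (t, x)‖ₑ ≤
    ENNReal.ofReal ((N ^ 2 * N.factorial) * K ^ N * M) *
      (ENNReal.ofReal (t ^ (1 - N : ℝ)) * osc u t x ^ (N : ℝ)) := by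
  have hu1 : ContDiff ℝ 1 u := hu.of_le (by simp)
  have hu2 : ContDiff ℝ 2 u := hu.of_le (WithTop.coe_le_coe.2 (le_top : (2 : ℕ∞) ≤ ⊤))
  have hU : ContDiff ℝ ∞ (scaleAvg (kernel N) u) :=
    contDiff_scaleAvg contDiff_kernel hasCompactSupport_kernel hu
  obtain ⟨L, hL⟩ := (hu1.continuous_fderiv (by norm_num)).bounded_above_of_compact_support
    (huc.fderiv ℝ)
  have hfin : osc u t x ≠ ⊤ := ((osc_ne_top hL t x).trans_lt
    (ENNReal.mul_lt_top ENNReal.ofReal_lt_top measure_closedBall_lt_top)).ne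
  set m := (osc u t x).toReal with hm
  have hm0 : 0 ≤ m := ENNReal.toReal_nonneg
  have toR : ∀ {a : ℝ}, ‖a‖ₑ ≤ ENNReal.ofReal K * osc u t x → |a| ≤ K * m := by
    intro a ha
    have := ENNReal.toReal_mono (ENNReal.mul_ne_top ENNReal.ofReal_ne_top hfin) ha
    rwa [ENNReal.toReal_mul, ENNReal.toReal_ofReal hK0, toReal_enorm, Real.norm_eq_abs] at this
  have hw := toR (enorm_dirDeriv_time_le hu1 hK t x)
  have hk1 : ContDiff ℝ 1 (kernel N) := contDiff_kernel (k := 1)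
  have hH : ∀ i j, |hessian (fun y => scaleAvg (kernel N) u (t, y)) x i j| ≤ K * m / t := by
    intro i j
    rw [hessian_slice hU, dirDeriv_scaleAvg_space hk1 hasCompactSupport_kernel hu1,
      dirDeriv_scaleAvg_space hk1 hasCompactSupport_kernel
        (contDiff_dirDeriv hu2 (by norm_num) _), le_div_iff₀ ht]
    have := toR (enorm_mul_scaleAvg_hessian_le hu2 hK' t x i j)
    rwa [abs_mul, abs_of_pos ht, mul_comm] at this
  -- The `N - 1` remaining Hessian rows contribute `K m / t` each and the time derivative
  -- contributes `K m`, in total `K^N m^N t^(1-N)`.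
  have hS := abs_sum_det_updateRow_le (by simpa using hN) hH hM
  simp only [Fintype.card_fin] at hS
  rw [Real.enorm_eq_ofReal_abs, abs_mul, ← ENNReal.ofReal_toReal hfin, ← hm,
    ENNReal.ofReal_rpow_of_nonneg hm0 (by positivity),
    ← ENNReal.ofReal_mul (Real.rpow_nonneg ht.le _), ← ENNReal.ofReal_mul' (by positivity)]
  apply ENNReal.ofReal_le_ofReal
  refine (mul_le_mul hS hw (abs_nonneg _) ((abs_nonneg _).trans hS)).trans (le_of_eq ?_)
  have e1 : t ^ (1 - N : ℝ) = (t ^ (N - 1))⁻¹ := by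
    rw [← Real.rpow_natCast, ← Real.rpow_neg ht.le, Nat.cast_sub (by omega)]
    congr 1; push_cast; ring
  have e2 : ∀ a : ℝ, a ^ N = a ^ (N - 1) * a := by
    intro a; rw [← pow_succ]; congr 1; omega
  rw [e1, Real.rpow_natCast, e2 K, e2 m, div_pow, mul_pow]
  field_simp

/-- As `Du` is bounded, the Hessian at scale `t` is `O(1/t)` uniformly in `x`, so its determinant is
`O(t^(-N))`. -/
theorem tendsto_integral_det_hessian_scaleAvg (hN : 2 ≤ N) (hu : ContDiff ℝ ∞ u)
    (huc : HasCompactSupport u) (hφ : ContDiff ℝ 2 φ) (hφc : HasCompactSupport φ) :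
    Tendsto (fun t => ∫ x, (hessian (fun y => scaleAvg (kernel N) u (t, y)) x).det * φ x)
      atTop (𝓝 0) := by
  have hu1 : ContDiff ℝ 1 u := hu.of_le (by simp)
  have hu2 : ContDiff ℝ 2 u := hu.of_le (WithTop.coe_le_coe.2 (le_top : (2 : ℕ∞) ≤ ⊤))
  have hU : ContDiff ℝ ∞ (scaleAvg (kernel N) u) :=
    contDiff_scaleAvg contDiff_kernel hasCompactSupport_kernel hu
  have hk1 : ContDiff ℝ 1 (kernel N) := contDiff_kernel (k := 1)
  obtain ⟨K, hK0, hK, hK'⟩ := exists_kernel_bound N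
  obtain ⟨L, hL⟩ := (hu1.continuous_fderiv (by norm_num)).bounded_above_of_compact_support
    (huc.fderiv ℝ)
  set R := K * (ENNReal.ofReal (2 * L) * volume (Metric.closedBall (0 : E N) 1)).toReal with hR
  have hfin : ENNReal.ofReal (2 * L) * volume (Metric.closedBall (0 : E N) 1) ≠ ⊤ :=
    (ENNReal.mul_lt_top ENNReal.ofReal_lt_top measure_closedBall_lt_top).ne
  have hH : ∀ t > 0, ∀ x i j,
      |hessian (fun y => scaleAvg (kernel N) u (t, y)) x i j| ≤ R / t := by
    intro t ht x i j
    rw [hessian_slice hU, dirDeriv_scaleAvg_space hk1 hasCompactSupport_kernel hu1,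
      dirDeriv_scaleAvg_space hk1 hasCompactSupport_kernel
        (contDiff_dirDeriv hu2 (by norm_num) _), le_div_iff₀ ht]
    have h := (enorm_mul_scaleAvg_hessian_le hu2 hK' t x i j).trans
      (mul_le_mul_right (osc_ne_top hL t x) _)
    have := ENNReal.toReal_mono (ENNReal.mul_ne_top ENNReal.ofReal_ne_top hfin) h
    rwa [ENNReal.toReal_mul, ENNReal.toReal_ofReal hK0, toReal_enorm, Real.norm_eq_abs, abs_mul,
      abs_of_pos ht, mul_comm t] at this
  have hφi : Integrable φ := hφ.continuous.integrable_of_hasCompactSupport hφc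
  refine squeeze_zero_norm' (a := fun t => (N.factorial * (R / t) ^ N) * ∫ x, ‖φ x‖) ?_ ?_
  · filter_upwards [eventually_gt_atTop 0] with t ht
    rw [← integral_const_mul]
    refine norm_integral_le_of_norm_le (hφi.norm.const_mul _)
      (Eventually.of_forall fun x => ?_)
    rw [norm_mul]
    gcongr
    simpa using abs_det_le (hH t ht x)
  · have h1 : Tendsto (fun t : ℝ => R / t) atTop (𝓝 0) := tendsto_const_nhds.div_atTop tendsto_id
    have h2 := ((h1.pow N).const_mul (N.factorial : ℝ)).mul_const (∫ x, ‖φ x‖)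
    simpa [show N ≠ 0 by omega] using h2

/-- The Hessian determinant of a smooth function is controlled by the Gagliardo double integral
of its gradient, with two derivatives on the test function. -/
theorem exists_enorm_integral_det_hessian_le (hN : 2 ≤ N) : ∃ C : ℝ≥0∞, C ≠ ⊤ ∧
    ∀ (u φ : E N → ℝ) (M : ℝ), ContDiff ℝ ∞ u → HasCompactSupport u → ContDiff ℝ 2 φ →
      HasCompactSupport φ → (∀ᵐ x, ∀ i j, |hessian φ x i j| ≤ M) →
      ‖∫ x, (hessian u x).det * φ x‖ₑ ≤ C * ENNReal.ofReal M *
        ∫⁻ z : E N × E N, ‖fderiv ℝ u z.1 - fderiv ℝ u z.2‖ₑ ^ (N : ℝ) /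
          ‖z.1 - z.2‖ₑ ^ (2 * N - 2 : ℝ) := by
  obtain ⟨K, hK0, hK, hK'⟩ := exists_kernel_bound N
  have hN1 : (1 : ℝ) ≤ N := by exact_mod_cast (show 1 ≤ N by omega)
  set V := volume (Metric.closedBall (0 : E N) 1) ^ ((N : ℝ) - 1) with hV
  have hVtop : V ≠ ⊤ := ENNReal.rpow_ne_top_of_nonneg (by linarith) measure_closedBall_lt_top.ne
  refine ⟨ENNReal.ofReal ((N ^ 2 * N.factorial) * K ^ N) * V,
    ENNReal.mul_ne_top ENNReal.ofReal_ne_top hVtop, ?_⟩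
  intro u φ M hu huc hφ hφc hM
  have hu1 : ContDiff ℝ 1 u := hu.of_le (by simp)
  have hU : ContDiff ℝ ∞ (scaleAvg (kernel N) u) :=
    contDiff_scaleAvg contDiff_kernel hasCompactSupport_kernel hu
  set g : ℝ → ℝ := fun t =>
    ∫ x, (hessian (fun y => scaleAvg (kernel N) u (t, y)) x).det * φ x with hg
  obtain ⟨hg1, hg'⟩ := integral_det_hessian_slice hU hφ hφc
  have hg0 : g 0 = ∫ x, (hessian u x).det * φ x := by
    simp only [hg, scaleAvg_kernel_zero]
  set B := ∫⁻ t in Set.Ioi (0 : ℝ), ‖deriv g t‖ₑ with hB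
  have hle : ‖∫ x, (hessian u x).det * φ x‖ₑ ≤ B := by
    have h1 : Tendsto (fun b => ‖g b - g 0‖ₑ) atTop (𝓝 ‖(0 : ℝ) - g 0‖ₑ) :=
      (((tendsto_integral_det_hessian_scaleAvg hN hu huc hφ hφc).sub_const (g 0)).enorm)
    -- The bound on `|g b - g 0|` by the full integral of `|g'|` does not depend on `b`; letting `b
    -- → ∞` removes `g b`.
    have h2 := le_of_tendsto h1 ((eventually_ge_atTop 0).mono fun b hb =>
      enorm_sub_zero_le_lintegral_deriv hg1 hb)
    rwa [zero_sub, enorm_neg, hg0] at h2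
  refine hle.trans ?_
  have hcd : Continuous (fderiv ℝ u) := hu1.continuous_fderiv (by norm_num)
  have hf : Measurable fun z : E N × E N => ‖fderiv ℝ u z.1 - fderiv ℝ u z.2‖ₑ ^ (N : ℝ) := by
    have : Continuous fun z : E N × E N => fderiv ℝ u z.1 - fderiv ℝ u z.2 :=
      (hcd.comp continuous_fst).sub (hcd.comp continuous_snd)
    exact this.enorm.measurable.pow_const _
  refine le_trans ?_ (mul_le_mul_right (lintegral_scales_le hN hf) _)
  rw [← lintegral_const_mul' _ _ (ENNReal.mul_ne_top (ENNReal.mul_ne_top ENNReal.ofReal_ne_top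
    hVtop) ENNReal.ofReal_ne_top)]
  refine setLIntegral_mono' measurableSet_Ioi fun t ht => ?_
  rw [hg']
  refine (enorm_integral_le_lintegral_enorm _).trans ?_
  calc _ ≤ ∫⁻ x, ENNReal.ofReal ((N ^ 2 * N.factorial) * K ^ N * M) *
          (ENNReal.ofReal (t ^ (1 - N : ℝ)) * osc u t x ^ (N : ℝ)) := by
        refine lintegral_mono_ae (hM.mono fun x hx => ?_)
        exact enorm_evolution_integrand_le hN hu huc hK0 hK hK' hx ht
    _ ≤ ∫⁻ x, ENNReal.ofReal ((N ^ 2 * N.factorial) * K ^ N * M) *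
          (ENNReal.ofReal (t ^ (1 - N : ℝ)) * (V * ∫⁻ z in Metric.closedBall (0 : E N) 1,
            ‖fderiv ℝ u x - fderiv ℝ u (x - t • z)‖ₑ ^ (N : ℝ))) := by
        gcongr with x
        exact rpow_osc_le (by omega) hu1 t x
    _ = _ := by
        rw [lintegral_const_mul' _ _ ENNReal.ofReal_ne_top,
          lintegral_const_mul' _ _ ENNReal.ofReal_ne_top, lintegral_const_mul' _ _ hVtop,
          ENNReal.ofReal_mul (by positivity)]
        ring

end Diagonal

/-! ### Integrated Jensen inequality -/

section Minkowski

variable {X Z : Type*} [MeasurableSpace X] [MeasurableSpace Z]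

/-- Jensen's inequality for an average of functions, integrated. -/
theorem lintegral_rpow_lintegral_le (μ : Measure X) [SFinite μ] (ν : Measure Z) [SFinite ν]
    {p : ℝ} (hp : 1 ≤ p) {f : X × Z → ℝ≥0∞} (hf : Measurable f) :
    ∫⁻ x, (∫⁻ z, f (x, z) ∂ν) ^ p ∂μ ≤
      ν Set.univ ^ (p - 1) * ∫⁻ z, ∫⁻ x, f (x, z) ^ p ∂μ ∂ν := by
  have hm : Measurable fun x => ∫⁻ z, f (x, z) ^ p ∂ν :=
    (hf.pow_const p).lintegral_prod_right'
  calc ∫⁻ x, (∫⁻ z, f (x, z) ∂ν) ^ p ∂μ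
      ≤ ∫⁻ x, ν Set.univ ^ (p - 1) * ∫⁻ z, f (x, z) ^ p ∂ν ∂μ :=
        lintegral_mono fun x => lintegral_rpow_le ν hp
          (hf.comp measurable_prodMk_left).aemeasurable
    _ = ν Set.univ ^ (p - 1) * ∫⁻ x, ∫⁻ z, f (x, z) ^ p ∂ν ∂μ := lintegral_const_mul _ hm
    _ = _ := by
        rw [lintegral_lintegral_swap (hf.pow_const p).aemeasurable]

end Minkowski

/-! ### Continuity of translations in `L^p` -/

section Translation

variable {X : Type*} [NormedAddCommGroup X] [MeasurableSpace X] [BorelSpace X]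
variable {F : Type*} [NormedAddCommGroup F]

/-- Translations are continuous in `L^p`. -/
theorem exists_forall_eLpNorm_translate_sub_le (μ : Measure X) [μ.IsAddRightInvariant]
    [IsLocallyFiniteMeasure μ] [μ.InnerRegularCompactLTTop] {p : ℝ≥0∞} [Fact (1 ≤ p)]
    (hp : p ≠ ∞) {f : X → F} (hf : MemLp f p μ) {ε : ℝ} (hε : 0 < ε) :
    ∃ δ > 0, ∀ z : X, ‖z‖ < δ →
      eLpNorm (fun x => f (x - z) - f x) p μ ≤ ENNReal.ofReal ε := by
  -- Translations form a continuous family of measure-preserving continuous maps; composition with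
  -- such a family is continuous in `L^p`.
  set g : C(X, C(X, X)) :=
    (ContinuousMap.mk (fun a : X × X => a.2 - a.1) (by fun_prop)).curry with hg
  have hgm : ∀ z, MeasurePreserving (g z) μ μ := fun z => measurePreserving_sub_right μ z
  have hcont : Continuous fun z => Lp.compMeasurePreserving (g z) (hgm z) (hf.toLp f) :=
    continuous_const.compMeasurePreservingLp g.continuous hgm hp
  have h0 : Lp.compMeasurePreserving (g 0) (hgm 0) (hf.toLp f) = hf.toLp f := by
    apply Lp.ext
    refine (Lp.coeFn_compMeasurePreserving _ (hgm 0)).trans ?_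
    refine Filter.Eventually.of_forall fun x => ?_
    simp [hg]
  obtain ⟨δ, hδ, h⟩ := Metric.continuous_iff.1 hcont 0 ε hε
  refine ⟨δ, hδ, fun z hz => ?_⟩
  have h1 := h z (by simpa using hz)
  rw [h0, dist_eq_norm, Lp.norm_def] at h1
  have h2 : eLpNorm (fun x => f (x - z) - f x) p μ =
      eLpNorm (Lp.compMeasurePreserving (g z) (hgm z) (hf.toLp f) - hf.toLp f : Lp F p μ) p μ := by
    apply eLpNorm_congr_ae
    have e1 := (hgm z).quasiMeasurePreserving.ae_eq_comp hf.coeFn_toLp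
    filter_upwards [Lp.coeFn_sub (Lp.compMeasurePreserving (g z) (hgm z) (hf.toLp f)) (hf.toLp f),
      Lp.coeFn_compMeasurePreserving (hf.toLp f) (hgm z), hf.coeFn_toLp, e1] with x a b c d
    rw [a, Pi.sub_apply, b, c, d]
    rfl
  rw [h2]
  exact ENNReal.le_ofReal_iff_toReal_le (Lp.eLpNorm_ne_top _) hε.le |>.2 h1.le

end Translation

/-! ### The Gagliardo seminorm of `C^1` functions -/

section GagliardoBound

variable {N : ℕ} {F : Type*} [NormedAddCommGroup F]

/-- In polar coordinates the radial integrand is `y^(p-1-σp)` near `0`, integrable as `σ < 1`, and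
`y^(-1-σp)` at infinity, integrable as `σ > 0`. -/
theorem lintegral_gagliardo_kernel_lt_top (hN : 1 ≤ N) {p σ : ℝ} (hp : 1 ≤ p) (hσ : 0 < σ)
    (hσ' : σ < 1) :
    ∫⁻ h : E N, ENNReal.ofReal (min 1 ‖h‖ ^ p * ‖h‖ ^ (-(N + σ * p))) < ∞ := by
  have : Nonempty (Fin N) := ⟨⟨0, hN⟩⟩
  have : Nontrivial (E N) := inferInstance
  have hp0 : 0 < p := by linarith
  have hintegrable : Integrable (fun h : E N => min 1 ‖h‖ ^ p * ‖h‖ ^ (-(N + σ * p))) := by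
    rw [integrable_fun_norm_addHaar (volume : Measure (E N))
      (f := fun y => min 1 y ^ p * y ^ (-(N + σ * p)))]
    simp only [finrank_euclideanSpace, Fintype.card_fin, smul_eq_mul]
    have e : ∀ y : ℝ, 0 < y → y ^ (N - 1) * (min 1 y ^ p * y ^ (-(N + σ * p))) =
        min 1 y ^ p * y ^ (-1 - σ * p) := by
      intro y hy
      rw [← Real.rpow_natCast, Nat.cast_sub hN, mul_left_comm, ← Real.rpow_add hy]
      congr 2; push_cast; ring
    rw [integrableOn_congr_fun (fun y (hy : y ∈ Set.Ioi (0 : ℝ)) => e y hy) measurableSet_Ioi,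
      ← Set.Ioc_union_Ioi_eq_Ioi (zero_le_one' ℝ), integrableOn_union]
    constructor
    · have : IntegrableOn (fun y : ℝ => y ^ (p - 1 - σ * p)) (Set.Ioc 0 1) := by
        rw [← intervalIntegrable_iff_integrableOn_Ioc_of_le zero_le_one]
        apply intervalIntegral.intervalIntegrable_rpow'
        nlinarith
      refine this.congr_fun (fun y hy => ?_) measurableSet_Ioc
      simp only
      rw [min_eq_right hy.2, ← Real.rpow_add hy.1]
      congr 1; ring
    · have : IntegrableOn (fun y : ℝ => y ^ (-1 - σ * p)) (Set.Ioi 1) :=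
        integrableOn_Ioi_rpow_of_lt (by nlinarith) one_pos
      refine this.congr_fun (fun y hy => ?_) measurableSet_Ioi
      simp only
      rw [min_eq_left (le_of_lt hy), Real.one_rpow, one_mul]
  have h := hintegrable.hasFiniteIntegral
  rw [hasFiniteIntegral_iff_ofReal (Filter.Eventually.of_forall fun h => by positivity)] at h
  exact h

theorem lintegral_translate_sub_le_two {p : ℝ} (hp : 1 ≤ p) {G : E N → F} (hG : Continuous G)
    (h : E N) :
    ∫⁻ x, ‖G x - G (x + h)‖ₑ ^ p ≤ 2 ^ p * ∫⁻ x, ‖G x‖ₑ ^ p := by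
  have hm : Measurable fun x => ‖G x‖ₑ ^ p := hG.enorm.measurable.pow_const p
  calc ∫⁻ x, ‖G x - G (x + h)‖ₑ ^ p
      ≤ ∫⁻ x, 2 ^ (p - 1) * (‖G x‖ₑ ^ p + ‖G (x + h)‖ₑ ^ p) := by
        refine lintegral_mono fun x => ?_
        calc ‖G x - G (x + h)‖ₑ ^ p ≤ (‖G x‖ₑ + ‖G (x + h)‖ₑ) ^ p := by
              gcongr; exact enorm_sub_le
          _ ≤ _ := ENNReal.rpow_add_le_mul_rpow_add_rpow _ _ hp
    _ = 2 ^ (p - 1) * ((∫⁻ x, ‖G x‖ₑ ^ p) + ∫⁻ x, ‖G x‖ₑ ^ p) := by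
        rw [lintegral_const_mul' _ _ (ENNReal.rpow_ne_top_of_nonneg (by linarith) (by norm_num)),
          lintegral_add_left hm, lintegral_add_right_eq_self (fun x => ‖G x‖ₑ ^ p) h]
    _ = _ := by
        rw [← two_mul, ← mul_assoc]
        congr 1
        nth_rewrite 2 [← ENNReal.rpow_one 2]
        rw [← ENNReal.rpow_add _ _ (by norm_num) (by norm_num)]
        congr 1; ring

/-- Write the difference as the integral of the derivative along the segment, apply Jensen in the
segment variable, and use translation invariance in `x`. -/
theorem lintegral_translate_sub_le_fderiv [NormedSpace ℝ F] [CompleteSpace F] {p : ℝ} (hp : 1 ≤ p) {G : E N → F}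
    (hG : ContDiff ℝ 1 G) (h : E N) :
    ∫⁻ x, ‖G x - G (x + h)‖ₑ ^ p ≤ ‖h‖ₑ ^ p * ∫⁻ x, ‖fderiv ℝ G x‖ₑ ^ p := by
  have hp0 : 0 ≤ p := by linarith
  have hcd : Continuous (fderiv ℝ G) := hG.continuous_fderiv (by norm_num)
  have key : ∀ x, ‖G x - G (x + h)‖ₑ ≤
      ∫⁻ s in Set.Ioc (0 : ℝ) 1, ‖h‖ₑ * ‖fderiv ℝ G (x + s • h)‖ₑ := by
    intro x
    have hd : ∀ s : ℝ, HasDerivAt (fun s : ℝ => G (x + s • h)) (fderiv ℝ G (x + s • h) h) s := by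
      intro s
      have h1 : HasDerivAt (fun s : ℝ => x + s • h) h s := by
        simpa using ((hasDerivAt_id s).smul_const h).const_add x
      exact HasFDerivAt.comp_hasDerivAt (l := G) s
        (hG.differentiable (by norm_num) _).hasFDerivAt h1
    have hc : Continuous fun s : ℝ => fderiv ℝ G (x + s • h) h :=
      (hcd.comp (by fun_prop)).clm_apply continuous_const
    have := intervalIntegral.integral_eq_sub_of_hasDerivAt (a := 0) (b := 1)
      (fun s _ => hd s) (hc.intervalIntegrable _ _)
    simp only [one_smul, zero_smul, add_zero] at this
    rw [← enorm_neg, neg_sub, ← this, intervalIntegral.integral_of_le zero_le_one]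
    refine (enorm_integral_le_lintegral_enorm _).trans (lintegral_mono fun s => ?_)
    rw [mul_comm]
    exact ContinuousLinearMap.le_opENorm _ _
  have hm : Measurable fun q : E N × ℝ => ‖h‖ₑ * ‖fderiv ℝ G (q.1 + q.2 • h)‖ₑ :=
    measurable_const.mul (hcd.comp (by fun_prop :
      Continuous fun q : E N × ℝ => q.1 + q.2 • h)).enorm.measurable
  calc ∫⁻ x, ‖G x - G (x + h)‖ₑ ^ p
      ≤ ∫⁻ x, (∫⁻ s in Set.Ioc (0 : ℝ) 1, ‖h‖ₑ * ‖fderiv ℝ G (x + s • h)‖ₑ) ^ p := by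
        gcongr with x; exact key x
    _ ≤ _ := lintegral_rpow_lintegral_le volume (volume.restrict (Set.Ioc (0 : ℝ) 1)) hp hm
    _ = _ := by
        have : ∀ s : ℝ, ∫⁻ x, (‖h‖ₑ * ‖fderiv ℝ G (x + s • h)‖ₑ) ^ p =
            ‖h‖ₑ ^ p * ∫⁻ x, ‖fderiv ℝ G x‖ₑ ^ p := by
          intro s
          simp only [ENNReal.mul_rpow_of_nonneg _ _ hp0]
          rw [lintegral_const_mul' _ _ (ENNReal.rpow_ne_top_of_nonneg hp0 enorm_ne_top),
            lintegral_add_right_eq_self (fun x => ‖fderiv ℝ G x‖ₑ ^ p) (s • h)]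
        simp only [this]
        simp

/-- The Gagliardo double integral of a `C^1` function is controlled by its `W^{1,p}` norm. -/
theorem exists_lintegral_gagliardo_le (hN : 1 ≤ N) {p σ : ℝ} (hp : 1 ≤ p) (hσ : 0 < σ)
    (hσ' : σ < 1) (F : Type*) [NormedAddCommGroup F] [NormedSpace ℝ F] [CompleteSpace F] :
    ∃ C : ℝ≥0∞, C ≠ ∞ ∧ ∀ G : E N → F, ContDiff ℝ 1 G →
      ∫⁻ z : E N × E N, ‖G z.1 - G z.2‖ₑ ^ p / ‖z.1 - z.2‖ₑ ^ (N + σ * p) ≤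
        C * ((∫⁻ x, ‖G x‖ₑ ^ p) + ∫⁻ x, ‖fderiv ℝ G x‖ₑ ^ p) := by
  have hp0 : 0 < p := by linarith
  have hexp : 0 < N + σ * p := by positivity
  refine ⟨(∫⁻ h : E N, ENNReal.ofReal (min 1 ‖h‖ ^ p * ‖h‖ ^ (-(N + σ * p)))) * 2 ^ p,
    ENNReal.mul_ne_top (lintegral_gagliardo_kernel_lt_top hN hp hσ hσ').ne
      (ENNReal.rpow_ne_top_of_nonneg hp0.le (by norm_num)), fun G hG => ?_⟩
  set I := (∫⁻ x, ‖G x‖ₑ ^ p) + ∫⁻ x, ‖fderiv ℝ G x‖ₑ ^ p with hI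
  set f : E N × E N → ℝ≥0∞ := fun z =>
    ‖G z.1 - G z.2‖ₑ ^ p / ‖z.1 - z.2‖ₑ ^ (N + σ * p) with hf
  have hfm : Measurable f := by
    refine Measurable.div ?_ ?_
    · have : Continuous fun z : E N × E N => G z.1 - G z.2 :=
        (hG.continuous.comp continuous_fst).sub (hG.continuous.comp continuous_snd)
      exact this.enorm.measurable.pow_const _
    · exact (measurable_fst.sub measurable_snd).enorm.pow_const _
  have h1 : ∫⁻ z, f z = ∫⁻ h, ∫⁻ x, f (x, x + h) := by
    rw [Measure.volume_eq_prod, lintegral_prod _ hfm.aemeasurable]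
    rw [lintegral_congr fun x => (lintegral_add_left_eq_self (fun y => f (x, y)) x).symm]
    rw [lintegral_lintegral_swap]
    exact (hfm.comp (by fun_prop :
      Measurable fun q : E N × E N => (q.1, q.1 + q.2))).aemeasurable
  rw [h1, mul_assoc, ← lintegral_mul_const'' _ (by fun_prop)]
  refine lintegral_mono_ae ?_
  have hne : ∀ᵐ h : E N, h ≠ 0 := by
    have : Nonempty (Fin N) := ⟨⟨0, hN⟩⟩
    have : Nontrivial (E N) := inferInstance
    rw [ae_iff]; simp
  filter_upwards [hne] with h hh
  have hpos : 0 < ‖h‖ := norm_pos_iff.2 hh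
  have h2 : ∫⁻ x, f (x, x + h) = (∫⁻ x, ‖G x - G (x + h)‖ₑ ^ p) * (‖h‖ₑ ^ (N + σ * p))⁻¹ := by
    simp only [hf, div_eq_mul_inv, sub_add_cancel_left, enorm_neg]
    rw [lintegral_mul_const']
    simp [ENNReal.inv_eq_top, hh, ENNReal.rpow_eq_zero_iff, hexp]
  -- The triangle inequality serves for long increments `h` and the derivative bound for short ones;
  -- together they give the factor `min 1 ‖h‖ ^ p`.
  have h3 : ∫⁻ x, ‖G x - G (x + h)‖ₑ ^ p ≤ ENNReal.ofReal (min 1 ‖h‖ ^ p) * (2 ^ p * I) := by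
    rcases le_total 1 ‖h‖ with h1 | h1
    · rw [min_eq_left h1, Real.one_rpow, ENNReal.ofReal_one, one_mul]
      refine (lintegral_translate_sub_le_two hp hG.continuous h).trans ?_
      gcongr
      exact le_self_add
    · rw [min_eq_right h1, ← ENNReal.ofReal_rpow_of_pos hpos, ofReal_norm]
      refine (lintegral_translate_sub_le_fderiv hp hG h).trans ?_
      gcongr
      calc ∫⁻ x, ‖fderiv ℝ G x‖ₑ ^ p ≤ 1 * I := by rw [one_mul]; exact le_add_self
        _ ≤ 2 ^ p * I := by
          gcongr
          exact ENNReal.one_le_rpow (by norm_num) hp0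
  rw [h2, ENNReal.ofReal_mul (by positivity), Real.rpow_neg hpos.le,
    ENNReal.ofReal_inv_of_pos (Real.rpow_pos_of_pos hpos _), ← ENNReal.ofReal_rpow_of_pos hpos,
    ofReal_norm, mul_right_comm]
  gcongr

end GagliardoBound

/-! ### Regular functions in the Besov space -/

section SmoothBesov

variable {N : ℕ} {s : ℝ} {p : ℝ≥0}

theorem gradient_coord (u : E N → ℝ) (x : E N) (i : Fin N) :
    gradient u x i = dirDeriv (stdVec i) u x := by
  have h : inner ℝ (gradient u x) (stdVec i) = fderiv ℝ u x (stdVec i) := by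
    rw [gradient, InnerProductSpace.toDual_symm_apply]
  rw [dirDeriv, ← h, stdVec, EuclideanSpace.inner_single_right]
  simp

theorem norm_gradient (u : E N → ℝ) (x : E N) : ‖gradient u x‖ = ‖fderiv ℝ u x‖ := by
  rw [gradient, LinearIsometryEquiv.norm_map]

theorem norm_gradient_sub (u : E N → ℝ) (x y : E N) :
    ‖gradient u x - gradient u y‖ = ‖fderiv ℝ u x - fderiv ℝ u y‖ := by
  rw [gradient, gradient, ← map_sub, LinearIsometryEquiv.norm_map]

theorem continuous_gradient {u : E N → ℝ} (hu : ContDiff ℝ 1 u) : Continuous (gradient u) :=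
  (LinearIsometryEquiv.continuous _).comp (hu.continuous_fderiv (by norm_num))

theorem hasWeakGradient_gradient {u : E N → ℝ} (hu : ContDiff ℝ 1 u) :
    HasWeakGradient u (gradient u) := by
  intro φ i
  have h := integral_mul_dirDeriv (φ.contDiff.of_le (by simp)) hu φ.hasCompactSupport (stdVec i)
  simp only [gradient_coord]
  rw [← neg_inj, neg_neg, ← integral_congr_ae (Filter.Eventually.of_forall fun x =>
    mul_comm (φ x) (dirDeriv (stdVec i) u x)), h]
  congr 1
  exact integral_congr_ae (Filter.Eventually.of_forall fun x => mul_comm _ _)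

theorem gagliardo_gradient {σ : ℝ} (u : E N → ℝ) :
    gagliardo σ p (gradient u) = (∫⁻ z : E N × E N,
      ‖fderiv ℝ u z.1 - fderiv ℝ u z.2‖ₑ ^ (p : ℝ) /
        ‖z.1 - z.2‖ₑ ^ ((N : ℝ) + σ * (p : ℝ))) ^ (1 / (p : ℝ)) := by
  simp only [gagliardo, ← ofReal_norm, norm_gradient_sub]

variable [hp1 : Fact (1 ≤ p)]

theorem Besov.exists_of_hasWeakGradient {f : E N → ℝ} {G : E N → E N} (hf : MemLp f p volume)
    (hG : MemLp G p volume) (h : HasWeakGradient f G) (hg : gagliardo (s - 1) p G < ∞) :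
    ∃ w : Besov N s p, (Besov.toLp w : E N → ℝ) =ᵐ[volume] f ∧
      (Besov.grad w : E N → E N) =ᵐ[volume] G := by
  have h' : HasWeakGradient (hf.toLp f) (hG.toLp G) :=
    h.congr hf.coeFn_toLp.symm hG.coeFn_toLp.symm
  let w : Besov N s p := ⟨hf.toLp f, hG.toLp G, h', by rwa [gagliardo_congr hG.coeFn_toLp]⟩
  refine ⟨w, hf.coeFn_toLp, ?_⟩
  rw [Besov.grad_eq_of_hasWeakGradient w (hG.toLp G) h']
  exact hG.coeFn_toLp

/-- Allows the norm to be computed from any representatives of the function and its weak gradient,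
as a sum of extended nonnegative numbers. -/
theorem Besov.enorm_eq {w : Besov N s p} {f : E N → ℝ} {G : E N → E N}
    (hf : (Besov.toLp w : E N → ℝ) =ᵐ[volume] f) (hG : (Besov.grad w : E N → E N) =ᵐ[volume] G) :
    ‖w‖ₑ = eLpNorm f p volume + eLpNorm G p volume + gagliardo (s - 1) p G := by
  rw [← ofReal_norm, Besov.norm_def, ENNReal.ofReal_add (by positivity) ENNReal.toReal_nonneg,
    ENNReal.ofReal_add (norm_nonneg _) (norm_nonneg _),
    ENNReal.ofReal_toReal (Besov.gagliardo_grad_lt_top w).ne, gagliardo_congr hG, ofReal_norm,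
    ofReal_norm, Lp.enorm_def, Lp.enorm_def, eLpNorm_congr_ae hf, eLpNorm_congr_ae hG]

theorem eLpNorm_eq_lintegral_rpow {X F : Type*} [MeasurableSpace X] [NormedAddCommGroup F]
    (μ : Measure X) (f : X → F) :
    eLpNorm f p μ = (∫⁻ x, ‖f x‖ₑ ^ (p : ℝ) ∂μ) ^ (1 / (p : ℝ)) := by
  have hp : (0 : ℝ≥0∞) < p := lt_of_lt_of_le one_pos (by exact_mod_cast hp1.out)
  rw [eLpNorm_eq_lintegral_rpow_enorm_toReal hp.ne' ENNReal.coe_ne_top, ENNReal.coe_toReal]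

/-- The `p`-th power of a `W^{2,p}` norm. -/
def sobolevInt (p : ℝ) (v : E N → ℝ) : ℝ≥0∞ :=
  (∫⁻ x, ‖v x‖ₑ ^ p) + (∫⁻ x, ‖fderiv ℝ v x‖ₑ ^ p) + ∫⁻ x, ‖fderiv ℝ (fderiv ℝ v) x‖ₑ ^ p

/-- `C^2` functions with finite `W^{2,p}` norm belong to `B(s, p)`. -/
theorem Besov.exists_of_sobolevInt (hN : 1 ≤ N) (hs : 1 < s) (hs' : s < 2) :
    ∃ C : ℝ≥0∞, C ≠ ∞ ∧ ∀ v : E N → ℝ, ContDiff ℝ 2 v → sobolevInt p v < ∞ →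
      ∃ w : Besov N s p, (Besov.toLp w : E N → ℝ) =ᵐ[volume] v ∧
        (Besov.grad w : E N → E N) =ᵐ[volume] gradient v ∧
        ‖w‖ₑ ≤ C * sobolevInt p v ^ (1 / (p : ℝ)) := by
  have hp : (1 : ℝ) ≤ p := by exact_mod_cast hp1.out
  have hp0 : (0 : ℝ) ≤ 1 / p := by positivity
  obtain ⟨C, hC, h⟩ := exists_lintegral_gagliardo_le hN (p := p) (σ := s - 1) hp (by linarith)
    (by linarith) (E N →L[ℝ] ℝ)
  refine ⟨1 + 1 + C ^ (1 / (p : ℝ)), ENNReal.add_ne_top.2 ⟨by norm_num,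
    ENNReal.rpow_ne_top_of_nonneg hp0 hC⟩, fun v hv hfin => ?_⟩
  have hv1 : ContDiff ℝ 1 v := hv.of_le (by norm_num)
  have hd1 : ContDiff ℝ 1 (fderiv ℝ v) := hv.fderiv_right (by norm_num)
  have e1 : eLpNorm v p volume ≤ sobolevInt p v ^ (1 / (p : ℝ)) := by
    rw [eLpNorm_eq_lintegral_rpow]
    gcongr
    exact le_self_add.trans le_self_add
  have e2 : eLpNorm (gradient v) p volume ≤ sobolevInt p v ^ (1 / (p : ℝ)) := by
    rw [eLpNorm_eq_lintegral_rpow]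
    simp only [← ofReal_norm, norm_gradient]
    gcongr
    simp only [ofReal_norm]
    exact le_add_self.trans le_self_add
  have e3 : gagliardo (s - 1) p (gradient v) ≤
      C ^ (1 / (p : ℝ)) * sobolevInt p v ^ (1 / (p : ℝ)) := by
    rw [gagliardo_gradient, ← ENNReal.mul_rpow_of_nonneg _ _ hp0]
    gcongr
    refine (h _ hd1).trans ?_
    gcongr
    rw [sobolevInt, add_assoc]
    exact le_add_self
  have hfin' : sobolevInt p v ^ (1 / (p : ℝ)) < ∞ := ENNReal.rpow_lt_top_of_nonneg hp0 hfin.ne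
  obtain ⟨w, hw1, hw2⟩ := Besov.exists_of_hasWeakGradient (s := s) (p := p)
    ⟨hv.continuous.aestronglyMeasurable, e1.trans_lt hfin'⟩
    ⟨(continuous_gradient hv1).aestronglyMeasurable, e2.trans_lt hfin'⟩
    (hasWeakGradient_gradient hv1)
    (e3.trans_lt (ENNReal.mul_lt_top (ENNReal.rpow_lt_top_of_nonneg hp0 hC) hfin'))
  refine ⟨w, hw1, hw2, ?_⟩
  rw [Besov.enorm_eq hw1 hw2, add_mul, add_mul, one_mul]
  gcongr

theorem lintegral_rpow_lt_top_of_hasCompactSupport {F : Type*} [NormedAddCommGroup F]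
    {f : E N → F} (hf : Continuous f) (hc : HasCompactSupport f) {q : ℝ} (hq : 1 ≤ q) :
    ∫⁻ x, ‖f x‖ₑ ^ q < ∞ := by
  have h : MemLp f (ENNReal.ofReal q) volume := hf.memLp_of_hasCompactSupport hc
  have := lintegral_rpow_enorm_lt_top_of_eLpNorm_lt_top (by simp; linarith) (by simp) h.2
  rwa [ENNReal.toReal_ofReal (by linarith)] at this

theorem sobolevInt_lt_top_of_hasCompactSupport {v : E N → ℝ} (hv : ContDiff ℝ 2 v)
    (hc : HasCompactSupport v) {q : ℝ} (hq : 1 ≤ q) : sobolevInt q v < ∞ := by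
  have hd1 : ContDiff ℝ 1 (fderiv ℝ v) := hv.fderiv_right (by norm_num)
  refine ENNReal.add_lt_top.2 ⟨ENNReal.add_lt_top.2 ⟨?_, ?_⟩, ?_⟩
  · exact lintegral_rpow_lt_top_of_hasCompactSupport hv.continuous hc hq
  · exact lintegral_rpow_lt_top_of_hasCompactSupport hd1.continuous (hc.fderiv ℝ) hq
  · exact lintegral_rpow_lt_top_of_hasCompactSupport (hd1.continuous_fderiv (by norm_num))
      ((hc.fderiv ℝ).fderiv ℝ) hq

end SmoothBesov

/-! ### Mollification -/

section Mollify

open scoped ContDiff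

variable {N : ℕ} {F : Type*} [NormedAddCommGroup F] [NormedSpace ℝ F]

/-- The mollification `ρ ⋆ f` by a normalized bump function. -/
def mollify (b : ContDiffBump (0 : E N)) (f : E N → F) : E N → F :=
  convolution (b.normed volume) f (ContinuousLinearMap.lsmul ℝ ℝ) volume

theorem mollify_apply (b : ContDiffBump (0 : E N)) (f : E N → F) (x : E N) :
    mollify b f x = ∫ z, b.normed volume z • f (x - z) := rfl

/-- The probability measure with density a normalized bump function. -/
def bumpMeasure (b : ContDiffBump (0 : E N)) : Measure (E N) :=
  volume.withDensity fun z => ‖b.normed volume z‖ₑ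

theorem bumpMeasure_univ (b : ContDiffBump (0 : E N)) : bumpMeasure b Set.univ = 1 := by
  rw [bumpMeasure, withDensity_apply _ MeasurableSet.univ, Measure.restrict_univ]
  simp only [← ofReal_norm, Real.norm_of_nonneg (b.nonneg_normed _)]
  rw [← ofReal_integral_eq_lintegral_ofReal b.integrable_normed
    (Filter.Eventually.of_forall fun z => b.nonneg_normed z), b.integral_normed]
  simp

instance (b : ContDiffBump (0 : E N)) : IsProbabilityMeasure (bumpMeasure b) :=
  ⟨bumpMeasure_univ b⟩

theorem lintegral_bumpMeasure (b : ContDiffBump (0 : E N)) {g : E N → ℝ≥0∞} (hg : Measurable g) :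
    ∫⁻ z, g z ∂(bumpMeasure b) = ∫⁻ z, ‖b.normed volume z‖ₑ * g z := by
  rw [bumpMeasure, lintegral_withDensity_eq_lintegral_mul _
    b.continuous_normed.enorm.measurable hg]
  rfl

theorem bumpMeasure_ae_norm_lt (b : ContDiffBump (0 : E N)) :
    ∀ᵐ z ∂(bumpMeasure b), ‖z‖ < b.rOut := by
  rw [bumpMeasure, ae_withDensity_iff b.continuous_normed.enorm.measurable]
  refine Filter.Eventually.of_forall fun z hz => ?_
  have : z ∈ Function.support (b.normed volume) := by
    intro h; simp [h] at hz
  rw [b.support_normed_eq] at this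
  simpa using this

theorem enorm_integral_bump_smul_le (b : ContDiffBump (0 : E N)) {g : E N → F}
    (hg : Measurable fun z => ‖g z‖ₑ) :
    ‖∫ z, b.normed volume z • g z‖ₑ ≤ ∫⁻ z, ‖g z‖ₑ ∂(bumpMeasure b) := by
  rw [lintegral_bumpMeasure b hg]
  refine (enorm_integral_le_lintegral_enorm _).trans (le_of_eq ?_)
  simp only [enorm_smul]

variable {f : E N → F}

theorem integrable_bump_smul (b : ContDiffBump (0 : E N)) (hf : LocallyIntegrable f) (x : E N) :
    Integrable fun z => b.normed volume z • f (x - z) :=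
  b.hasCompactSupport_normed.convolutionExists_left (ContinuousLinearMap.lsmul ℝ ℝ)
    b.continuous_normed hf x

theorem contDiff_mollify (b : ContDiffBump (0 : E N)) (hf : LocallyIntegrable f) :
    ContDiff ℝ ∞ (mollify b f) :=
  b.hasCompactSupport_normed.contDiff_convolution_left (ContinuousLinearMap.lsmul ℝ ℝ)
    b.contDiff_normed hf

theorem mollify_sub_self [CompleteSpace F] (b : ContDiffBump (0 : E N)) (hf : LocallyIntegrable f)
    (x : E N) :
    mollify b f x - f x = ∫ z, b.normed volume z • (f (x - z) - f x) := by
  simp only [smul_sub]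
  rw [integral_sub (integrable_bump_smul b hf x) (b.integrable_normed.smul_const _),
    b.integral_normed_smul, mollify_apply]

/-- **Young's inequality** for a continuous kernel with compact support. -/
theorem lintegral_rpow_convolution_lt_top {F₁ F₂ : Type*} [NormedAddCommGroup F₁]
    [NormedSpace ℝ F₁] [NormedAddCommGroup F₂] [NormedSpace ℝ F₂] {k : E N → F₁}
    (hk : Continuous k) (hkc : HasCompactSupport k) (L : F₁ →L[ℝ] F →L[ℝ] F₂)
    (hf : Measurable fun x => ‖f x‖ₑ) {p : ℝ} (hp : 1 ≤ p) (hfin : ∫⁻ x, ‖f x‖ₑ ^ p < ⊤) :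
    ∫⁻ x, ‖convolution k f L volume x‖ₑ ^ p < ⊤ := by
  set c : E N → ℝ≥0∞ := fun z => ‖L‖ₑ * ‖k z‖ₑ with hc
  have hcm : Measurable c := measurable_const.mul hk.enorm.measurable
  set ν : Measure (E N) := volume.withDensity c with hν
  have hνfin : ν Set.univ < ⊤ := by
    rw [hν, withDensity_apply _ MeasurableSet.univ, Measure.restrict_univ,
      lintegral_const_mul' _ _ enorm_ne_top]
    exact ENNReal.mul_lt_top enorm_lt_top
      (hk.integrable_of_hasCompactSupport hkc).hasFiniteIntegral
  have : IsFiniteMeasure ν := ⟨hνfin⟩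
  have hm : Measurable fun q : E N × E N => ‖f (q.1 - q.2)‖ₑ :=
    hf.comp (measurable_fst.sub measurable_snd)
  have key : ∀ x, ‖convolution k f L volume x‖ₑ ≤ ∫⁻ z, ‖f (x - z)‖ₑ ∂ν := by
    intro x
    rw [hν, lintegral_withDensity_eq_lintegral_mul (μ := volume) hcm
      (g := fun z => ‖f (x - z)‖ₑ) (hm.comp measurable_prodMk_left)]
    refine (enorm_integral_le_lintegral_enorm _).trans (lintegral_mono fun z => ?_)
    calc ‖L (k z) (f (x - z))‖ₑ ≤ ‖L (k z)‖ₑ * ‖f (x - z)‖ₑ := ContinuousLinearMap.le_opENorm _ _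
      _ ≤ ‖L‖ₑ * ‖k z‖ₑ * ‖f (x - z)‖ₑ := by
        gcongr; exact ContinuousLinearMap.le_opENorm _ _
  calc ∫⁻ x, ‖convolution k f L volume x‖ₑ ^ p ≤ ∫⁻ x, (∫⁻ z, ‖f (x - z)‖ₑ ∂ν) ^ p := by
        gcongr with x; exact key x
    _ ≤ ν Set.univ ^ (p - 1) * ∫⁻ z, ∫⁻ x, ‖f (x - z)‖ₑ ^ p ∂volume ∂ν :=
        lintegral_rpow_lintegral_le volume ν hp hm
    _ = ν Set.univ ^ (p - 1) * ((∫⁻ x, ‖f x‖ₑ ^ p) * ν Set.univ) := by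
        simp only [fun z => lintegral_sub_right_eq_self (μ := (volume : Measure (E N)))
          (fun x => ‖f x‖ₑ ^ p) z, lintegral_const]
    _ < ⊤ := ENNReal.mul_lt_top (ENNReal.rpow_lt_top_of_nonneg (by linarith) hνfin.ne)
        (ENNReal.mul_lt_top hfin hνfin)

theorem lintegral_rpow_fderiv_convolution_lt_top {F₁ F₂ : Type*} [NormedAddCommGroup F₁]
    [NormedSpace ℝ F₁] [NormedAddCommGroup F₂] [NormedSpace ℝ F₂] {k : E N → F₁}
    (hk : ContDiff ℝ 1 k) (hkc : HasCompactSupport k) (L : F₁ →L[ℝ] F →L[ℝ] F₂)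
    (hf : LocallyIntegrable f) (hfm : Measurable fun x => ‖f x‖ₑ) {p : ℝ} (hp : 1 ≤ p)
    (hfin : ∫⁻ x, ‖f x‖ₑ ^ p < ⊤) :
    ∫⁻ x, ‖fderiv ℝ (convolution k f L volume) x‖ₑ ^ p < ⊤ := by
  simp only [fun x => (hkc.hasFDerivAt_convolution_left L hk hf x).fderiv]
  exact lintegral_rpow_convolution_lt_top (hk.continuous_fderiv (by norm_num)) (hkc.fderiv ℝ) _
    hfm hp hfin

/-- All derivatives up to order two fall on the bump function, so `f` in `L^p` suffices, by Young's
inequality. -/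
theorem sobolevInt_mollify_lt_top (b : ContDiffBump (0 : E N)) {f : E N → ℝ}
    (hf : LocallyIntegrable f) (hfm : Measurable f) {p : ℝ} (hp : 1 ≤ p)
    (hfin : ∫⁻ x, ‖f x‖ₑ ^ p < ⊤) : sobolevInt p (mollify b f) < ⊤ := by
  have hρ : ContDiff ℝ ∞ (b.normed volume) := b.contDiff_normed
  have hρ1 : ContDiff ℝ ∞ (fderiv ℝ (b.normed volume)) := hρ.fderiv_right (by simp)
  have hc : HasCompactSupport (b.normed volume) := b.hasCompactSupport_normed
  set L₁ : (E N →L[ℝ] ℝ) →L[ℝ] ℝ →L[ℝ] (E N →L[ℝ] ℝ) :=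
    ContinuousLinearMap.precompL (E N) (ContinuousLinearMap.lsmul ℝ ℝ : ℝ →L[ℝ] ℝ →L[ℝ] ℝ)
  have h1 : fderiv ℝ (mollify b f) = convolution (fderiv ℝ (b.normed volume)) f L₁ volume := by
    ext1 x
    exact (hc.hasFDerivAt_convolution_left _ (hρ.of_le (by simp)) hf x).fderiv
  rw [sobolevInt, h1]
  refine ENNReal.add_lt_top.2 ⟨ENNReal.add_lt_top.2 ⟨?_, ?_⟩, ?_⟩
  · exact lintegral_rpow_convolution_lt_top hρ.continuous hc _ hfm.enorm hp hfin
  · exact lintegral_rpow_convolution_lt_top hρ1.continuous (hc.fderiv ℝ) _ hfm.enorm hp hfin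
  · exact lintegral_rpow_fderiv_convolution_lt_top (hρ1.of_le (by simp)) (hc.fderiv ℝ) _ hf
      hfm.enorm hp hfin

/-- Mollification commutes with the weak gradient. -/
theorem gradient_mollify (b : ContDiffBump (0 : E N)) {f : E N → ℝ} {G : E N → E N}
    (hf : LocallyIntegrable f) (hG : LocallyIntegrable G) (h : HasWeakGradient f G) :
    gradient (mollify b f) = mollify b G := by
  have hρ : ContDiff ℝ ∞ (b.normed volume) := b.contDiff_normed
  have hc : HasCompactSupport (b.normed volume) := b.hasCompactSupport_normed
  ext x i
  have hd := (hc.hasFDerivAt_convolution_left (ContinuousLinearMap.lsmul ℝ ℝ)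
    (hρ.of_le (by simp)) hf x).fderiv
  have hintegrable := (hc.fderiv ℝ).convolutionExists_left
    ((ContinuousLinearMap.lsmul ℝ ℝ).precompL (E N)) (hρ.continuous_fderiv (by simp)) hf x
  have e1 : gradient (mollify b f) x i =
      ∫ z, fderiv ℝ (b.normed volume) z (stdVec i) * f (x - z) := by
    rw [gradient_coord, dirDeriv, mollify, hd, convolution,
      ContinuousLinearMap.integral_apply hintegrable]
    rfl
  -- The reflected bump function centred at `x` serves as the test function in the definition of the
  -- weak gradient.
  let φ : 𝓓((⊤ : Opens (E N)), ℝ) := ⟨fun y => b.normed volume (x - y),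
    hρ.comp (contDiff_const.sub contDiff_id), hc.comp_homeomorph (Homeomorph.subLeft x), by simp⟩
  have hφd : ∀ y, fderiv ℝ φ y (stdVec i) = -fderiv ℝ (b.normed volume) (x - y) (stdVec i) := by
    intro y
    have h1 : HasFDerivAt (fun y : E N => x - y) (-ContinuousLinearMap.id ℝ (E N)) y := by
      simpa using (hasFDerivAt_id y).const_sub x
    have h2 : HasFDerivAt (fun y : E N => b.normed volume (x - y))
        ((fderiv ℝ (b.normed volume) (x - y)).comp (-ContinuousLinearMap.id ℝ (E N))) y :=
      HasFDerivAt.comp y (g := b.normed volume)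
        (hρ.differentiable (by simp) _).hasFDerivAt h1
    change fderiv ℝ (fun y : E N => b.normed volume (x - y)) y (stdVec i) = _
    rw [h2.fderiv]
    simp
  have hw := h φ i
  simp only [hφd] at hw
  rw [e1, ← integral_sub_left_eq_self _ volume x]
  simp only [sub_sub_cancel]
  have e2 : mollify b G x i = ∫ y, G y i * φ y := by
    have := ((EuclideanSpace.proj (𝕜 := ℝ) i).integral_comp_comm
      (integrable_bump_smul b hG x)).symm
    rw [mollify_apply]
    refine Eq.trans this ?_
    rw [← integral_sub_left_eq_self _ volume x]
    refine integral_congr_ae (Filter.Eventually.of_forall fun y => ?_)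
    simp only [sub_sub_cancel]
    change b.normed volume (x - y) * G y i = G y i * b.normed volume (x - y)
    ring
  rw [e2, ← neg_inj, ← hw, ← integral_neg]
  refine integral_congr_ae (Filter.Eventually.of_forall fun y => ?_)
  simp only
  ring

end Mollify

/-! ### Convergence of mollifications in the Besov norm -/

section MollifyBesov

variable {N : ℕ} {s : ℝ} {p : ℝ≥0} [hp1 : Fact (1 ≤ p)]

/-- An average of small translation differences is small in `L^p`. -/
theorem eLpNorm_le_of_enorm_le_average {X F F' : Type*} [NormedAddCommGroup X]
    [MeasurableSpace X] [BorelSpace X] [SecondCountableTopology X] [NormedAddCommGroup F]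
    [NormedAddCommGroup F'] (μ : Measure X) [SFinite μ] (b : ContDiffBump (0 : E N)) {f : X → F}
    (hf : StronglyMeasurable f) {ι : E N → X} (hι : Measurable ι) {H : X → F'}
    (hH : ∀ x, ‖H x‖ₑ ≤ ∫⁻ z, ‖f (x - ι z) - f x‖ₑ ∂(bumpMeasure b)) {ε : ℝ≥0∞}
    (hε : ∀ z, ‖z‖ < b.rOut → eLpNorm (fun x => f (x - ι z) - f x) p μ ≤ ε) :
    eLpNorm H p μ ≤ ε := by
  have hp : (1 : ℝ) ≤ p := by exact_mod_cast hp1.out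
  have hp0 : (0 : ℝ) < p := by linarith
  have hm : Measurable fun q : X × E N => ‖f (q.1 - ι q.2) - f q.1‖ₑ :=
    ((hf.comp_measurable (measurable_fst.sub (hι.comp measurable_snd))).sub
      (hf.comp_measurable measurable_fst)).enorm
  have h1 : ∫⁻ x, ‖H x‖ₑ ^ (p : ℝ) ∂μ ≤ ε ^ (p : ℝ) := by
    calc ∫⁻ x, ‖H x‖ₑ ^ (p : ℝ) ∂μ
        ≤ ∫⁻ x, (∫⁻ z, ‖f (x - ι z) - f x‖ₑ ∂(bumpMeasure b)) ^ (p : ℝ) ∂μ := by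
          gcongr with x; exact hH x
      _ ≤ _ := lintegral_rpow_lintegral_le μ (bumpMeasure b) hp hm
      _ = ∫⁻ z, ∫⁻ x, ‖f (x - ι z) - f x‖ₑ ^ (p : ℝ) ∂μ ∂(bumpMeasure b) := by
          rw [bumpMeasure_univ, ENNReal.one_rpow, one_mul]
      _ ≤ ∫⁻ _z, ε ^ (p : ℝ) ∂(bumpMeasure b) := by
          refine lintegral_mono_ae ((bumpMeasure_ae_norm_lt b).mono fun z hz => ?_)
          have := hε z hz
          rw [eLpNorm_eq_lintegral_rpow] at this
          have h2 := ENNReal.rpow_le_rpow this hp0.le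
          rwa [← ENNReal.rpow_mul, one_div_mul_cancel hp0.ne', ENNReal.rpow_one] at h2
      _ = _ := by rw [lintegral_const, bumpMeasure_univ, mul_one]
  rw [eLpNorm_eq_lintegral_rpow]
  have h2 := ENNReal.rpow_le_rpow h1 (show (0 : ℝ) ≤ 1 / p by positivity)
  rwa [← ENNReal.rpow_mul, mul_one_div_cancel hp0.ne', ENNReal.rpow_one] at h2

/-- The difference quotient `(G(x) - G(y)) / |x - y|^a`. -/
def diffQuot (a : ℝ) (G : E N → E N) (q : E N × E N) : E N :=
  ‖q.1 - q.2‖ ^ (-a) • (G q.1 - G q.2)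

/-- Turns the seminorm into an `L^p` norm on the product space, where translations are continuous.
On the diagonal the numerator vanishes on both sides. -/
theorem gagliardo_eq_eLpNorm_diffQuot (σ : ℝ) (G : E N → E N) :
    gagliardo σ p G = eLpNorm (diffQuot ((N + σ * p) / p) G) p volume := by
  have hp : (1 : ℝ) ≤ p := by exact_mod_cast hp1.out
  have hp0 : (0 : ℝ) < p := by linarith
  rw [eLpNorm_eq_lintegral_rpow, gagliardo]
  congr 1
  refine lintegral_congr fun q => ?_
  rw [diffQuot, enorm_smul, ENNReal.mul_rpow_of_nonneg _ _ hp0.le]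
  by_cases hq : q.1 = q.2
  · simp [hq, hp0]
  · have hpos : 0 < ‖q.1 - q.2‖ := norm_pos_iff.2 (sub_ne_zero.2 hq)
    rw [div_eq_mul_inv, mul_comm]
    congr 1
    rw [Real.enorm_eq_ofReal (by positivity), Real.rpow_neg hpos.le,
      ENNReal.ofReal_inv_of_pos (Real.rpow_pos_of_pos hpos _), ← ENNReal.ofReal_rpow_of_pos hpos,
      ofReal_norm, ← ENNReal.rpow_neg, ← ENNReal.rpow_neg, ← ENNReal.rpow_mul]
    congr 1
    field_simp

theorem stronglyMeasurable_diffQuot (a : ℝ) {G : E N → E N} (hG : StronglyMeasurable G) :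
    StronglyMeasurable (diffQuot a G) := by
  refine StronglyMeasurable.smul (f := fun q : E N × E N => ‖q.1 - q.2‖ ^ (-a)) ?_ ?_
  · exact ((measurable_fst.sub measurable_snd).norm.pow_const _).stronglyMeasurable
  · exact (hG.comp_measurable measurable_fst).sub (hG.comp_measurable measurable_snd)

/-- A diagonal translation by `(z, z)` leaves `x - y` unchanged, so averaging over `z` commutes with
the weight `|x - y|^(-a)`. -/
theorem diffQuot_mollify_sub_self_le (a : ℝ) (b : ContDiffBump (0 : E N)) {G : E N → E N}
    (hGm : StronglyMeasurable G) (hG : LocallyIntegrable G) (q : E N × E N) :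
    ‖diffQuot a (mollify b G - G) q‖ₑ ≤
      ∫⁻ z, ‖diffQuot a G (q - (z, z)) - diffQuot a G q‖ₑ ∂(bumpMeasure b) := by
  have hintegrable : ∀ x, Integrable fun z => b.normed volume z • (G (x - z) - G x) := by
    intro x
    simp only [smul_sub]
    exact (integrable_bump_smul b hG x).sub (b.integrable_normed.smul_const _)
  have h1 : diffQuot a (mollify b G - G) q = ∫ z, b.normed volume z •
      (diffQuot a G (q - (z, z)) - diffQuot a G q) := by
    rw [diffQuot, Pi.sub_apply, Pi.sub_apply, mollify_sub_self b hG, mollify_sub_self b hG,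
      ← integral_sub (hintegrable _) (hintegrable _), ← integral_smul]
    refine integral_congr_ae (Filter.Eventually.of_forall fun z => ?_)
    simp only [diffQuot, Prod.fst_sub, Prod.snd_sub, sub_sub_sub_cancel_right]
    module
  rw [h1]
  refine enorm_integral_bump_smul_le b ?_
  have hV := stronglyMeasurable_diffQuot a hGm
  exact ((hV.comp_measurable (measurable_const.sub (measurable_id.prodMk measurable_id))).sub
    stronglyMeasurable_const).enorm

theorem Besov.grad_sub (u v : Besov N s p) : grad (u - v) = grad u - grad v := by
  rw [sub_eq_add_neg, ← neg_one_smul ℝ v, Besov.grad_add, Besov.grad_smul, neg_one_smul,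
    ← sub_eq_add_neg]

/-- Mollifications converge in `B(s, p)`. -/
theorem Besov.exists_mollify_close (hN : 1 ≤ N) (hs : 1 < s) (hs' : s < 2) (w : Besov N s p)
    {ε : ℝ} (hε : 0 < ε) :
    ∃ δ > 0, ∀ b : ContDiffBump (0 : E N), b.rOut < δ → ∃ w' : Besov N s p,
      (Besov.toLp w' : E N → ℝ) =ᵐ[volume] mollify b (⇑(Besov.toLp w)) ∧ ‖w' - w‖ ≤ ε := by
  have hp : (1 : ℝ) ≤ p := by exact_mod_cast hp1.out
  have hpe : (1 : ℝ≥0∞) ≤ p := by exact_mod_cast hp1.out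
  set f : E N → ℝ := ⇑(Besov.toLp w) with hf
  set G : E N → E N := ⇑(Besov.grad w) with hG
  have hfL : MemLp f p volume := Lp.memLp _
  have hGL : MemLp G p volume := Lp.memLp _
  have hfm : StronglyMeasurable f := Lp.stronglyMeasurable _
  have hGm : StronglyMeasurable G := Lp.stronglyMeasurable _
  have hfl : LocallyIntegrable f := hfL.locallyIntegrable hpe
  have hGl : LocallyIntegrable G := hGL.locallyIntegrable hpe
  set a : ℝ := (N + (s - 1) * p) / p with ha
  have hVL : MemLp (diffQuot a G) p volume :=
    ⟨(stronglyMeasurable_diffQuot a hGm).aestronglyMeasurable, by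
      rw [← gagliardo_eq_eLpNorm_diffQuot]; exact Besov.gagliardo_grad_lt_top w⟩
  have hε3 : 0 < ε / 3 := by positivity
  obtain ⟨δ₁, hδ₁, h₁⟩ := exists_forall_eLpNorm_translate_sub_le volume ENNReal.coe_ne_top hfL hε3
  obtain ⟨δ₂, hδ₂, h₂⟩ := exists_forall_eLpNorm_translate_sub_le volume ENNReal.coe_ne_top hGL hε3
  have : (volume : Measure (E N × E N)).IsAddRightInvariant :=
    inferInstanceAs ((volume : Measure (E N)).prod (volume : Measure (E N))).IsAddRightInvariant
  obtain ⟨δ₃, hδ₃, h₃⟩ := exists_forall_eLpNorm_translate_sub_le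
    (volume : Measure (E N × E N)) ENNReal.coe_ne_top hVL hε3
  refine ⟨min δ₁ (min δ₂ δ₃), by positivity, fun b hb => ?_⟩
  have hb₁ := hb.trans_le (min_le_left _ _)
  have hb₂ := hb.trans_le ((min_le_right _ _).trans (min_le_left _ _))
  have hb₃ := hb.trans_le ((min_le_right _ _).trans (min_le_right _ _))
  have hfin : ∫⁻ x, ‖f x‖ₑ ^ (p : ℝ) < ∞ := by
    have := lintegral_rpow_enorm_lt_top_of_eLpNorm_lt_top
      (zero_lt_one.trans_le hpe).ne' ENNReal.coe_ne_top hfL.2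
    simpa using this
  obtain ⟨C, -, hC⟩ := Besov.exists_of_sobolevInt (p := p) hN hs hs'
  obtain ⟨w', hw1, hw2, -⟩ := hC (mollify b f) ((contDiff_mollify b hfl).of_le
    (WithTop.coe_le_coe.2 (le_top : (2 : ℕ∞) ≤ ⊤)))
    (sobolevInt_mollify_lt_top b hfl hfm.measurable hp hfin)
  rw [gradient_mollify b hfl hGl (Besov.hasWeakGradient_grad w)] at hw2
  refine ⟨w', hw1, ?_⟩
  have d1 : (Besov.toLp (w' - w) : E N → ℝ) =ᵐ[volume] mollify b f - f := by
    rw [map_sub]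
    exact (Lp.coeFn_sub _ _).trans (hw1.sub (Filter.EventuallyEq.refl _ _))
  have d2 : (Besov.grad (w' - w) : E N → E N) =ᵐ[volume] mollify b G - G := by
    rw [Besov.grad_sub]
    exact (Lp.coeFn_sub _ _).trans (hw2.sub (Filter.EventuallyEq.refl _ _))
  have avg : ∀ {F : Type} [NormedAddCommGroup F] [NormedSpace ℝ F] [CompleteSpace F] {g : E N → F}
      (_ : StronglyMeasurable g) (_ : LocallyIntegrable g) (x : E N),
      ‖(mollify b g - g) x‖ₑ ≤ ∫⁻ z, ‖g (x - id z) - g x‖ₑ ∂(bumpMeasure b) := by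
    intro F _ _ _ g hgm hg x
    rw [Pi.sub_apply, mollify_sub_self b hg]
    refine enorm_integral_bump_smul_le b ?_
    exact ((hgm.comp_measurable (measurable_const.sub measurable_id)).sub
      stronglyMeasurable_const).enorm
  have n1 : eLpNorm (mollify b f - f) p volume ≤ ENNReal.ofReal (ε / 3) :=
    eLpNorm_le_of_enorm_le_average volume b hfm measurable_id (avg hfm hfl)
      fun z hz => h₁ z (hz.trans hb₁)
  have n2 : eLpNorm (mollify b G - G) p volume ≤ ENNReal.ofReal (ε / 3) :=
    eLpNorm_le_of_enorm_le_average volume b hGm measurable_id (avg hGm hGl)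
      fun z hz => h₂ z (hz.trans hb₂)
  have n3 : gagliardo (s - 1) p (mollify b G - G) ≤ ENNReal.ofReal (ε / 3) := by
    rw [gagliardo_eq_eLpNorm_diffQuot]
    -- The same averaging argument on the product space, with diagonal translations.
    refine eLpNorm_le_of_enorm_le_average volume b (stronglyMeasurable_diffQuot a hGm)
      (ι := fun z => (z, z)) (measurable_id.prodMk measurable_id)
      (diffQuot_mollify_sub_self_le a b hGm hGl) fun z hz => h₃ (z, z) ?_
    simpa [Prod.norm_def] using hz.trans hb₃
  have := Besov.enorm_eq d1 d2
  rw [← ENNReal.ofReal_le_ofReal_iff hε.le, ofReal_norm, this]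
  calc _ ≤ ENNReal.ofReal (ε / 3) + ENNReal.ofReal (ε / 3) + ENNReal.ofReal (ε / 3) := by gcongr
    _ = ENNReal.ofReal ε := by
      rw [← ENNReal.ofReal_add hε3.le hε3.le, ← ENNReal.ofReal_add (by positivity) hε3.le]
      congr 1; ring

end MollifyBesov

/-! ### Cutoff at infinity and density of smooth functions -/

section Cutoff

open scoped ContDiff

variable {N : ℕ}

theorem norm_fderiv_fderiv (v : E N → ℝ) (x : E N) :
    ‖fderiv ℝ (fderiv ℝ v) x‖ = ‖iteratedFDeriv ℝ 2 v x‖ := by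
  rw [← norm_iteratedFDeriv_one, norm_iteratedFDeriv_fderiv]

theorem ofReal_norm_bilin (B : E N →L[ℝ] E N →L[ℝ] ℝ) : ENNReal.ofReal ‖B‖ = ‖B‖ₑ :=
  ofReal_norm B

/-- The complement `x ↦ 1 - χ(x / R)` of a smooth cutoff function at scale `R`. -/
def farCutoff (N : ℕ) (R : ℝ) (x : E N) : ℝ :=
  1 - (⟨1, 2, one_pos, one_lt_two⟩ : ContDiffBump (0 : E N)) (R⁻¹ • x)

theorem contDiff_farCutoff (R : ℝ) : ContDiff ℝ ∞ (farCutoff N R) :=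
  contDiff_const.sub ((ContDiffBump.contDiff _).comp (contDiff_const_smul R⁻¹))

theorem farCutoff_eq_zero {R : ℝ} (hR : 0 < R) {x : E N} (hx : ‖x‖ ≤ R) :
    farCutoff N R x = 0 := by
  rw [farCutoff, ContDiffBump.one_of_mem_closedBall, sub_self]
  rw [mem_closedBall_zero_iff, norm_smul, norm_inv, Real.norm_of_nonneg hR.le,
    inv_mul_le_iff₀ hR, mul_one]
  exact hx

theorem farCutoff_eq_one {R : ℝ} (hR : 0 < R) {x : E N} (hx : 2 * R ≤ ‖x‖) :
    farCutoff N R x = 1 := by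
  rw [farCutoff, ContDiffBump.zero_of_le_dist, sub_zero]
  rw [dist_zero_right, norm_smul, norm_inv, Real.norm_of_nonneg hR.le]
  change 2 ≤ R⁻¹ * ‖x‖
  rwa [le_inv_mul_iff₀ hR, mul_comm]

/-- Each derivative of `χ(x / R)` brings a factor `1/R ≤ 1`, so the bounds for `χ` hold uniformly in
`R`; the constant function accounts for the added `1`. -/
theorem exists_norm_iteratedFDeriv_farCutoff_le (N : ℕ) :
    ∃ A : ℝ, 0 ≤ A ∧ ∀ R : ℝ, 1 ≤ R → ∀ i ≤ 2, ∀ x : E N,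
      ‖iteratedFDeriv ℝ i (farCutoff N R) x‖ ≤ A := by
  set χ : ContDiffBump (0 : E N) := ⟨1, 2, one_pos, one_lt_two⟩
  have hχ : ContDiff ℝ ∞ χ := χ.contDiff
  have h1 : ∀ i : ℕ, ∃ A : ℝ, ∀ x, ‖iteratedFDeriv ℝ i χ x‖ ≤ A := fun i =>
    (χ.hasCompactSupport.iteratedFDeriv i).exists_bound_of_continuous
      (hχ.continuous_iteratedFDeriv (by exact_mod_cast le_top))
  choose A hA using h1
  have hA0 : ∀ i, 0 ≤ A i := fun i => (norm_nonneg _).trans (hA i 0)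
  refine ⟨1 + (A 0 + A 1 + A 2), by linarith [hA0 0, hA0 1, hA0 2], fun R hR i hi x => ?_⟩
  have hAi : A i ≤ A 0 + A 1 + A 2 := by
    interval_cases i <;> linarith [hA0 0, hA0 1, hA0 2]
  have hf : farCutoff N R = (fun _ => (1 : ℝ)) -
      (χ ∘ (R⁻¹ • ContinuousLinearMap.id ℝ (E N))) := by
    ext y; simp [farCutoff, χ]
  have hχR : ContDiff ℝ ∞ (χ ∘ (R⁻¹ • ContinuousLinearMap.id ℝ (E N))) :=
    hχ.comp (ContinuousLinearMap.contDiff _)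
  have hi' : (i : WithTop ℕ∞) ≤ (⊤ : ℕ∞) := by exact_mod_cast le_top
  have hc : ‖iteratedFDeriv ℝ i (fun _ : E N => (1 : ℝ)) x‖ ≤ 1 := by
    rcases Nat.eq_zero_or_pos i with rfl | hi0
    · simp
    · rw [iteratedFDeriv_const_of_ne hi0.ne']; simp
  have hL : ‖R⁻¹ • ContinuousLinearMap.id ℝ (E N)‖ ≤ 1 := by
    rw [norm_smul, norm_inv, Real.norm_of_nonneg (by linarith)]
    exact mul_le_one₀ (inv_le_one_of_one_le₀ hR) (norm_nonneg _)
      ContinuousLinearMap.norm_id_le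
  rw [hf, iteratedFDeriv_sub_apply (contDiff_const.contDiffAt)
    (hχR.of_le hi').contDiffAt]
  refine (norm_sub_le _ _).trans (add_le_add hc ?_)
  rw [ContinuousLinearMap.iteratedFDeriv_comp_right _ hχ _ hi']
  refine (ContinuousMultilinearMap.norm_compContinuousLinearMap_le _ _).trans ?_
  calc _ ≤ A i * 1 := by
        refine mul_le_mul (hA i _) ?_ (by positivity) (hA0 i)
        simpa using pow_le_one₀ (norm_nonneg _) hL
    _ ≤ _ := by linarith

theorem rpow_add_add_le (a b c : ℝ≥0∞) {p : ℝ} (hp : 0 ≤ p) :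
    (a + b + c) ^ p ≤ 3 ^ p * (a ^ p + b ^ p + c ^ p) := by
  have key : ∀ m : ℝ≥0∞, a ≤ m → b ≤ m → c ≤ m → m ^ p ≤ a ^ p + b ^ p + c ^ p →
      (a + b + c) ^ p ≤ 3 ^ p * (a ^ p + b ^ p + c ^ p) := by
    intro m ha hb hc hm
    calc (a + b + c) ^ p ≤ (3 * m) ^ p := by
          gcongr
          calc a + b + c ≤ m + m + m := by gcongr
            _ = 3 * m := by ring
      _ = 3 ^ p * m ^ p := ENNReal.mul_rpow_of_nonneg _ _ hp
      _ ≤ _ := by gcongr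
  rcases le_total a b with hab | hab <;> rcases le_total b c with hbc | hbc <;>
    rcases le_total a c with hac | hac
  · exact key c hac hbc le_rfl le_add_self
  · exact key c (hab.trans hbc) hbc le_rfl le_add_self
  · exact key b hab le_rfl hbc (le_add_self.trans le_self_add)
  · exact key b hab le_rfl hbc (le_add_self.trans le_self_add)
  · exact key c hac hbc le_rfl le_add_self
  · exact key a le_rfl hab hac (le_self_add.trans le_self_add)
  · exact key a le_rfl hab (hbc.trans hab) (le_self_add.trans le_self_add)
  · exact key a le_rfl hab hac (le_self_add.trans le_self_add)

/-- The part of a function with finite `W^{2,p}` norm outside a large ball is small. -/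
theorem tendsto_sobolevInt_farCutoff_mul {v : E N → ℝ} (hv : ContDiff ℝ 2 v) {p : ℝ} (hp : 0 < p)
    (hfin : sobolevInt p v < ⊤) :
    Filter.Tendsto (fun n : ℕ => sobolevInt p fun x => farCutoff N (n + 1) x * v x) Filter.atTop
      (nhds 0) := by
  obtain ⟨A, hA0, hA⟩ := exists_norm_iteratedFDeriv_farCutoff_le N
  have hd1 : ContDiff ℝ 1 (fderiv ℝ v) := hv.fderiv_right (by norm_num)
  set J : E N → ℝ≥0∞ := fun x =>
    ‖v x‖ₑ ^ p + ‖fderiv ℝ v x‖ₑ ^ p + ‖fderiv ℝ (fderiv ℝ v) x‖ₑ ^ p with hJ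
  have m0 : Measurable fun x => ‖v x‖ₑ ^ p := hv.continuous.enorm.measurable.pow_const _
  have m1 : Measurable fun x => ‖fderiv ℝ v x‖ₑ ^ p := hd1.continuous.enorm.measurable.pow_const _
  have m2 : Measurable fun x => ‖fderiv ℝ (fderiv ℝ v) x‖ₑ ^ p := by
    simp only [← ofReal_norm_bilin, norm_fderiv_fderiv]
    exact (hv.continuous_iteratedFDeriv (m := 2) le_rfl).norm.measurable.ennreal_ofReal.pow_const _
  have hJm : Measurable J := (m0.add m1).add m2
  have hJi : ∫⁻ x, J x = sobolevInt p v := by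
    rw [sobolevInt, ← lintegral_add_left m0, ← lintegral_add_right _ m2]
  -- The `4 = 2^2` is the sum of the binomial coefficients in the Leibniz rule of order two; `3 ^ p`
  -- comes from the power of a sum of three terms.
  set K : ℝ≥0∞ := ENNReal.ofReal (4 * A) ^ p * 3 ^ p with hK
  have hKtop : K ≠ ⊤ := ENNReal.mul_ne_top
    (ENNReal.rpow_ne_top_of_nonneg hp.le ENNReal.ofReal_ne_top)
    (ENNReal.rpow_ne_top_of_nonneg hp.le (by norm_num))
  set S : ℕ → Set (E N) := fun n => {x | (n : ℝ) + 1 ≤ ‖x‖} with hS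
  have hSm : ∀ n, MeasurableSet (S n) := fun n => (isClosed_le continuous_const
    continuous_norm).measurableSet
  have hpt : ∀ (n k : ℕ), k ≤ 2 → ∀ x,
      ‖iteratedFDeriv ℝ k (fun x => farCutoff N (n + 1) x * v x) x‖ₑ ^ p ≤
        K * (S n).indicator J x := by
    intro n k hk x
    have hn : (1 : ℝ) ≤ n + 1 := by linarith [n.cast_nonneg (α := ℝ)]
    by_cases hx : x ∈ S n
    · rw [Set.indicator_of_mem hx]
      have hkv : (k : WithTop ℕ∞) ≤ 2 := by exact_mod_cast hk
      have l := norm_iteratedFDeriv_mul_le (n := k) (N := 2)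
        ((contDiff_farCutoff (N := N) (n + 1)).of_le
          (WithTop.coe_le_coe.2 (le_top : (2 : ℕ∞) ≤ ⊤))) hv x hkv
      have hV : ∀ j ≤ 2, ‖iteratedFDeriv ℝ j v x‖ ≤
          ‖v x‖ + ‖fderiv ℝ v x‖ + ‖fderiv ℝ (fderiv ℝ v) x‖ := by
        intro j hj
        have a0 := norm_nonneg (v x)
        have a1 := norm_nonneg (fderiv ℝ v x)
        have a2 := norm_nonneg (fderiv ℝ (fderiv ℝ v) x)
        interval_cases j
        · rw [norm_iteratedFDeriv_zero]; linarith
        · rw [norm_iteratedFDeriv_one]; linarith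
        · rw [← norm_fderiv_fderiv]; linarith
      set V := ‖v x‖ + ‖fderiv ℝ v x‖ + ‖fderiv ℝ (fderiv ℝ v) x‖ with hVdef
      have hV0 : 0 ≤ V := by positivity
      have l2 : ‖iteratedFDeriv ℝ k (fun x => farCutoff N (n + 1) x * v x) x‖ ≤ 4 * A * V := by
        refine l.trans ?_
        calc _ ≤ ∑ i ∈ Finset.range (k + 1), (k.choose i : ℝ) * (A * V) := by
              refine Finset.sum_le_sum fun i hi => ?_
              rw [mul_assoc]
              have : i ≤ k := Nat.lt_succ_iff.1 (Finset.mem_range.1 hi)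
              gcongr
              · exact hA _ hn i (this.trans hk) x
              · exact hV _ ((Nat.sub_le _ _).trans hk)
          _ = 2 ^ k * (A * V) := by
              rw [← Finset.sum_mul]
              congr 1
              exact_mod_cast Nat.sum_range_choose k
          _ ≤ 2 ^ 2 * (A * V) := by
              gcongr
              norm_num
          _ = 4 * A * V := by ring
      rw [← ofReal_norm]
      calc _ ≤ ENNReal.ofReal (4 * A * V) ^ p := by gcongr
        _ = ENNReal.ofReal (4 * A) ^ p *
            (‖v x‖ₑ + ‖fderiv ℝ v x‖ₑ + ‖fderiv ℝ (fderiv ℝ v) x‖ₑ) ^ p := by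
            rw [ENNReal.ofReal_mul (by positivity), ENNReal.mul_rpow_of_nonneg _ _ hp.le, hVdef,
              ENNReal.ofReal_add (by positivity) (by positivity),
              ENNReal.ofReal_add (norm_nonneg _) (norm_nonneg _), ofReal_norm, ofReal_norm,
              ofReal_norm_bilin]
        _ ≤ ENNReal.ofReal (4 * A) ^ p * (3 ^ p * J x) := by
            gcongr; exact rpow_add_add_le _ _ _ hp.le
        _ = K * J x := by rw [hK, mul_assoc]
    · have hx' : ‖x‖ < (n : ℝ) + 1 := not_le.1 hx
      have : (fun x => farCutoff N (n + 1) x * v x) =ᶠ[nhds x] fun _ => 0 := by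
        filter_upwards [(isOpen_lt continuous_norm continuous_const).mem_nhds hx'] with y hy
        rw [farCutoff_eq_zero (by linarith) (le_of_lt hy), zero_mul]
      rw [(Filter.EventuallyEq.iteratedFDeriv ℝ this k).eq_of_nhds]
      rcases Nat.eq_zero_or_pos k with rfl | hk0
      · rw [← ofReal_norm, norm_iteratedFDeriv_zero]; simp [hp]
      · rw [iteratedFDeriv_const_of_ne hk0.ne']; simp [hp]
  have hle : ∀ n : ℕ, sobolevInt p (fun x => farCutoff N (n + 1) x * v x) ≤
      3 * K * ∫⁻ x, (S n).indicator J x := by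
    intro n
    have e : ∀ k ≤ 2, ∫⁻ x, ‖iteratedFDeriv ℝ k (fun x => farCutoff N (n + 1) x * v x) x‖ₑ ^ p ≤
        K * ∫⁻ x, (S n).indicator J x := fun k hk => by
      rw [← lintegral_const_mul' _ _ hKtop]
      exact lintegral_mono (hpt n k hk)
    have e0 := e 0 (by norm_num)
    have e1 := e 1 (by norm_num)
    have e2 := e 2 (by norm_num)
    simp only [← ofReal_norm, norm_iteratedFDeriv_zero] at e0
    simp only [← ofReal_norm, norm_iteratedFDeriv_one] at e1
    simp only [← ofReal_norm, ← norm_fderiv_fderiv] at e2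
    simp only [ofReal_norm] at e0 e1
    simp only [ofReal_norm_bilin] at e2
    refine (add_le_add (add_le_add e0 e1) e2).trans (le_of_eq ?_)
    ring
  -- The integrals of the integrable `J` over the exteriors of growing balls tend to zero, by
  -- dominated convergence.
  have hlim : Filter.Tendsto (fun n : ℕ => ∫⁻ x, (S n).indicator J x) Filter.atTop (nhds 0) := by
    have := tendsto_lintegral_of_dominated_convergence (μ := volume) (F := fun n => (S n).indicator J)
      (f := fun _ => 0) J (fun n => hJm.indicator (hSm n))
      (fun n => Filter.Eventually.of_forall fun x => Set.indicator_le_self _ _ _)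
      (by rw [hJi]; exact hfin.ne)
      (Filter.Eventually.of_forall fun x => by
        refine tendsto_const_nhds.congr' ?_
        obtain ⟨m, hm⟩ := exists_nat_gt ‖x‖
        filter_upwards [Filter.eventually_ge_atTop m] with n hn
        rw [Set.indicator_of_notMem]
        simp only [hS, Set.mem_ofPred_eq, not_le]
        have : (m : ℝ) ≤ n := by exact_mod_cast hn
        linarith)
    simpa using this
  have hlim' := ENNReal.Tendsto.const_mul (a := 3 * K) hlim
    (Or.inr (ENNReal.mul_ne_top (by norm_num) hKtop))
  rw [mul_zero] at hlim'
  exact tendsto_of_tendsto_of_tendsto_of_le_of_le tendsto_const_nhds hlim'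
    (fun _ => zero_le) hle

variable {s : ℝ} {p : ℝ≥0} [hp1 : Fact (1 ≤ p)]

/-- `C_c^∞` is dense in `B(s, p)`. -/
theorem Besov.exists_smooth_close (hN : 1 ≤ N) (hs : 1 < s) (hs' : s < 2) (w : Besov N s p)
    {ε : ℝ} (hε : 0 < ε) :
    ∃ (u : E N → ℝ) (w' : Besov N s p), ContDiff ℝ ∞ u ∧ HasCompactSupport u ∧
      (Besov.toLp w' : E N → ℝ) =ᵐ[volume] u ∧ ‖w' - w‖ ≤ ε := by
  have hp : (1 : ℝ) ≤ p := by exact_mod_cast hp1.out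
  have hpe : (1 : ℝ≥0∞) ≤ p := by exact_mod_cast hp1.out
  obtain ⟨δ, hδ, h⟩ := Besov.exists_mollify_close hN hs hs' w (half_pos hε)
  obtain ⟨w₁, hw₁, hw₁'⟩ := h ⟨δ / 4, δ / 2, by positivity, by linarith⟩ (half_lt_self hδ)
  set b : ContDiffBump (0 : E N) := ⟨δ / 4, δ / 2, by positivity, by linarith⟩
  set f : E N → ℝ := ⇑(Besov.toLp w) with hf
  have hfL : MemLp f p volume := Lp.memLp _
  have hfl : LocallyIntegrable f := hfL.locallyIntegrable hpe
  have hfin : ∫⁻ x, ‖f x‖ₑ ^ (p : ℝ) < ⊤ := by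
    have := lintegral_rpow_enorm_lt_top_of_eLpNorm_lt_top
      (zero_lt_one.trans_le hpe).ne' ENNReal.coe_ne_top hfL.2
    simpa using this
  have hv : ContDiff ℝ ∞ (mollify b f) := contDiff_mollify b hfl
  have h2 : (2 : WithTop ℕ∞) ≤ (⊤ : ℕ∞) := WithTop.coe_le_coe.2 (le_top : (2 : ℕ∞) ≤ ⊤)
  have hlim := tendsto_sobolevInt_farCutoff_mul (hv.of_le h2) (p := p) (by linarith)
    (sobolevInt_mollify_lt_top b hfl (Lp.stronglyMeasurable _).measurable hp hfin)
  obtain ⟨C, hC, hCw⟩ := Besov.exists_of_sobolevInt (p := p) hN hs hs'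
  have hp0 : (0 : ℝ) < 1 / p := by positivity
  have hlim2 := ENNReal.Tendsto.const_mul (a := C)
    ((ENNReal.continuous_rpow_const (y := 1 / (p : ℝ))).tendsto 0 |>.comp hlim) (Or.inr hC)
  rw [ENNReal.zero_rpow_of_pos hp0, mul_zero] at hlim2
  obtain ⟨n, hn1, hn2⟩ := ((hlim2.eventually (gt_mem_nhds
    (ENNReal.ofReal_pos.2 (half_pos hε)))).and
      (hlim.eventually (gt_mem_nhds (ENNReal.zero_lt_top)))).exists
  have hη := contDiff_farCutoff (N := N) ((n : ℝ) + 1)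
  obtain ⟨w₂, hw₂, -, hw₂'⟩ := hCw _ ((hη.mul hv).of_le h2) hn2
  have hn0 : (0 : ℝ) < n + 1 := by positivity
  -- The cutoff is a subtraction of the far part `w₂`, whose Besov norm is small because its
  -- `W^{2,p}` norm is.
  refine ⟨fun x => (1 - farCutoff N (n + 1) x) * mollify b f x, w₁ - w₂,
    (contDiff_const.sub hη).mul hv, ?_, ?_, ?_⟩
  · refine HasCompactSupport.intro (isCompact_closedBall (0 : E N) (2 * (n + 1))) fun x hx => ?_
    rw [mem_closedBall_zero_iff, not_le] at hx
    rw [farCutoff_eq_one hn0 hx.le, sub_self, zero_mul]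
  · rw [map_sub]
    refine (Lp.coeFn_sub _ _).trans ?_
    filter_upwards [hw₁, hw₂] with x h1 h2
    rw [Pi.sub_apply, h1, h2]
    ring
  · have : ‖w₂‖ ≤ ε / 2 := by
      rw [← ENNReal.ofReal_le_ofReal_iff (half_pos hε).le, ofReal_norm]
      exact hw₂'.trans hn1.le
    calc ‖w₁ - w₂ - w‖ = ‖(w₁ - w) - w₂‖ := by congr 1; abel
      _ ≤ ‖w₁ - w‖ + ‖w₂‖ := norm_sub_le _ _
      _ ≤ ε := by linarith

end Cutoff

/-! ### The difference estimate for smooth functions -/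

section Difference

open scoped ContDiff

variable {N : ℕ}

theorem memLp_top_iteratedFDeriv_two {φ : E N → ℝ} (hφ : ContDiff ℝ 2 φ)
    (hc : HasCompactSupport φ) : MemLp (iteratedFDeriv ℝ 2 φ) ⊤ (volume : Measure (E N)) :=
  (hφ.continuous_iteratedFDeriv (m := 2) le_rfl).memLp_of_hasCompactSupport
    (hc.iteratedFDeriv 2)

theorem supNormD2_nonneg (φ : E N → ℝ) : 0 ≤ supNormD2 φ := ENNReal.toReal_nonneg

theorem abs_hessian_le (φ : E N → ℝ) (x : E N) (i j : Fin N) :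
    |hessian φ x i j| ≤ ‖iteratedFDeriv ℝ 2 φ x‖ := by
  have h := (iteratedFDeriv ℝ 2 φ x).le_opNorm
    ![EuclideanSpace.single i 1, EuclideanSpace.single j 1]
  simpa [hessian, Fin.prod_univ_two] using h

theorem ae_abs_hessian_le_supNormD2 {φ : E N → ℝ} (hφ : ContDiff ℝ 2 φ)
    (hc : HasCompactSupport φ) : ∀ᵐ x, ∀ i j, |hessian φ x i j| ≤ supNormD2 φ := by
  have hm := memLp_top_iteratedFDeriv_two hφ hc
  filter_upwards [ae_le_eLpNormEssSup (f := iteratedFDeriv ℝ 2 φ) (μ := volume)] with x hx i j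
  refine (abs_hessian_le φ x i j).trans ?_
  rw [supNormD2, ← toReal_enorm]
  refine ENNReal.toReal_mono hm.2.ne ?_
  rwa [eLpNorm_exponent_top]

theorem supNormD2_le {φ : E N → ℝ} {M : ℝ} (hM : 0 ≤ M)
    (h : ∀ x, ‖iteratedFDeriv ℝ 2 φ x‖ ≤ M) : supNormD2 φ ≤ M := by
  rw [supNormD2, eLpNorm_exponent_top]
  refine ENNReal.toReal_le_of_le_ofReal hM ?_
  refine eLpNormEssSup_le_of_ae_bound (Filter.Eventually.of_forall h)

theorem continuous_hessian {u : E N → ℝ} (hu : ContDiff ℝ 2 u) (i j : Fin N) :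
    Continuous fun x => hessian u x i j :=
  (hu.continuous_iteratedFDeriv (m := 2) le_rfl).eval_const
    ![EuclideanSpace.single i 1, EuclideanSpace.single j 1]

theorem hessian_add_smul {v h : E N → ℝ} (hv : ContDiff ℝ 2 v) (hh : ContDiff ℝ 2 h) (c : ℝ)
    (x : E N) : hessian (v + c • h) x = hessian v x + c • hessian h x := by
  have hch : ContDiff ℝ 2 (c • h) := hh.const_smul c
  ext i j
  simp only [hessian, Matrix.of_apply, Matrix.add_apply, Matrix.smul_apply]
  rw [iteratedFDeriv_add_apply hv.contDiffAt hch.contDiffAt,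
    iteratedFDeriv_const_smul_apply hh.contDiffAt]
  rfl

theorem continuous_det_hessian {u : E N → ℝ} (hu : ContDiff ℝ 2 u) :
    Continuous fun x => (hessian u x).det :=
  (continuous_matrix fun i j => continuous_hessian hu i j).matrix_det

theorem integrable_det_hessian_mul {u φ : E N → ℝ} (hu : ContDiff ℝ 2 u) (hφ : Continuous φ)
    (hc : HasCompactSupport φ) : Integrable fun x => (hessian u x).det * φ x :=
  ((continuous_det_hessian hu).mul hφ).integrable_of_hasCompactSupport hc.mul_left

theorem integral_det_hessian_add_smul {v h φ : E N → ℝ} (hv : ContDiff ℝ 2 v)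
    (hh : ContDiff ℝ 2 h) (hφ : Continuous φ) (hc : HasCompactSupport φ) (θ : ℝ) :
    ∫ x, (hessian (v + θ • h) x).det * φ x =
      ∑ k ∈ Finset.range (N + 1), (∫ x, (hessian (v + (k : ℝ) • h) x).det * φ x) *
        (Lagrange.basis (Finset.range (N + 1)) (fun k : ℕ => (k : ℝ)) k).eval θ := by
  simp only [← integral_mul_const]
  rw [← integral_finsetSum]
  · refine integral_congr_ae (Filter.Eventually.of_forall fun x => ?_)
    simp only [hessian_add_smul hv hh]
    rw [det_add_smul_eq_sum, Finset.sum_mul, Fintype.card_fin]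
    exact Finset.sum_congr rfl fun k _ => by ring
  · intro k _
    exact (integrable_det_hessian_mul (hv.add (hh.const_smul (k : ℝ))) hφ hc).mul_const _

/-- The increment `q(θ) - q(0)` is `θ` times a polynomial, which is bounded on `[0, 1]`. -/
theorem exists_abs_eval_sub_eval_zero_le (q : Polynomial ℝ) :
    ∃ L : ℝ, 0 ≤ L ∧ ∀ θ ∈ Set.Icc (0 : ℝ) 1, |q.eval θ - q.eval 0| ≤ L * θ := by
  obtain ⟨L, hL⟩ := isCompact_Icc.exists_bound_of_continuousOn
    (s := Set.Icc (0 : ℝ) 1) (f := fun θ => q.divX.eval θ) q.divX.continuous.continuousOn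
  refine ⟨L, (norm_nonneg _).trans (hL 0 (by simp)), fun θ hθ => ?_⟩
  have h : ∀ t, q.eval t = q.divX.eval t * t + q.coeff 0 := fun t => by
    conv_lhs => rw [← q.divX_mul_X_add]
    simp
  rw [h θ, h 0, mul_zero, zero_add, add_sub_cancel_right, abs_mul, abs_of_nonneg hθ.1]
  exact mul_le_mul_of_nonneg_right (hL θ hθ) hθ.1

variable {s : ℝ} {p : ℝ≥0} [hp1 : Fact (1 ≤ p)]

/-- `u` is a `C_c^∞` representative of the element `w` of `B(s, p)`. -/
structure IsSmoothRep (w : Besov N s p) (u : E N → ℝ) : Prop where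
  contDiff : ContDiff ℝ ∞ u
  hasCompactSupport : HasCompactSupport u
  ae_eq : (Besov.toLp w : E N → ℝ) =ᵐ[volume] u

namespace IsSmoothRep

variable {w w' : Besov N s p} {u u' : E N → ℝ}

theorem contDiff_two (h : IsSmoothRep w u) : ContDiff ℝ 2 u :=
  h.contDiff.of_le (WithTop.coe_le_coe.2 (le_top : (2 : ℕ∞) ≤ ⊤))

theorem add_smul (h : IsSmoothRep w u) (h' : IsSmoothRep w' u') (c : ℝ) :
    IsSmoothRep (w + c • w') (u + c • u') where
  contDiff := h.contDiff.add (h'.contDiff.const_smul c)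
  hasCompactSupport := h.hasCompactSupport.add
    (h'.hasCompactSupport.comp_left (g := fun y => c • y) (smul_zero c))
  ae_eq := by
    rw [map_add, map_smul]
    filter_upwards [Lp.coeFn_add (Besov.toLp w) (c • Besov.toLp w'),
      Lp.coeFn_smul c (Besov.toLp w'), h.ae_eq, h'.ae_eq] with x h1 h2 h3 h4
    rw [h1, Pi.add_apply, h2, Pi.smul_apply, h3, h4]
    rfl

theorem eq_of_eq (h : IsSmoothRep w u) (h' : IsSmoothRep w u') : u = u' :=
  (h.contDiff.continuous.ae_eq_iff_eq volume h'.contDiff.continuous).1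
    (h.ae_eq.symm.trans h'.ae_eq)

theorem grad_ae_eq (h : IsSmoothRep w u) : (Besov.grad w : E N → E N) =ᵐ[volume] gradient u := by
  have h1 : ContDiff ℝ 1 u := h.contDiff.of_le (by simp)
  refine ((Besov.hasWeakGradient_grad w).congr h.ae_eq (Filter.EventuallyEq.refl _ _)).unique
    (hasWeakGradient_gradient h1) (Lp.memLp _)
    ((continuous_gradient h1).memLp_of_hasCompactSupport ?_)
  exact (h.hasCompactSupport.fderiv ℝ).comp_left (map_zero _)

end IsSmoothRep

/-- The critical exponent makes `N + (s - 1) N` equal to `2N - 2`, so the double integral is the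
`N`-th power of the Gagliardo part of the norm. -/
theorem exists_abs_integral_det_hessian_le (N : ℕ) [hN : Fact (3 ≤ N)] :
    ∃ C : ℝ, 0 ≤ C ∧ ∀ (w : CriticalBesov N) (u φ : E N → ℝ), IsSmoothRep w u → ContDiff ℝ 2 φ →
      HasCompactSupport φ →
      |∫ x, (hessian u x).det * φ x| ≤ C * ‖w‖ ^ N * supNormD2 φ := by
  have hN3 : 3 ≤ N := hN.out
  have hN0 : (0 : ℝ) < N := by exact_mod_cast (show 0 < N by omega)
  obtain ⟨C, hC, h⟩ := exists_enorm_integral_det_hessian_le (N := N) (by omega)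
  refine ⟨C.toReal, ENNReal.toReal_nonneg, fun w u φ hw hφ hc => ?_⟩
  have h1 := h u φ (supNormD2 φ) hw.contDiff hw.hasCompactSupport hφ hc
    (ae_abs_hessian_le_supNormD2 hφ hc)
  have hg : gagliardo (2 - 2 / (N : ℝ) - 1) (N : ℝ≥0) (gradient u) ≤ ‖w‖ₑ := by
    rw [Besov.enorm_eq hw.ae_eq hw.grad_ae_eq]
    exact le_add_self
  rw [gagliardo_gradient] at hg
  have hexp : (N : ℝ) + (2 - 2 / (N : ℝ) - 1) * ((N : ℝ≥0) : ℝ) = 2 * N - 2 := by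
    rw [NNReal.coe_natCast]; field_simp; ring
  rw [hexp, NNReal.coe_natCast] at hg
  have hg2 := ENNReal.rpow_le_rpow hg hN0.le
  rw [← ENNReal.rpow_mul, one_div_mul_cancel hN0.ne', ENNReal.rpow_one] at hg2
  have h2 : ‖∫ x, (hessian u x).det * φ x‖ₑ ≤
      C * ENNReal.ofReal (supNormD2 φ) * ‖w‖ₑ ^ (N : ℝ) := h1.trans (by gcongr)
  have h3 := ENNReal.toReal_mono (ENNReal.mul_ne_top (ENNReal.mul_ne_top hC ENNReal.ofReal_ne_top)
    (ENNReal.rpow_ne_top_of_nonneg hN0.le enorm_ne_top)) h2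
  rw [toReal_enorm, ENNReal.toReal_mul, ENNReal.toReal_mul,
    ENNReal.toReal_ofReal (supNormD2_nonneg φ), ← ENNReal.toReal_rpow, toReal_enorm,
    Real.rpow_natCast, Real.norm_eq_abs] at h3
  linarith

/-- The difference estimate for `det D²u` on `C_c^∞`. -/
theorem exists_abs_integral_det_hessian_sub_le (N : ℕ) [hN : Fact (3 ≤ N)] :
    ∃ C : ℝ, 0 ≤ C ∧ ∀ (w₁ w₂ : CriticalBesov N) (u₁ u₂ φ : E N → ℝ), IsSmoothRep w₁ u₁ →
      IsSmoothRep w₂ u₂ → ContDiff ℝ 2 φ → HasCompactSupport φ →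
      |(∫ x, (hessian u₁ x).det * φ x) - ∫ x, (hessian u₂ x).det * φ x| ≤
        C * ‖w₁ - w₂‖ * (‖w₁‖ ^ (N - 1) + ‖w₂‖ ^ (N - 1)) * supNormD2 φ := by
  obtain ⟨C, hC, hF⟩ := exists_abs_integral_det_hessian_le N
  choose L hL0 hL using fun k : ℕ => exists_abs_eval_sub_eval_zero_le
    (Lagrange.basis (Finset.range (N + 1)) (fun k : ℕ => (k : ℝ)) k)
  set Λ : ℝ := ∑ k ∈ Finset.range (N + 1), L k with hΛ
  have hΛ0 : 0 ≤ Λ := Finset.sum_nonneg fun k _ => hL0 k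
  refine ⟨C * (N + 1) ^ N * Λ * (2 ^ (N - 1) * 2 ^ (N - 1 - 1)), by positivity,
    fun w₁ w₂ u₁ u₂ φ h₁ h₂ hφ hc => ?_⟩
  have hS := supNormD2_nonneg φ
  set a := ‖w₂‖ with ha
  set d := ‖w₁ - w₂‖ with hd
  have ha0 : 0 ≤ a := norm_nonneg _
  have hd0 : 0 ≤ d := norm_nonneg _
  rcases hd0.eq_or_lt with hd1 | hd1
  · have : w₁ = w₂ := sub_eq_zero.1 (norm_eq_zero.1 hd1.symm)
    subst this
    rw [h₁.eq_of_eq h₂, sub_self, abs_zero]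
    positivity
  -- With this `R`, the rescaled difference `h` has norm `a + d`. The nodes `u₂ + k h` then have
  -- norm at most `(N + 1)(a + d)`, and `u₁` is reached at `θ = 1/R = d / (a + d)`, which supplies
  -- the factor `‖w₁ - w₂‖`.
  set R := (a + d) / d with hR
  have hR1 : 1 ≤ R := by rw [hR, one_le_div hd1]; linarith
  have hR0 : 0 < R := by linarith
  have hθ : R⁻¹ ∈ Set.Icc (0 : ℝ) 1 := ⟨by positivity, inv_le_one_of_one_le₀ hR1⟩
  have hdiff : IsSmoothRep (w₁ + (-1 : ℝ) • w₂) (u₁ + (-1 : ℝ) • u₂) := h₁.add_smul h₂ _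
  set h : E N → ℝ := R • (u₁ + (-1 : ℝ) • u₂) with hh
  have hh2 : ContDiff ℝ 2 h := hdiff.contDiff_two.const_smul R
  have e0 : ∀ θ : ℝ, u₂ + θ • h = u₂ + (θ * R) • (u₁ + (-1 : ℝ) • u₂) := fun θ => by
    rw [hh, smul_smul]
  have hQ := integral_det_hessian_add_smul h₂.contDiff_two hh2 hφ.continuous hc
  have eu1 : u₂ + R⁻¹ • h = u₁ := by
    rw [e0, inv_mul_cancel₀ hR0.ne', one_smul, neg_one_smul]; abel
  have eu2 : u₂ + (0 : ℝ) • h = u₂ := by rw [zero_smul, add_zero]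
  have q1 := hQ R⁻¹
  have q0 := hQ 0
  rw [eu1] at q1
  rw [eu2] at q0
  rw [q1, q0, ← Finset.sum_sub_distrib]
  have hk : ∀ k ∈ Finset.range (N + 1), |∫ x, (hessian (u₂ + (k : ℝ) • h) x).det * φ x| ≤
      C * ((N + 1) * (a + d)) ^ N * supNormD2 φ := by
    intro k hk
    have hkN : (k : ℝ) ≤ N := by exact_mod_cast Nat.lt_succ_iff.1 (Finset.mem_range.1 hk)
    rw [e0]
    refine (hF _ _ φ (h₂.add_smul hdiff _) hφ hc).trans ?_
    gcongr
    calc ‖w₂ + ((k : ℝ) * R) • (w₁ + (-1 : ℝ) • w₂)‖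
        ≤ ‖w₂‖ + ‖((k : ℝ) * R) • (w₁ + (-1 : ℝ) • w₂)‖ := norm_add_le _ _
      _ = a + k * R * d := by
          rw [norm_smul, neg_one_smul, ← sub_eq_add_neg, Real.norm_of_nonneg (by positivity)]
      _ = a + k * (a + d) := by rw [hR]; field_simp
      _ ≤ (a + d) + N * (a + d) := by gcongr; linarith
      _ = _ := by ring
  have hpow : (a + d) ^ (N - 1) ≤
      2 ^ (N - 1) * 2 ^ (N - 1 - 1) * (‖w₁‖ ^ (N - 1) + a ^ (N - 1)) := by
    have : d ≤ ‖w₁‖ + a := norm_sub_le _ _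
    calc (a + d) ^ (N - 1) ≤ (2 * (‖w₁‖ + a)) ^ (N - 1) := by
          gcongr; linarith [norm_nonneg w₁]
      _ = 2 ^ (N - 1) * (‖w₁‖ + a) ^ (N - 1) := mul_pow _ _ _
      _ ≤ 2 ^ (N - 1) * (2 ^ (N - 1 - 1) * (‖w₁‖ ^ (N - 1) + a ^ (N - 1))) := by
          gcongr; exact add_pow_le (norm_nonneg _) ha0 _
      _ = _ := by ring
  calc _ ≤ ∑ k ∈ Finset.range (N + 1), C * ((N + 1) * (a + d)) ^ N * supNormD2 φ *
          (L k * R⁻¹) := by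
        refine (Finset.abs_sum_le_sum_abs _ _).trans (Finset.sum_le_sum fun k hk' => ?_)
        rw [← mul_sub, abs_mul]
        exact mul_le_mul (hk k hk') (hL k _ hθ) (abs_nonneg _) (by positivity)
    _ = C * (N + 1) ^ N * Λ * d * (a + d) ^ (N - 1) * supNormD2 φ := by
        rw [← Finset.mul_sum, ← Finset.sum_mul, ← hΛ, hR, inv_div, mul_pow]
        have hN1 : (a + d) ^ N = (a + d) ^ (N - 1) * (a + d) := by
          rw [← pow_succ]; congr 1; have := hN.out; omega
        rw [hN1]
        field_simp
    _ ≤ C * (N + 1) ^ N * Λ * d * (2 ^ (N - 1) * 2 ^ (N - 1 - 1) *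
          (‖w₁‖ ^ (N - 1) + a ^ (N - 1))) * supNormD2 φ := by gcongr
    _ = _ := by ring

end Difference

/-! ### Mollified Hessians of `C_c^2` functions -/

section TwiceDifferentiable

open scoped ContDiff

variable {N : ℕ}

theorem mollify_congr_ae (b : ContDiffBump (0 : E N)) {f g : E N → ℝ} (h : f =ᵐ[volume] g) :
    mollify b f = mollify b g :=
  convolution_congr _ (Filter.EventuallyEq.refl _ _) h

theorem hasCompactSupport_mollify (b : ContDiffBump (0 : E N)) {f : E N → ℝ}
    (hf : HasCompactSupport f) : HasCompactSupport (mollify b f) :=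
  HasCompactSupport.convolution _ b.hasCompactSupport_normed hf

theorem dirDeriv_mollify (b : ContDiffBump (0 : E N)) {f : E N → ℝ} (hf : ContDiff ℝ 1 f)
    (hc : HasCompactSupport f) (v : E N) :
    dirDeriv v (mollify b f) = mollify b (dirDeriv v f) := by
  ext x
  have hρ : LocallyIntegrable (b.normed volume) := b.continuous_normed.locallyIntegrable
  rw [dirDeriv, mollify,
    (hc.hasFDerivAt_convolution_right (ContinuousLinearMap.lsmul ℝ ℝ) hρ hf x).fderiv,
    convolution_precompR_apply _ hρ (hc.fderiv ℝ) (hf.continuous_fderiv one_ne_zero)]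
  rfl

theorem hessian_mollify (b : ContDiffBump (0 : E N)) {u : E N → ℝ} (hu : ContDiff ℝ 2 u)
    (hc : HasCompactSupport u) (x : E N) (i j : Fin N) :
    hessian (mollify b u) x i j = mollify b (fun y => hessian u y i j) x := by
  have h1 : ContDiff ℝ 1 (dirDeriv (stdVec j) u) := contDiff_dirDeriv hu (by norm_num) _
  rw [hessian_apply ((contDiff_mollify b hu.continuous.locallyIntegrable).of_le
      (WithTop.coe_le_coe.2 (le_top : (2 : ℕ∞) ≤ ⊤))),
    dirDeriv_mollify b (hu.of_le (by norm_num)) hc, dirDeriv_mollify b h1 (hc.dirDeriv _)]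
  simp only [hessian_apply hu]

theorem abs_mollify_le (b : ContDiffBump (0 : E N)) {g : E N → ℝ} {M : ℝ} (hg : ∀ x, |g x| ≤ M)
    (x : E N) : |mollify b g x| ≤ M := by
  rw [mollify_apply, ← Real.norm_eq_abs]
  refine (norm_integral_le_of_norm_le (b.integrable_normed.mul_const M)
    (Filter.Eventually.of_forall fun z => ?_)).trans ?_
  · rw [norm_smul, Real.norm_of_nonneg (b.nonneg_normed z)]
    exact mul_le_mul_of_nonneg_left (hg _) (b.nonneg_normed z)
  · rw [integral_mul_const, b.integral_normed, one_mul]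

/-- Bump functions shrinking to the origin. -/
def shrinkingBump (N n : ℕ) : ContDiffBump (0 : E N) :=
  ⟨1 / (n + 2), 1 / (n + 1), by positivity, by gcongr; norm_num⟩

theorem tendsto_rOut_shrinkingBump (N : ℕ) :
    Filter.Tendsto (fun n => (shrinkingBump N n).rOut) Filter.atTop (nhds 0) :=
  tendsto_one_div_add_atTop_nhds_zero_nat

/-- Hessian entries commute with mollification, hence keep their sup bound and converge pointwise by
continuity; dominated convergence applies. -/
theorem tendsto_integral_det_hessian_mollify {u φ : E N → ℝ} (hu : ContDiff ℝ 2 u)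
    (hc : HasCompactSupport u) (hφ : Continuous φ) (hφc : HasCompactSupport φ) :
    Filter.Tendsto (fun n => ∫ x, (hessian (mollify (shrinkingBump N n) u) x).det * φ x)
      Filter.atTop (nhds (∫ x, (hessian u x).det * φ x)) := by
  obtain ⟨M, hM⟩ := (hc.iteratedFDeriv (𝕜 := ℝ) 2).exists_bound_of_continuous
    (hu.continuous_iteratedFDeriv (m := 2) le_rfl)
  have hM' : ∀ i j x, |hessian u x i j| ≤ M := fun i j x => (abs_hessian_le u x i j).trans (hM x)
  refine tendsto_integral_of_dominated_convergence
    (fun x => ((Fintype.card (Fin N)).factorial * M ^ Fintype.card (Fin N)) * |φ x|) ?_ ?_ ?_ ?_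
  · intro n
    exact ((continuous_det_hessian ((contDiff_mollify _ hu.continuous.locallyIntegrable).of_le
      (WithTop.coe_le_coe.2 (le_top : (2 : ℕ∞) ≤ ⊤)))).mul hφ).aestronglyMeasurable
  · exact ((hφ.integrable_of_hasCompactSupport hφc).abs).const_mul _
  · intro n
    refine Filter.Eventually.of_forall fun x => ?_
    rw [norm_mul, Real.norm_eq_abs, Real.norm_eq_abs]
    refine mul_le_mul_of_nonneg_right (abs_det_le fun i j => ?_) (abs_nonneg _)
    rw [hessian_mollify _ hu hc]
    exact abs_mollify_le _ (hM' i j) x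
  · refine Filter.Eventually.of_forall fun x => Filter.Tendsto.mul_const _ ?_
    refine ((Continuous.matrix_det continuous_id).tendsto (hessian u x)).comp ?_
    refine tendsto_pi_nhds.2 fun i => tendsto_pi_nhds.2 fun j => ?_
    refine Filter.Tendsto.congr (fun n => (hessian_mollify _ hu hc x i j).symm) ?_
    exact ContDiffBump.convolution_tendsto_right_of_continuous (tendsto_rOut_shrinkingBump N)
      (continuous_hessian hu i j) x

end TwiceDifferentiable

/-! ### Extension of the pairing by density -/

section Extension

open scoped ContDiff

variable {N : ℕ} [hN : Fact (3 ≤ N)]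

theorem one_lt_criticalExponent (N : ℕ) [hN : Fact (3 ≤ N)] : 1 < 2 - 2 / (N : ℝ) := by
  have h3 : (3 : ℝ) ≤ N := by exact_mod_cast hN.out
  have : 2 / (N : ℝ) < 1 := by rw [div_lt_one (by linarith)]; linarith
  linarith

theorem criticalExponent_lt_two (N : ℕ) [hN : Fact (3 ≤ N)] : 2 - 2 / (N : ℝ) < 2 := by
  have h3 : (3 : ℝ) ≤ N := by exact_mod_cast hN.out
  have : 0 < 2 / (N : ℝ) := by positivity
  linarith

/-- A sequence of elements of `B(2 - 2/N, N)` converging to `w`, with `C_c^∞` representatives. -/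
structure IsApprox (w : CriticalBesov N) (v : ℕ → CriticalBesov N) (u : ℕ → E N → ℝ) : Prop where
  isSmoothRep : ∀ n, IsSmoothRep (v n) (u n)
  tendsto : Filter.Tendsto v Filter.atTop (nhds w)

theorem exists_isApprox (w : CriticalBesov N) : ∃ v u, IsApprox w v u := by
  have h : ∀ n : ℕ, ∃ (u : E N → ℝ) (w' : CriticalBesov N), IsSmoothRep w' u ∧
      ‖w' - w‖ ≤ 1 / ((n : ℝ) + 1) := fun n => by
    obtain ⟨u, w', h1, h2, h3, h4⟩ := Besov.exists_smooth_close (by have := hN.out; omega)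
      (one_lt_criticalExponent N) (criticalExponent_lt_two N) w
      (show (0 : ℝ) < 1 / ((n : ℝ) + 1) by positivity)
    exact ⟨u, w', ⟨h1, h2, h3⟩, h4⟩
  choose u v h1 h2 using h
  exact ⟨v, u, h1, tendsto_iff_norm_sub_tendsto_zero.2 (squeeze_zero (fun _ => norm_nonneg _) h2
    tendsto_one_div_add_atTop_nhds_zero_nat)⟩

/-- `C_c^2` functions belong to `B(2 - 2/N, N)` and are approximated by their mollifications. -/
theorem exists_isApprox_mollify {u : E N → ℝ} (hu : ContDiff ℝ 2 u) (hc : HasCompactSupport u) :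
    ∃ w : CriticalBesov N, (Besov.toLp w : E N → ℝ) =ᵐ[volume] u ∧
      ∃ (v : ℕ → CriticalBesov N) (k : ℕ → ℕ), Filter.Tendsto k Filter.atTop Filter.atTop ∧
        IsApprox w v fun n => mollify (shrinkingBump N (k n)) u := by
  have hN1 : 1 ≤ N := by have := hN.out; omega
  have hp : (1 : ℝ) ≤ ((N : ℝ≥0) : ℝ) := by simpa using hN1
  obtain ⟨C, -, hC⟩ := Besov.exists_of_sobolevInt (p := (N : ℝ≥0)) hN1
    (one_lt_criticalExponent N) (criticalExponent_lt_two N)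
  obtain ⟨w, hw, -, -⟩ := hC u hu (sobolevInt_lt_top_of_hasCompactSupport hu hc hp)
  refine ⟨w, hw, ?_⟩
  -- The index `k` makes the bump radius small enough for accuracy `1/(n+1)`; `n ≤ k` forces the
  -- chosen indices to infinity.
  have h : ∀ n : ℕ, ∃ (k : ℕ) (w' : CriticalBesov N), n ≤ k ∧
      IsSmoothRep w' (mollify (shrinkingBump N k) u) ∧ ‖w' - w‖ ≤ 1 / ((n : ℝ) + 1) := fun n => by
    obtain ⟨δ, hδ, h⟩ := Besov.exists_mollify_close hN1 (one_lt_criticalExponent N)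
      (criticalExponent_lt_two N) w (show (0 : ℝ) < 1 / ((n : ℝ) + 1) by positivity)
    obtain ⟨k, hk, hkn⟩ := (((tendsto_rOut_shrinkingBump N).eventually (gt_mem_nhds hδ)).and
      (Filter.eventually_ge_atTop n)).exists
    obtain ⟨w', h1, h2⟩ := h _ hk
    rw [mollify_congr_ae _ hw] at h1
    exact ⟨k, w', hkn, ⟨contDiff_mollify _ hu.continuous.locallyIntegrable,
      hasCompactSupport_mollify _ hc, h1⟩, h2⟩
  choose k v hk h1 h2 using h
  exact ⟨v, k, Filter.tendsto_atTop_mono hk Filter.tendsto_id, h1,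
    tendsto_iff_norm_sub_tendsto_zero.2 (squeeze_zero (fun _ => norm_nonneg _) h2
      tendsto_one_div_add_atTop_nhds_zero_nat)⟩

theorem tendsto_difference_bound {ι : Type*} {l : Filter ι} {v₁ v₂ : ι → CriticalBesov N}
    {w₁ w₂ : CriticalBesov N} (h₁ : Filter.Tendsto v₁ l (nhds w₁))
    (h₂ : Filter.Tendsto v₂ l (nhds w₂)) (C M : ℝ) :
    Filter.Tendsto (fun n => C * ‖v₁ n - v₂ n‖ * (‖v₁ n‖ ^ (N - 1) + ‖v₂ n‖ ^ (N - 1)) * M) l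
      (nhds (C * ‖w₁ - w₂‖ * (‖w₁‖ ^ (N - 1) + ‖w₂‖ ^ (N - 1)) * M)) :=
  (((h₁.sub h₂).norm.const_mul C).mul ((h₁.norm.pow _).add (h₂.norm.pow _))).mul_const M

/-- The pairing of `det D²u` with a `C_c^2` function extends to `B(2 - 2/N, N)`. -/
theorem exists_tendsto_integral_det_hessian (w : CriticalBesov N) {φ : E N → ℝ}
    (hφ : ContDiff ℝ 2 φ) (hc : HasCompactSupport φ) :
    ∃ t : ℝ, ∀ v u, IsApprox w v u →
      Filter.Tendsto (fun n => ∫ x, (hessian (u n) x).det * φ x) Filter.atTop (nhds t) := by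
  obtain ⟨C, hC, hF⟩ := exists_abs_integral_det_hessian_sub_le N
  obtain ⟨v₀, u₀, h₀⟩ := exists_isApprox w
  have hcauchy : CauchySeq fun n => ∫ x, (hessian (u₀ n) x).det * φ x := by
    rw [cauchySeq_iff_tendsto_dist_atTop_0]
    refine squeeze_zero (fun _ => dist_nonneg) (fun n => hF (v₀ n.1) (v₀ n.2) (u₀ n.1) (u₀ n.2) φ
      (h₀.isSmoothRep _) (h₀.isSmoothRep _) hφ hc) ?_
    rw [← Filter.prod_atTop_atTop_eq]
    have := tendsto_difference_bound (h₀.tendsto.comp Filter.tendsto_fst)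
      (h₀.tendsto.comp (Filter.tendsto_snd (f := Filter.atTop (α := ℕ)))) C (supNormD2 φ)
    simpa using this
  obtain ⟨t, ht⟩ := cauchySeq_tendsto_of_complete hcauchy
  refine ⟨t, fun v u h => ?_⟩
  -- Two sequences approximating the same `w` have pairings whose difference vanishes, so the limit
  -- is independent of the approximation.
  have hd : Filter.Tendsto (fun n => (∫ x, (hessian (u n) x).det * φ x) -
      ∫ x, (hessian (u₀ n) x).det * φ x) Filter.atTop (nhds 0) := by
    refine squeeze_zero_norm (fun n => hF (v n) (v₀ n) (u n) (u₀ n) φ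
      (h.isSmoothRep _) (h₀.isSmoothRep _) hφ hc) ?_
    simpa using tendsto_difference_bound h.tendsto h₀.tendsto C (supNormD2 φ)
  simpa using hd.add ht

/-- The value of the extension of `det D²` at `w`, tested against a `C_c^2` function. -/
def detPairing (w : CriticalBesov N) (φ : 𝓓^{2}((⊤ : Opens (E N)), ℝ)) : ℝ :=
  (exists_tendsto_integral_det_hessian w φ.contDiff φ.hasCompactSupport).choose

theorem tendsto_detPairing {w : CriticalBesov N} {v : ℕ → CriticalBesov N} {u : ℕ → E N → ℝ}
    (h : IsApprox w v u) (φ : 𝓓^{2}((⊤ : Opens (E N)), ℝ)) :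
    Filter.Tendsto (fun n => ∫ x, (hessian (u n) x).det * φ x) Filter.atTop
      (nhds (detPairing w φ)) :=
  (exists_tendsto_integral_det_hessian w φ.contDiff φ.hasCompactSupport).choose_spec v u h

theorem exists_abs_detPairing_sub_le (N : ℕ) [Fact (3 ≤ N)] :
    ∃ C : ℝ, ∀ (w₁ w₂ : CriticalBesov N) (φ : 𝓓^{2}((⊤ : Opens (E N)), ℝ)),
      |detPairing w₁ φ - detPairing w₂ φ| ≤
        C * ‖w₁ - w₂‖ * (‖w₁‖ ^ (N - 1) + ‖w₂‖ ^ (N - 1)) * supNormD2 φ := by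
  obtain ⟨C, hC, hF⟩ := exists_abs_integral_det_hessian_sub_le N
  refine ⟨C, fun w₁ w₂ φ => ?_⟩
  obtain ⟨v₁, u₁, h₁⟩ := exists_isApprox w₁
  obtain ⟨v₂, u₂, h₂⟩ := exists_isApprox w₂
  exact le_of_tendsto_of_tendsto' ((tendsto_detPairing h₁ φ).sub (tendsto_detPairing h₂ φ)).abs
    (tendsto_difference_bound h₁.tendsto h₂.tendsto C (supNormD2 φ)) fun n =>
      hF _ _ _ _ φ (h₁.isSmoothRep n) (h₂.isSmoothRep n) φ.contDiff φ.hasCompactSupport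

theorem exists_abs_detPairing_le (N : ℕ) [Fact (3 ≤ N)] :
    ∃ C : ℝ, ∀ (w : CriticalBesov N) (φ : 𝓓^{2}((⊤ : Opens (E N)), ℝ)),
      |detPairing w φ| ≤ C * ‖w‖ ^ N * supNormD2 φ := by
  obtain ⟨C, hC, hF⟩ := exists_abs_integral_det_hessian_le N
  refine ⟨C, fun w φ => ?_⟩
  obtain ⟨v, u, h⟩ := exists_isApprox w
  exact le_of_tendsto_of_tendsto' (tendsto_detPairing h φ).abs
    (((h.tendsto.norm.pow N).const_mul C).mul_const (supNormD2 φ)) fun n =>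
      hF _ _ φ (h.isSmoothRep n) φ.contDiff φ.hasCompactSupport

theorem integrable_det_hessian_mul_testFunction {v : CriticalBesov N} {u : E N → ℝ}
    (h : IsSmoothRep v u) (φ : 𝓓^{2}((⊤ : Opens (E N)), ℝ)) :
    Integrable fun x => (hessian u x).det * φ x :=
  integrable_det_hessian_mul h.contDiff_two φ.continuous φ.hasCompactSupport

theorem detPairing_add (w : CriticalBesov N) (φ ψ : 𝓓^{2}((⊤ : Opens (E N)), ℝ)) :
    detPairing w (φ + ψ) = detPairing w φ + detPairing w ψ := by
  obtain ⟨v, u, h⟩ := exists_isApprox w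
  refine tendsto_nhds_unique (tendsto_detPairing h (φ + ψ))
    (((tendsto_detPairing h φ).add (tendsto_detPairing h ψ)).congr fun n => ?_)
  rw [← integral_add (integrable_det_hessian_mul_testFunction (h.isSmoothRep n) φ)
    (integrable_det_hessian_mul_testFunction (h.isSmoothRep n) ψ)]
  refine integral_congr_ae (Filter.Eventually.of_forall fun x => ?_)
  exact (mul_add _ (φ x) (ψ x)).symm

theorem detPairing_smul (w : CriticalBesov N) (c : ℝ) (φ : 𝓓^{2}((⊤ : Opens (E N)), ℝ)) :
    detPairing w (c • φ) = c * detPairing w φ := by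
  obtain ⟨v, u, h⟩ := exists_isApprox w
  refine tendsto_nhds_unique (tendsto_detPairing h (c • φ))
    (((tendsto_detPairing h φ).const_mul c).congr fun n => ?_)
  rw [← integral_const_mul]
  refine integral_congr_ae (Filter.Eventually.of_forall fun x => ?_)
  exact mul_left_comm c _ (φ x)

end Extension

/-! ### Continuity of the second derivative on test functions -/

section SecondDerivative

variable {V : Type*} [NormedAddCommGroup V] [NormedSpace ℝ V]

/-- Only a continuous majorant `q` of the sup norm with `q 0 = 0` is recorded; this is all that
later continuity and compactness arguments need. -/
theorem exists_continuous_norm_le (Ω : Opens V) (F : Type*) [NormedAddCommGroup F]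
    [NormedSpace ℝ F] (n : ℕ∞) :
    ∃ q : 𝓓^{n}(Ω, F) → ℝ, Continuous q ∧ q 0 = 0 ∧
      ∀ (f : 𝓓^{n}(Ω, F)) (x : V), ‖f x‖ ≤ q f := by
  refine ⟨fun f => ‖TestFunction.toBoundedContinuousFunctionCLM ℝ f‖,
    (ContinuousLinearMap.continuous _).norm, by simp only [map_zero, norm_zero], fun f x => ?_⟩
  exact (TestFunction.toBoundedContinuousFunctionCLM ℝ f).norm_coe_le_norm x

theorem exists_continuous_norm_fderiv_le (Ω : Opens V) (F : Type*) [NormedAddCommGroup F]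
    [NormedSpace ℝ F] {n k : ℕ∞} (hk : k + 1 ≤ n) :
    ∃ q : 𝓓^{n}(Ω, F) → ℝ, Continuous q ∧ q 0 = 0 ∧
      ∀ (f : 𝓓^{n}(Ω, F)) (x : V), ‖fderiv ℝ f x‖ ≤ q f := by
  obtain ⟨q, h1, h2, h3⟩ := exists_continuous_norm_le Ω (V →L[ℝ] F) k
  refine ⟨fun f => q (TestFunction.fderivCLM ℝ n k f), h1.comp (ContinuousLinearMap.continuous _),
    by simp [h2], fun f x => ?_⟩
  have := h3 (TestFunction.fderivCLM ℝ n k f) x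
  rwa [TestFunction.fderivCLM_apply_of_le _ hk] at this

/-- The second derivative of a `C_c^2` function depends continuously on it, in the sup norm. -/
theorem exists_continuous_norm_iteratedFDeriv_two_le (Ω : Opens V) :
    ∃ q : 𝓓^{2}(Ω, ℝ) → ℝ, Continuous q ∧ q 0 = 0 ∧
      ∀ (φ : 𝓓^{2}(Ω, ℝ)) (x : V), ‖iteratedFDeriv ℝ 2 φ x‖ ≤ q φ := by
  obtain ⟨q, h1, h2, h3⟩ := exists_continuous_norm_fderiv_le Ω (V →L[ℝ] ℝ) (n := 1) (k := 0)
    (by norm_num)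
  refine ⟨fun f => q (TestFunction.fderivCLM ℝ 2 1 f), h1.comp (ContinuousLinearMap.continuous _),
    by simp [h2], fun f x => ?_⟩
  have := h3 (TestFunction.fderivCLM ℝ 2 1 f) x
  rw [TestFunction.fderivCLM_apply_of_le _ (by norm_num)] at this
  rwa [← norm_iteratedFDeriv_fderiv, norm_iteratedFDeriv_one]

end SecondDerivative

/-! ### The extension as a distribution -/

section Distribution

theorem coe_monoCLM {N : ℕ} (φ : 𝓓((⊤ : Opens (E N)), ℝ)) :
    ((TestFunction.monoCLM ℝ φ : 𝓓^{2}((⊤ : Opens (E N)), ℝ)) : E N → ℝ) = φ := by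
  rw [TestFunction.monoCLM_apply, if_pos ⟨le_top, le_rfl⟩]

variable {N : ℕ} [hN : Fact (3 ≤ N)]

theorem exists_continuous_supNormD2_le (N : ℕ) :
    ∃ q : 𝓓^{2}((⊤ : Opens (E N)), ℝ) → ℝ, Continuous q ∧ q 0 = 0 ∧
      ∀ φ : 𝓓^{2}((⊤ : Opens (E N)), ℝ), supNormD2 φ ≤ q φ := by
  obtain ⟨q, h1, h2, h3⟩ := exists_continuous_norm_iteratedFDeriv_two_le (⊤ : Opens (E N))
  exact ⟨q, h1, h2, fun φ => supNormD2_le ((norm_nonneg _).trans (h3 φ 0)) (h3 φ)⟩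

/-- The extension of `det D²` to `B(2 - 2/N, N)`, as a distribution of order at most two. -/
def detDistribution (w : CriticalBesov N) : 𝓓'^{2}((⊤ : Opens (E N)), ℝ) :=
  ContinuousLinearMap.toUniformConvergenceCLM (RingHom.id ℝ) ℝ _
    { toFun := detPairing w
      map_add' := detPairing_add w
      map_smul' := detPairing_smul w
      cont := by
        obtain ⟨C, hC⟩ := exists_abs_detPairing_le N
        obtain ⟨q, hq, hq0, hqle⟩ := exists_continuous_supNormD2_le N
        let L : 𝓓^{2}((⊤ : Opens (E N)), ℝ) →ₗ[ℝ] ℝ :=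
          { toFun := detPairing w
            map_add' := detPairing_add w
            map_smul' := detPairing_smul w }
        refine continuous_of_continuousAt_zero L ?_
        rw [ContinuousAt, map_zero]
        refine squeeze_zero_norm (a := fun φ => |C| * ‖w‖ ^ N * q φ) (fun φ => ?_) ?_
        · refine (hC w φ).trans ?_
          have h1 := supNormD2_nonneg φ
          have h2 := hqle φ
          have h3 := le_abs_self C
          gcongr
        · have := (hq.tendsto 0).const_mul (|C| * ‖w‖ ^ N)
          rwa [hq0, mul_zero] at this }

@[simp]
theorem detDistribution_apply (w : CriticalBesov N) (φ : 𝓓^{2}((⊤ : Opens (E N)), ℝ)) :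
    detDistribution w φ = detPairing w φ := rfl

/-- Convergence of distributions here is uniform on compact sets of test functions. There the
continuous majorant of `supNormD2` is bounded, so the difference estimate is uniform. -/
theorem continuous_detDistribution :
    Continuous (detDistribution : CriticalBesov N → 𝓓'^{2}((⊤ : Opens (E N)), ℝ)) := by
  obtain ⟨C, hC⟩ := exists_abs_detPairing_sub_le N
  obtain ⟨q, hq, -, hqle⟩ := exists_continuous_supNormD2_le N
  refine continuous_iff_continuousAt.2 fun w => ?_
  rw [ContinuousAt, UniformConvergenceCLM.tendsto_iff_tendstoUniformlyOn]
  intro S hS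
  obtain ⟨B, hB⟩ := hS.exists_bound_of_continuousOn hq.continuousOn
  rw [Metric.tendstoUniformlyOn_iff]
  intro ε hε
  have hlim := tendsto_difference_bound (tendsto_const_nhds (x := w))
    (Filter.tendsto_id (x := nhds w)) |C| |B|
  simp only [sub_self, norm_zero, mul_zero, zero_mul, id] at hlim
  filter_upwards [hlim.eventually (gt_mem_nhds hε)] with w' hw' φ hφ
  refine lt_of_le_of_lt ?_ hw'
  rw [Real.dist_eq, detDistribution_apply, detDistribution_apply]
  refine (hC w w' φ).trans ?_
  have h1 := supNormD2_nonneg φ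
  have h2 : supNormD2 φ ≤ |B| := (hqle φ).trans
    ((le_abs_self _).trans ((hB φ hφ).trans (le_abs_self B)))
  have h3 := le_abs_self C
  gcongr

/-- The extension of `det D²` to `B(2 - 2/N, N)`. -/
def hessianDet (w : CriticalBesov N) : 𝓓'((⊤ : Opens (E N)), ℝ) :=
  (TestFunction.monoCLM ℝ : 𝓓((⊤ : Opens (E N)), ℝ) →L[ℝ]
    𝓓^{2}((⊤ : Opens (E N)), ℝ)).precompCompactConvergenceCLM ℝ (detDistribution w)

theorem continuous_hessianDet :
    Continuous (hessianDet : CriticalBesov N → 𝓓'((⊤ : Opens (E N)), ℝ)) :=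
  (ContinuousLinearMap.continuous _).comp continuous_detDistribution

theorem tendsto_hessianDet {w : CriticalBesov N} {v : ℕ → CriticalBesov N}
    {u : ℕ → E N → ℝ} (h : IsApprox w v u) (φ : 𝓓((⊤ : Opens (E N)), ℝ)) :
    Filter.Tendsto (fun n => ∫ x, (hessian (u n) x).det * φ x) Filter.atTop
      (nhds (hessianDet w φ)) := by
  have := tendsto_detPairing h (TestFunction.monoCLM ℝ φ)
  rwa [coe_monoCLM] at this

/-- The determinants of mollifications of `u` converge both to the extension at `w`, by
construction, and to the classical integral. -/
theorem extendsHessianDet_hessianDet :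
    ExtendsHessianDet (hessianDet : CriticalBesov N → 𝓓'((⊤ : Opens (E N)), ℝ)) := by
  intro u
  obtain ⟨w, hw, v, k, hk, h⟩ := exists_isApprox_mollify u.contDiff u.hasCompactSupport
  refine ⟨w, hw, fun φ => tendsto_nhds_unique (tendsto_hessianDet h φ) ?_⟩
  exact (tendsto_integral_det_hessian_mollify u.contDiff u.hasCompactSupport φ.continuous
    φ.hasCompactSupport).comp hk

/-- A continuous extension of `det D²` is determined by its values on smooth functions. -/
theorem ExtendsHessianDet.eq_hessianDet {H : CriticalBesov N → 𝓓'((⊤ : Opens (E N)), ℝ)}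
    (hH : ExtendsHessianDet H) (hc : Continuous H) : H = hessianDet := by
  ext w φ
  obtain ⟨v, u, h⟩ := exists_isApprox w
  refine tendsto_nhds_unique ?_ (tendsto_hessianDet h φ)
  have h1 : Filter.Tendsto (fun n => H (v n) φ) Filter.atTop (nhds (H w φ)) :=
    ((continuous_eval_const φ).comp hc).tendsto w |>.comp h.tendsto
  refine h1.congr fun n => ?_
  have hr := h.isSmoothRep n
  -- The smooth `u n` is itself an admissible `C_c^2` function. The element representing it must be
  -- `v n`, because the inclusion into `L^p` is injective.
  obtain ⟨w', hw', hval⟩ := hH ⟨u n, hr.contDiff_two, hr.hasCompactSupport, by simp⟩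
  have : w' = v n := Besov.toLp_injective (Lp.ext (hw'.trans hr.ae_eq.symm))
  rw [← this]
  exact hval φ

end Distribution

end HessianDet

end

/-! ### The main theorem -/

open HessianDet in
theorem corollary1 (N : ℕ) [Fact (3 ≤ N)] :
    ∃ H : CriticalBesov N → 𝓓'((⊤ : Opens (E N)), ℝ),
      -- `H` is a continuous extension of `u ↦ det(D²u)`, and the only one
      Continuous H ∧ ExtendsHessianDet H ∧
      (∀ H' : CriticalBesov N → 𝓓'((⊤ : Opens (E N)), ℝ),
        Continuous H' → ExtendsHessianDet H' → H' = H) ∧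
      -- the estimate, with a constant that depends only on `N`
      ∃ C : ℝ,
        (∀ (u₁ u₂ : CriticalBesov N) (φ : 𝓓((⊤ : Opens (E N)), ℝ)),
          |(H u₁ - H u₂) φ| ≤
            C * ‖u₁ - u₂‖ * (‖u₁‖ ^ (N - 1) + ‖u₂‖ ^ (N - 1)) * supNormD2 φ) ∧
        -- each `H u` has order at most two, and the estimate holds for `φ ∈ C_c^2` as well
        ∃ T : CriticalBesov N → 𝓓'^{2}((⊤ : Opens (E N)), ℝ),
          (∀ (u : CriticalBesov N) (φ : 𝓓^{2}((⊤ : Opens (E N)), ℝ))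
            (ψ : 𝓓((⊤ : Opens (E N)), ℝ)), (φ : E N → ℝ) = ψ → T u φ = H u ψ) ∧
          ∀ (u₁ u₂ : CriticalBesov N) (φ : 𝓓^{2}((⊤ : Opens (E N)), ℝ)),
            |(T u₁ - T u₂) φ| ≤
              C * ‖u₁ - u₂‖ * (‖u₁‖ ^ (N - 1) + ‖u₂‖ ^ (N - 1)) * supNormD2 φ := by
  -- This estimate holds for `C_c^2` test functions; the smooth case is its restriction along the
  -- inclusion, so both share the constant `C`.
  obtain ⟨C, hC⟩ := exists_abs_detPairing_sub_le N
  refine ⟨hessianDet, continuous_hessianDet, extendsHessianDet_hessianDet,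
    fun H' hc hH' => hH'.eq_hessianDet hc, C, fun u₁ u₂ φ => ?_, detDistribution,
    fun u φ ψ h => ?_, fun u₁ u₂ φ => hC u₁ u₂ φ⟩
  · have := hC u₁ u₂ (TestFunction.monoCLM ℝ φ)
    rwa [coe_monoCLM] at this
  · have : φ = TestFunction.monoCLM ℝ ψ := DFunLike.coe_injective (h.trans (coe_monoCLM ψ).symm)
    rw [this]
    rfl
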